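/- **Setting.** Let $X=(\Omega,\mathscr F,(\mathscr F_t)_{t\ge0},(X_t)_{t\ge0},(\theta_t)_{t\ge0},(\mathbb P_x)_{x\in E})$ be a conservative Borel right process: a time-homogeneous Markov process with values in a metric space $E$ with its Borel $\sigma$-algebra, Borel transition laws, right-continuous paths, $\mathbb P_x(X_0=x)=1$, shift operators $\theta_t$ with $X_s\circ\theta_t=X_{t+s}$, and the strong Markov property with respect to the right-continuous filtration $(\mathscr F_{t+})$. Here $(\mathscr F_t)$ is the filtration generated by $X$, completed with the $\mathbb P_\mu$-null sets for all initial distributions $\mu$. Let $S$ be a Markovian pricing kernel: an adapted, strictly positive process with $S_0=1$, with $S_{t+s}=S_t\,(S_s\circ\theta_t)$ almost surely for all $s,t\ge0$, which under every $\mathbb P_x$ is a semimartingale with strictly positive left limits, and with $\mathbb E_x[S_t]<\infty$ for all $t\ge 0$ and $x\in E$. (A semimartingale is an adapted process with right-continuous paths with left limits which is a good integrator, that is, equivalently, the sum of a local martingale and an adapted process of finite variation; under $\mathbb P_x$, adaptedness and properties of paths are understood up to $\mathbb P_x$-null sets.) Write $P(t,x)=\mathbb E_x[S_t]$ and $(\mathscr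 P_tf)(x)=\mathbb E_x[S_tf(X_t)]$. Under $\mathbb P_x$ let $P_t^T=\mathbb E_x[S_T\mid\mathscr F_t]/S_t$ for $t\le T$. For $T>0$ let $B^T$ be the value of the roll-over strategy, that is, the process with right-continuous paths with left limits such that, almost surely for each $t$, $$B_t^T=\Big(\prod_{i=0}^kP_{iT}^{(i+1)T}\Big)^{-1}P_t^{(k+1)T},\qquad k=\lfloor t/T\rfloor ,$$ and let $\mathbb Q^T|_{\mathscr F_t}=S_tB_t^T\,\mathbb P_x|_{\mathscr F_t}$ be the $T$-forward measure. The *long bond* $B^\infty(x)$ under $\mathbb P_x$ is a strictly positive semimartingale to which $B^T$ converges uniformly on compacts in $\mathbb P_x$-probability as $T\to\infty$. The *long forward measure* $\mathbb L_x$ is a consistent family of probability measures on the $\mathscr F_t$, $t\ge0$, equivalent to $\mathbb P_x$ on each $\mathscr F_t$, with $\mathbb Q^T(A)\to\mathbb L_x(A)$ as $T\to\infty$ for all $t\ge0$ and $A\in\mathscr F_t$. **Theorem.** Suppose that for each $x\in E$ and each $t>0$ there is a $\mathbb P_x$-almost surely positive $\mathscr F_t$-measurable random variable $M_t^\infty$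 with $$\frac{\mathbb E_x[S_T\mid\mathscr F_t]}{\mathbb E_x[S_T]}\longrightarrow M_t^\infty\quad\text{in }L^1(\mathbb P_x)\text{ as }T\to\infty,$$ and that for all $t>0$ and $x,y\in E$ the ratio $P(T-t,y)/P(T,x)$ converges to a (finite) positive limit as $T\to\infty$. Then there are $\lambda_L\in\mathbb R$ and a universally measurable function $\pi_L:E\to(0,\infty)$ such that: 1. $\pi_L$ is an eigenfunction of the pricing operators: $\mathscr P_t\pi_L(x)=e^{-\lambda_Lt}\pi_L(x)$ for all $t\ge0$, $x\in E$ (the expectation being finite). 2. $e^{\lambda_Lt}\pi_L(X_t)/\pi_L(X_0)$ is a positive multiplicative functional of $X$, and for each $x\in E$ the long bond under $\mathbb P_x$ exists and is given by $$B_t^\infty(x)=e^{\lambda_Lt}\,\frac{\pi_L(X_t)}{\pi_L(x)}\qquad\mathbb P_x\text{-almost surely, for each }t\ge0.$$ 3. The pricing kernel has the Hansen–Scheinkman eigen-factorization $S_t=M_t^{\pi_L}\,e^{-\lambda_Lt}\,\pi_L(X_0)/\pi_L(X_t)$, in which $e^{-\lambda_Lt}\pi_L(X_0)/\pi_L(X_t)$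 is a positive multiplicative functional and $M_t^{\pi_L}=S_te^{\lambda_Lt}\pi_L(X_t)/\pi_L(X_0)$ is a positive multiplicative functional that is a $\mathbb P_x$-martingale for each $x\in E$. 4. For each $x\in E$ the long forward measure $\mathbb L_x$ exists and equals the eigen-measure: $\mathbb L_x|_{\mathscr F_t}=\mathbb Q_x^{\pi_L}|_{\mathscr F_t}:=M_t^{\pi_L}\,\mathbb P_x|_{\mathscr F_t}$ for each $t\ge0$. -/

import Mathlib

open MeasureTheory Filter Topology Set
open scoped NNReal ENNReal symmDiff

noncomputable section

namespace LongForward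

/-! ### Paths, semimartingales and convergence for a single probability measure -/

section SingleMeasure

/-- A path is right-continuous with left limits. -/
def IsRCLL (f : ℝ≥0 → ℝ) : Prop :=
  (∀ t, ContinuousWithinAt f (Ici t) t) ∧ ∀ t, 0 < t → ∃ l, Tendsto f (𝓝[<] t) (𝓝 l)

variable {Ω : Type*} {mΩ : MeasurableSpace Ω}

/-- A simple predictable integrand
`H = H₀ 1_{0} + ∑_{i < n} H_i 1_{(τ_i, τ_{i+1}]}`, where `τ_0 ≤ τ_1 ≤ …` are finite stopping
times, `H₀` is `F_0`-measurable and `H_i` is `F_{τ_i}`-measurable. -/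
structure SimplePredictable (F : Filtration ℝ≥0 mΩ) where
  n : ℕ
  τ : ℕ → Ω → ℝ≥0
  isStoppingTime : ∀ i, IsStoppingTime F (fun ω => (τ i ω : WithTop ℝ≥0))
  mono : ∀ i ω, τ i ω ≤ τ (i + 1) ω
  H₀ : Ω → ℝ
  measurable_H₀ : Measurable[F 0] H₀
  H : ℕ → Ω → ℝ
  measurable_H : ∀ i, Measurable[(isStoppingTime i).measurableSpace] (H i)

namespace SimplePredictable

variable {F : Filtration ℝ≥0 mΩ}

/-- The integrand is bounded by `δ`. -/
def BoundedBy (H : SimplePredictable F) (δ : ℝ) : Prop :=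
  (∀ ω, |H.H₀ ω| ≤ δ) ∧ ∀ i ω, |H.H i ω| ≤ δ

/-- The elementary stochastic integral `H₀ X_0 + ∫_0^t H dX`. -/
def integral (H : SimplePredictable F) (X : ℝ≥0 → Ω → ℝ) (t : ℝ≥0) (ω : Ω) : ℝ :=
  H.H₀ ω * X 0 ω +
    ∑ i ∈ Finset.range H.n,
      H.H i ω * (X (min (H.τ (i + 1) ω) t) ω - X (min (H.τ i ω) t) ω)

end SimplePredictable

/-- Semimartingales, by the definition in Protter's book: an adapted RCLL process `X` such that for each `t` the elementary integral `H ↦ H₀ X_0 + ∫_0^t H dX` is continuous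
from the simple predictable processes with the topology of uniform convergence to the random
variables with convergence in probability (the map is linear, so this is continuity at `0`).
These are the sums of a local martingale and an adapted process of finite variation.
Adaptedness and regularity of paths are up to `μ`-null sets, that is, `X` is adapted to the
augmentation of `F` by the `μ`-null sets. -/
structure IsSemimartingale (F : Filtration ℝ≥0 mΩ) (μ : Measure Ω) (X : ℝ≥0 → Ω → ℝ) : Prop where
  adapted : ∀ t, AEStronglyMeasurable[F t] (X t) μ
  rcll : ∀ᵐ ω ∂μ, IsRCLL (fun t => X t ω)
  good_integrator : ∀ t : ℝ≥0, ∀ ε : ℝ, 0 < ε → ∃ δ : ℝ, 0 < δ ∧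
    ∀ H : SimplePredictable F, H.BoundedBy δ →
      μ {ω | ε ≤ |H.integral X t ω|} ≤ ENNReal.ofReal ε

/-- Uniform convergence on compacts in probability of `V T` to `Y`, as `T → ∞`; the event is
`{sup_{s ≤ t} |V T s - Y s| > K}`. -/
def TendstoUCP (μ : Measure Ω) (V : ℝ≥0 → ℝ≥0 → Ω → ℝ) (Y : ℝ≥0 → Ω → ℝ) : Prop :=
  ∀ t : ℝ≥0, ∀ K : ℝ, 0 < K →
    Tendsto (fun T => μ {ω | ∃ s ≤ t, K < |V T s ω - Y s ω|}) atTop (𝓝 0)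

end SingleMeasure

/-! ### Borel right processes -/

section Family

variable {E Ω : Type*} [MeasurableSpace E]

/-- The `σ`-algebra generated by the random variables `X_s`, `s ∈ I`. -/
@[reducible] def rawSigma (X : ℝ≥0 → Ω → E) (I : Set ℝ≥0) : MeasurableSpace Ω :=
  ⨆ s ∈ I, MeasurableSpace.comap (X s) inferInstance

/-- `A` is contained in a set `N` of the `σ`-algebra generated by `X` with `P_μ(N) = 0`, where
`P_μ = ∫ P_x μ(dx)`. -/
def IsNullSet [MeasurableSpace Ω] (X : ℝ≥0 → Ω → E) (P : E → Measure Ω) (μ : Measure E)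
    (A : Set Ω) : Prop :=
  ∃ N, MeasurableSet[rawSigma X univ] N ∧ A ⊆ N ∧ ∀ᵐ x ∂μ, P x N = 0

/-- The `σ`-algebra `⋂_μ σ(X_s, s ∈ I; P_μ-null sets)`, with `μ` ranging over all initial
distributions. -/
@[reducible] def completedSigma [MeasurableSpace Ω] (X : ℝ≥0 → Ω → E) (P : E → Measure Ω) (I : Set ℝ≥0) :
    MeasurableSpace Ω where
  MeasurableSet' A := ∀ μ : Measure E, IsProbabilityMeasure μ →
    ∃ A', MeasurableSet[rawSigma X I] A' ∧ IsNullSet X P μ (A ∆ A')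
  measurableSet_empty μ _ :=
    ⟨∅, @MeasurableSet.empty _ (rawSigma X I), ∅, @MeasurableSet.empty _ (rawSigma X univ),
      by simp, by simp⟩
  measurableSet_compl A hA μ hμ := by
    obtain ⟨A', hA', hN⟩ := hA μ hμ
    exact ⟨A'ᶜ, hA'.compl, by rwa [compl_symmDiff_compl]⟩
  measurableSet_iUnion A hA μ hμ := by
    choose A' hA' N hN hsub hnull using fun i => hA i μ hμ
    refine ⟨⋃ i, A' i, MeasurableSet.iUnion hA', ⋃ i, N i, MeasurableSet.iUnion hN, ?_, ?_⟩
    · intro ω hω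
      have key : ∃ i, ω ∈ A i ∆ A' i := by
        rcases hω with ⟨h1, h2⟩ | ⟨h1, h2⟩
        · obtain ⟨i, hi⟩ := mem_iUnion.1 h1
          exact ⟨i, Or.inl ⟨hi, fun h => h2 (mem_iUnion.2 ⟨i, h⟩)⟩⟩
        · obtain ⟨i, hi⟩ := mem_iUnion.1 h1
          exact ⟨i, Or.inr ⟨hi, fun h => h2 (mem_iUnion.2 ⟨i, h⟩)⟩⟩
      obtain ⟨i, hi⟩ := key
      exact mem_iUnion.2 ⟨i, hsub i hi⟩
    · filter_upwards [ae_all_iff.2 hnull] with x hx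
      exact measure_iUnion_null hx

theorem completedSigma_mono [MeasurableSpace Ω] (X : ℝ≥0 → Ω → E) (P : E → Measure Ω)
    {I J : Set ℝ≥0} (h : I ⊆ J) : completedSigma X P I ≤ completedSigma X P J := by
  intro A hA μ hμ
  obtain ⟨A', hA', hN⟩ := hA μ hμ
  have hle : rawSigma X I ≤ rawSigma X J := biSup_mono fun _ hs => h hs
  exact ⟨A', hle _ hA', hN⟩

/-- The filtration generated by `X`, completed with the `P_μ`-null sets for all initial
distributions `μ`. -/
def completedFiltration [mΩ : MeasurableSpace Ω] (X : ℝ≥0 → Ω → E) (P : E → Measure Ω)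
    (h : completedSigma X P univ ≤ mΩ) : Filtration ℝ≥0 mΩ where
  seq t := completedSigma X P (Iic t)
  mono' _ _ hst := completedSigma_mono X P (Iic_subset_Iic.2 hst)
  le' _ := (completedSigma_mono X P (subset_univ _)).trans h

end Family

/-- A conservative Borel right process with state space `E`: a time-homogeneous Markov family
`(P_x)` with Borel transition laws and right-continuous paths which never leave `E`, with shift
operators `θ`, and with the strong Markov property. -/
structure BorelRightProc (E Ω : Type*) [MetricSpace E] [MeasurableSpace E] [BorelSpace E]
    [mΩ : MeasurableSpace Ω] where
  X : ℝ≥0 → Ω → E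
  θ : ℝ≥0 → Ω → Ω
  P : E → Measure Ω
  isProbabilityMeasure : ∀ x, IsProbabilityMeasure (P x)
  /-- the ambient `σ`-algebra contains the completion of the `σ`-algebra generated by `X` -/
  completed_le : completedSigma X P univ ≤ mΩ
  /-- `x ↦ P_x(A)` is Borel for each event `A` generated by `X` -/
  measurable_P : ∀ A, MeasurableSet[rawSigma X univ] A → Measurable fun x => P x A
  X_zero : ∀ x, ∀ᵐ ω ∂P x, X 0 ω = x
  X_shift : ∀ s t ω, X s (θ t ω) = X (t + s) ω
  right_continuous : ∀ ω t, ContinuousWithinAt (fun s => X s ω) (Ici t) t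
  /-- The strong Markov property at every stopping time `τ` of the right-continuous filtration
  `(F_{t+})`: given `F_{τ+}`, on `{τ < ∞}` the law of `X_{τ+s}` is that of `X_s` under `P_{X_τ}`.
  (Taken at constant times, it shows that `(F_t)` itself is right-continuous.) -/
  strong_markov : ∀ (τ : Ω → WithTop ℝ≥0)
    (hτ : IsStoppingTime (completedFiltration X P completed_le).rightCont τ)
    (A : Set Ω), MeasurableSet[hτ.measurableSpace] A →
    ∀ (s : ℝ≥0) (f : E → ℝ≥0∞), Measurable f → ∀ x,
      ∫⁻ ω in A ∩ {ω | τ ω ≠ ⊤}, f (X ((τ ω).untopD 0 + s) ω) ∂P x =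
        ∫⁻ ω in A ∩ {ω | τ ω ≠ ⊤}, (∫⁻ ω', f (X s ω') ∂P (X ((τ ω).untopD 0) ω)) ∂P x

namespace BorelRightProc

variable {E Ω : Type*} [MetricSpace E] [MeasurableSpace E] [BorelSpace E]
  [mΩ : MeasurableSpace Ω]

/-- The filtration `(F_t)` of the process. -/
def F (𝒳 : BorelRightProc E Ω) : Filtration ℝ≥0 mΩ :=
  completedFiltration 𝒳.X 𝒳.P 𝒳.completed_le

/-- `Z` is a positive multiplicative functional of the process: adapted, with `Z_0 = 1`,
strictly positive, and `Z_{t+s} = Z_t · Z_s ∘ θ_t`, almost surely for each starting point. -/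
structure IsPosMultiplicativeFunctional (𝒳 : BorelRightProc E Ω) (Z : ℝ≥0 → Ω → ℝ) :
    Prop where
  adapted : ∀ t, Measurable[𝒳.F t] (Z t)
  zero : ∀ x, ∀ᵐ ω ∂𝒳.P x, Z 0 ω = 1
  pos : ∀ x, ∀ᵐ ω ∂𝒳.P x, ∀ t, 0 < Z t ω
  mul : ∀ t s x, ∀ᵐ ω ∂𝒳.P x, Z (t + s) ω = Z t ω * Z s (𝒳.θ t ω)

/-- A Markovian pricing kernel: a positive semimartingale multiplicative functional with strictly
positive left limits and `E_x[S_t] < ∞`. -/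
structure IsMarkovianPricingKernel (𝒳 : BorelRightProc E Ω) (S : ℝ≥0 → Ω → ℝ) : Prop where
  multiplicative : 𝒳.IsPosMultiplicativeFunctional S
  semimartingale : ∀ x, IsSemimartingale 𝒳.F (𝒳.P x) S
  left_limits_pos : ∀ x, ∀ᵐ ω ∂𝒳.P x, ∀ t, 0 < t →
    ∃ l, 0 < l ∧ Tendsto (fun s => S s ω) (𝓝[<] t) (𝓝 l)
  integrable : ∀ t x, Integrable (S t) (𝒳.P x)

variable (𝒳 : BorelRightProc E Ω) (S : ℝ≥0 → Ω → ℝ)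

/-- The bond pricing function `P(t, x) = E_x[S_t]`. -/
def bondPrice (t : ℝ≥0) (x : E) : ℝ := ∫ ω, S t ω ∂𝒳.P x

/-- The ratio `E_x[S_T | F_t] / E_x[S_T]` converges in `L¹(P_x)`, as `T → ∞`, to an almost surely
positive `F_t`-measurable random variable, for each `t > 0`. -/
def LongTermL1 (x : E) : Prop :=
  ∀ t : ℝ≥0, 0 < t → ∃ M : Ω → ℝ, StronglyMeasurable[𝒳.F t] M ∧ (∀ᵐ ω ∂𝒳.P x, 0 < M ω) ∧
    Tendsto (fun T : ℝ≥0 =>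
      eLpNorm (fun ω => ((𝒳.P x)[S T | 𝒳.F t]) ω / 𝒳.bondPrice S T x - M ω) 1 (𝒳.P x))
      atTop (𝓝 0)

/-- The value `P_t^T = E_x[S_T / S_t | F_t] = E_x[S_T | F_t] / S_t` at time `t` of the zero-coupon
bond with maturity `T`. -/
def zeroCoupon (x : E) (T t : ℝ≥0) (ω : Ω) : ℝ := ((𝒳.P x)[S T | 𝒳.F t]) ω / S t ω

/-- The value `B_t^T` at time `t` of one unit of account rolled over in zero-coupon bonds with
compounding interval `T`: with `k = ⌊t / T⌋`, it is
`(∏_{i=0}^{k} P_{iT}^{(i+1)T})⁻¹ P_t^{(k+1)T}`. -/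
def rollover (x : E) (T t : ℝ≥0) (ω : Ω) : ℝ :=
  (∏ i ∈ Finset.range (⌊t / T⌋₊ + 1), 𝒳.zeroCoupon S x ((i + 1 : ℕ) * T) (i * T) ω)⁻¹ *
    𝒳.zeroCoupon S x ((⌊t / T⌋₊ + 1 : ℕ) * T) t ω

/-- `V` is the RCLL version, under `P_x`, of the roll-over value process `B^T`. -/
def IsRolloverProc (x : E) (T : ℝ≥0) (V : ℝ≥0 → Ω → ℝ) : Prop :=
  (∀ᵐ ω ∂𝒳.P x, IsRCLL (fun t => V t ω)) ∧ ∀ t, V t =ᵐ[𝒳.P x] 𝒳.rollover S x T t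

/-- `Y` is the long bond under `P_x`: a strictly positive semimartingale to which the roll-over
value processes `B^T` converge uniformly on compacts in probability as `T → ∞`. -/
def IsLongBond (x : E) (Y : ℝ≥0 → Ω → ℝ) : Prop :=
  IsSemimartingale 𝒳.F (𝒳.P x) Y ∧ (∀ᵐ ω ∂𝒳.P x, ∀ t, 0 < Y t ω) ∧
    ∃ V : ℝ≥0 → ℝ≥0 → Ω → ℝ, (∀ T, 0 < T → 𝒳.IsRolloverProc S x T (V T)) ∧
      TendstoUCP (𝒳.P x) V Y

/-- The restriction to `F_t` of the `T`-forward measure, `Q^T = S_t B_t^T · P_x` on `F_t`. -/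
def forwardMeasure (x : E) (T t : ℝ≥0) : @Measure Ω (𝒳.F t) :=
  ((𝒳.P x).withDensity fun ω => ENNReal.ofReal (S t ω * 𝒳.rollover S x T t ω)).trim (𝒳.F.le t)

/-- `L` (given by its restrictions `L t` to the `σ`-algebras `F_t`, which are consistent
probability measures) is the long forward measure under `P_x`: it is equivalent to `P_x` on each
`F_t`, and `Q^T(A) → L(A)` as `T → ∞` for each `A ∈ F_t` and each `t`. -/
def IsLongForwardMeasure (x : E) (L : (t : ℝ≥0) → @Measure Ω (𝒳.F t)) : Prop :=
  (∀ t, L t univ = 1) ∧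
  (∀ s t, s ≤ t → ∀ A, MeasurableSet[𝒳.F s] A → L s A = L t A) ∧
  (∀ t A, MeasurableSet[𝒳.F t] A → (L t A = 0 ↔ 𝒳.P x A = 0)) ∧
  ∀ t A, MeasurableSet[𝒳.F t] A →
    Tendsto (fun T => 𝒳.forwardMeasure S x T t A) atTop (𝓝 (L t A))

/-- `π` is a positive (universally measurable) eigenfunction of the pricing operators
`(𝒫_t f)(x) = E_x[S_t f(X_t)]` with eigenvalues `e^{-λ t}`. -/
structure IsPosEigenfunction (lam : ℝ) (π : E → ℝ) : Prop where
  pos : ∀ x, 0 < π x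
  universally_measurable : ∀ μ : Measure E, IsProbabilityMeasure μ → AEMeasurable π μ
  integrable : ∀ t x, Integrable (fun ω => S t ω * π (𝒳.X t ω)) (𝒳.P x)
  eigen : ∀ (t : ℝ≥0) x,
    ∫ ω, S t ω * π (𝒳.X t ω) ∂𝒳.P x = Real.exp (-lam * t) * π x

/-- The transition independent functional `e^{λ t} π(X_t) / π(X_0)`. -/
def transitionIndependent (lam : ℝ) (π : E → ℝ) (t : ℝ≥0) (ω : Ω) : ℝ :=
  Real.exp (lam * t) * π (𝒳.X t ω) / π (𝒳.X 0 ω)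

/-- The process `M_t^π = S_t e^{λ t} π(X_t) / π(X_0)`. -/
def eigenMartingale (lam : ℝ) (π : E → ℝ) (t : ℝ≥0) (ω : Ω) : ℝ :=
  S t ω * Real.exp (lam * t) * π (𝒳.X t ω) / π (𝒳.X 0 ω)

/-- The restriction to `F_t` of the eigen-measure `Q^π_x`, that is `M_t^π · P_x` on `F_t`. -/
def eigenMeasure (lam : ℝ) (π : E → ℝ) (x : E) (t : ℝ≥0) : @Measure Ω (𝒳.F t) :=
  ((𝒳.P x).withDensity fun ω => ENNReal.ofReal (𝒳.eigenMartingale S lam π t ω)).trim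
    (𝒳.F.le t)

/-- The eigen-factorization `S_t = M_t^π e^{-λ t} π(X_0) / π(X_t)` of the pricing kernel, in which
`M^π` is a positive martingale (under each `P_x`) and a multiplicative functional, and the other
factor is a multiplicative functional too. -/
structure HasEigenFactorization (lam : ℝ) (π : E → ℝ) : Prop where
  martingale : ∀ x, Martingale (𝒳.eigenMartingale S lam π) 𝒳.F (𝒳.P x)
  multiplicative : 𝒳.IsPosMultiplicativeFunctional (𝒳.eigenMartingale S lam π)
  multiplicative' : 𝒳.IsPosMultiplicativeFunctional
    fun t ω => Real.exp (-lam * t) * π (𝒳.X 0 ω) / π (𝒳.X t ω)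
  factorization : ∀ t ω, S t ω =
    𝒳.eigenMartingale S lam π t ω * (Real.exp (-lam * t) * π (𝒳.X 0 ω) / π (𝒳.X t ω))

end BorelRightProc

end LongForward

end

/-! Multiplicativity of `S` and the Markov property give `E_x[S_T | F_t] = S_t P(T - t, X_t)`
(`IsMarkovianPricingKernel.condExp_eq`), so the normalized price `E_x[S_T | F_t] / E_x[S_T]` is `S_t
P(T - t, X_t) / P(T, x)`. Fix a reference point `x₀` and let `π y` be the limit of `P(T, y) / P(T,
x₀)`. The limit of `P(T - t, x₀) / P(T, x₀)` is multiplicative and measurable in `t`, hence equal to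
`e^{λt}` (`exists_exponent`). Thus `P(T - t, y) / P(T, x)` tends to `e^{λt} π y / π x`, and the
assumed `L¹`-limit of the normalized prices can only be `M^π` (`HasLongTermLimit.tendsto_eLpNorm`).

Integrals of the normalized prices over a set known at time `s` do not depend on the conditioning
time in `[s, T]`; by `L¹`-convergence the same holds for `M^π`, which is therefore a martingale of
mean one. This is the eigenfunction equation. For `t < T` the density `S_t B_t^T` is the normalized
price itself, so `Q^T(A)` converges to the integral of `M^π` over `A`.

The long bond takes most of the work, since `π` is only universally measurable and `π(X_t)` has no
evident path regularity. Doob regularization supplies a right-continuous version of `M^π` with left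
limits (`dyadicLim_ae_eq`). It needs a right-continuous filtration, and for this reason the Markov
property is proved for sets in `F_{t+}`. The long bond is this version divided by `S`. Uniform
convergence in probability follows from Doob's maximal inequality for the difference of two
martingales, as `1 / S` is locally bounded thanks to the positive left limits.

That the quotient is a semimartingale is proved with good integrators. Stopping times are rounded up
to a grid, so deterministic grids suffice (`IsGridIntegrator.isSemimartingale`). Nonnegative
martingales satisfy a weak-type bound (`measure_transform_le`). Quotients are expanded to first
order, the remainder being controlled by sums of squared increments (`IsGridIntegrator.mul_inv`). -/

namespace LongForward

/-! ### Completed and uncompleted σ-algebras -/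

section Completion

variable {E Ω : Type*} [MeasurableSpace E]

theorem measurable_rawSigma (X : ℝ≥0 → Ω → E) {I : Set ℝ≥0} {s : ℝ≥0} (hs : s ∈ I) :
    Measurable[rawSigma X I] (X s) :=
  Measurable.of_comap_le (le_iSup₂_of_le s hs le_rfl)

theorem rawSigma_le_completedSigma [MeasurableSpace Ω] (X : ℝ≥0 → Ω → E) (P : E → Measure Ω)
    (I : Set ℝ≥0) : rawSigma X I ≤ completedSigma X P I :=
  fun A hA μ _ => ⟨A, hA, ∅, @MeasurableSet.empty _ (rawSigma X univ), by simp, by simp⟩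

/-- A function which is measurable for the completed `σ`-algebra agrees off a `P_μ`-null set with
a function which is measurable for the uncompleted one. -/
theorem exists_rawSigma_version [MeasurableSpace Ω] {X : ℝ≥0 → Ω → E} {P : E → Measure Ω}
    {I : Set ℝ≥0} {g : Ω → ℝ≥0∞} (hg : Measurable[completedSigma X P I] g) (μ : Measure E)
    [hμ : IsProbabilityMeasure μ] :
    ∃ g' : Ω → ℝ≥0∞, Measurable[rawSigma X I] g' ∧ IsNullSet X P μ {ω | g ω ≠ g' ω} := by
  have hq : ∀ q : ℚ, MeasurableSet[completedSigma X P I] {ω | ENNReal.ofReal q < g ω} :=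
    fun q => @measurableSet_lt _ _ _ _ _ (completedSigma X P I) _ _ _ _ _
      (@measurable_const _ _ _ (completedSigma X P I) _) hg
  choose A' hA' N hN hsub hnull using fun q => hq q μ hμ
  -- A function is the supremum of the rational levels below it; each level set `{q < g}` is
  -- replaced by its uncompleted version `A' q`.
  refine ⟨fun ω => ⨆ q : ℚ, (A' q).indicator (fun _ => ENNReal.ofReal q) ω, ?_, ⋃ q, N q,
    MeasurableSet.iUnion hN, ?_, ?_⟩
  · exact Measurable.iSup fun q => (@measurable_const _ _ _ (rawSigma X I) _).indicator (hA' q)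
  · intro ω hω
    by_contra hcon
    simp only [mem_iUnion, not_exists] at hcon
    have hiff : ∀ q : ℚ, ENNReal.ofReal q < g ω ↔ ω ∈ A' q := by
      intro q
      have h1 : ω ∉ {ω | ENNReal.ofReal q < g ω} ∆ A' q := fun h => hcon q (hsub q h)
      simp only [mem_symmDiff, mem_ofPred_eq, not_or, not_and, not_not] at h1
      exact ⟨h1.1, h1.2⟩
    apply hω
    apply le_antisymm
    · refine le_of_forall_lt fun c hc => ?_
      obtain ⟨q, hq0, hcq, hqg⟩ := ENNReal.lt_iff_exists_rat_btwn.1 hc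
      refine lt_of_lt_of_le hcq (le_iSup_of_le q ?_)
      have hqg' : ENNReal.ofReal q < g ω := hqg
      rw [indicator_of_mem ((hiff q).1 hqg')]
      exact le_rfl
    · refine iSup_le fun q => ?_
      by_cases h : ω ∈ A' q
      · rw [indicator_of_mem h]
        exact ((hiff q).2 h).le
      · rw [indicator_of_notMem h]
        exact bot_le
  · filter_upwards [ae_all_iff.2 hnull] with x hx
    exact measure_iUnion_null hx

end Completion

/-! ### The Markov property for the whole future, given `F_{t+}` -/

namespace BorelRightProc

variable {E Ω : Type*} [MetricSpace E] [MeasurableSpace E] [BorelSpace E]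
  [mΩ : MeasurableSpace Ω]

instance (𝒳 : BorelRightProc E Ω) (x : E) : IsProbabilityMeasure (𝒳.P x) :=
  𝒳.isProbabilityMeasure x

variable (𝒳 : BorelRightProc E Ω)

theorem rawSigma_le : rawSigma 𝒳.X univ ≤ mΩ :=
  (rawSigma_le_completedSigma 𝒳.X 𝒳.P univ).trans 𝒳.completed_le

theorem measurable_X (t : ℝ≥0) : Measurable (𝒳.X t) :=
  (measurable_rawSigma 𝒳.X (mem_univ t)).mono 𝒳.rawSigma_le le_rfl

theorem measurable_X_F {s t : ℝ≥0} (h : s ≤ t) : Measurable[𝒳.F t] (𝒳.X s) :=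
  (measurable_rawSigma 𝒳.X (I := Iic t) h).mono
    (rawSigma_le_completedSigma 𝒳.X 𝒳.P (Iic t)) le_rfl

theorem F_le_completedSigma (t : ℝ≥0) : 𝒳.F t ≤ completedSigma 𝒳.X 𝒳.P univ :=
  completedSigma_mono 𝒳.X 𝒳.P (subset_univ _)

theorem measurable_θ (t : ℝ≥0) : Measurable[rawSigma 𝒳.X univ, rawSigma 𝒳.X univ] (𝒳.θ t) := by
  refine @Measurable.of_le_map _ _ (rawSigma 𝒳.X univ) (rawSigma 𝒳.X univ) _ ?_
  refine iSup₂_le fun s _ => ?_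
  rw [MeasurableSpace.comap_le_iff_le_map, MeasurableSpace.map_comp]
  have h : 𝒳.X s ∘ 𝒳.θ t = 𝒳.X (t + s) := funext fun ω => 𝒳.X_shift s t ω
  rw [h]
  exact (measurable_rawSigma 𝒳.X (mem_univ (t + s))).le_map

theorem measurable_θ' (t : ℝ≥0) : Measurable[mΩ, rawSigma 𝒳.X univ] (𝒳.θ t) :=
  (𝒳.measurable_θ t).mono 𝒳.rawSigma_le le_rfl

theorem F_le_rightCont (t : ℝ≥0) : 𝒳.F t ≤ 𝒳.F.rightCont t := 𝒳.F.le_rightCont t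

/-- The strong Markov property at a constant time. Sets of `F_{t+}`, and not only of `F_t`, are
allowed here and below because regularization needs martingales of the right-continuous filtration.
-/
theorem markov_X (t : ℝ≥0) (x : E) {A : Set Ω} (hA : MeasurableSet[𝒳.F.rightCont t] A)
    (s : ℝ≥0) {f : E → ℝ≥0∞} (hf : Measurable f) :
    ∫⁻ ω in A, f (𝒳.X (t + s) ω) ∂𝒳.P x =
      ∫⁻ ω in A, (∫⁻ ω', f (𝒳.X s ω') ∂𝒳.P (𝒳.X t ω)) ∂𝒳.P x := by
  have h := 𝒳.strong_markov (fun _ => (t : WithTop ℝ≥0)) (isStoppingTime_const _ t) A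
    (by rw [IsStoppingTime.measurableSpace_const]; exact hA) s f hf x
  have h0 : {_ω : Ω | (t : WithTop ℝ≥0) ≠ ⊤} = univ :=
    eq_univ_of_forall fun _ => WithTop.coe_ne_top
  simp only [h0, inter_univ] at h
  exact h

theorem inter_preimage_θ_cylinder (a v : ℝ≥0) (J : Finset ℝ≥0) (hv : v ≤ a) (haJ : ∀ s ∈ J, a < s)
    (B : ℝ≥0 → Set E) :
    (⋂ s ∈ insert a J, 𝒳.X (s - v) ⁻¹' B s) =
      𝒳.X (a - v) ⁻¹' B a ∩ 𝒳.θ (a - v) ⁻¹' ⋂ s ∈ J, 𝒳.X (s - a) ⁻¹' B s := by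
  rw [Finset.set_biInter_insert]
  congr 1
  ext ω
  simp only [mem_iInter, mem_preimage, 𝒳.X_shift]
  refine forall₂_congr fun s hs => ?_
  rw [add_comm, tsub_add_tsub_cancel (haJ s hs).le hv]

theorem measurableSet_cylinder (v : ℝ≥0) (J : Finset ℝ≥0) {B : ℝ≥0 → Set E}
    (hB : ∀ s, MeasurableSet (B s)) :
    MeasurableSet[rawSigma 𝒳.X univ] (⋂ s ∈ J, 𝒳.X (s - v) ⁻¹' B s) :=
  Finset.measurableSet_biInter J fun s _ => measurable_rawSigma 𝒳.X (mem_univ _) (hB s)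

/-- The axiom of the process speaks of a single future time only. Finitely many times are handled by
induction, splitting off the smallest one, `a`: the process restarts there, and the remaining times
are counted from `a`. For this reason the origin `v` is kept variable. -/
theorem markov_cylinder (J : Finset ℝ≥0) {B : ℝ≥0 → Set E} (hB : ∀ s, MeasurableSet (B s)) :
    ∀ v : ℝ≥0, (∀ s ∈ J, v ≤ s) → ∀ (t : ℝ≥0) (x : E) (A : Set Ω),
      MeasurableSet[𝒳.F.rightCont t] A →
      𝒳.P x (A ∩ 𝒳.θ t ⁻¹' ⋂ s ∈ J, 𝒳.X (s - v) ⁻¹' B s) =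
        ∫⁻ ω in A, 𝒳.P (𝒳.X t ω) (⋂ s ∈ J, 𝒳.X (s - v) ⁻¹' B s) ∂𝒳.P x := by
  induction J using Finset.induction_on_min with
  | empty => intro v _ t x A hA; simp
  | insert a J haJ ih =>
    intro v hv t x A hA
    have hva : v ≤ a := hv a (Finset.mem_insert_self a J)
    set C := ⋂ s ∈ J, 𝒳.X (s - a) ⁻¹' B s with hC
    have hCm : MeasurableSet[rawSigma 𝒳.X univ] C := 𝒳.measurableSet_cylinder a J hB
    have ih' := ih a fun s hs => (haJ s hs).le
    rw [𝒳.inter_preimage_θ_cylinder a v J hva haJ B, ← hC]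
    have hX : ∀ u w : ℝ≥0, MeasurableSet[𝒳.F.rightCont (u + w)] (𝒳.X (u + w) ⁻¹' B a) :=
      fun u w => 𝒳.F_le_rightCont _ _ (𝒳.measurable_X_F le_rfl (hB a))
    have hA' : MeasurableSet[𝒳.F.rightCont (t + (a - v))] A :=
      𝒳.F.rightCont.mono (le_self_add) _ hA
    -- The induction hypothesis is used under `P_y` here, and again below under `P_x` at the later
    -- time `t + (a - v)`; the two are linked by the one-time Markov property.
    have key : ∀ y, 𝒳.P y (𝒳.X (a - v) ⁻¹' B a ∩ 𝒳.θ (a - v) ⁻¹' C) =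
        ∫⁻ ω, (B a).indicator (fun z => 𝒳.P z C) (𝒳.X (a - v) ω) ∂𝒳.P y := by
      intro y
      have h0 := hX 0 (a - v)
      rw [zero_add] at h0
      rw [ih' (a - v) y _ h0, ← lintegral_indicator (𝒳.measurable_X _ (hB a))]
      rfl
    simp_rw [key]
    rw [← 𝒳.markov_X t x hA (a - v) ((𝒳.measurable_P C hCm).indicator (hB a))]
    have hset : A ∩ 𝒳.θ t ⁻¹' (𝒳.X (a - v) ⁻¹' B a ∩ 𝒳.θ (a - v) ⁻¹' C) =
        (A ∩ 𝒳.X (t + (a - v)) ⁻¹' B a) ∩ 𝒳.θ (t + (a - v)) ⁻¹' C := by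
      ext ω
      simp only [hC, mem_inter_iff, mem_preimage, mem_iInter, 𝒳.X_shift, and_assoc, add_assoc]
    have hBm := 𝒳.measurable_X (t + (a - v)) (hB a)
    rw [hset, ih' (t + (a - v)) x _ (hA'.inter (hX t (a - v))), inter_comm,
      ← Measure.restrict_restrict hBm, ← lintegral_indicator hBm]
    rfl

/-- The law of the process started from `y`, on the uncompleted `σ`-algebra. -/
noncomputable def rawLaw (y : E) : @Measure Ω (rawSigma 𝒳.X univ) := (𝒳.P y).trim 𝒳.rawSigma_le

theorem rawLaw_apply (y : E) {B : Set Ω} (hB : MeasurableSet[rawSigma 𝒳.X univ] B) :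
    𝒳.rawLaw y B = 𝒳.P y B := trim_measurableSet_eq _ hB

theorem measurable_rawLaw : @Measurable E (@Measure Ω (rawSigma 𝒳.X univ)) _
    (@Measure.instMeasurableSpace Ω (rawSigma 𝒳.X univ)) 𝒳.rawLaw := by
  refine @Measure.measurable_of_measurable_coe Ω E (rawSigma 𝒳.X univ) _ _ fun B hB => ?_
  simp_rw [𝒳.rawLaw_apply _ hB]
  exact 𝒳.measurable_P B hB

theorem lintegral_rawLaw (y : E) {g : Ω → ℝ≥0∞} (hg : Measurable[rawSigma 𝒳.X univ] g) :
    (@lintegral Ω (rawSigma 𝒳.X univ) (𝒳.rawLaw y) g) = ∫⁻ ω, g ω ∂𝒳.P y :=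
  lintegral_trim 𝒳.rawSigma_le hg

theorem measurable_lintegral_P {g : Ω → ℝ≥0∞} (hg : Measurable[rawSigma 𝒳.X univ] g) :
    Measurable fun y => ∫⁻ ω, g ω ∂𝒳.P y := by
  simp_rw [← 𝒳.lintegral_rawLaw _ hg]
  exact (@Measure.measurable_lintegral Ω (rawSigma 𝒳.X univ) g hg).comp 𝒳.measurable_rawLaw

/-- Both sides are finite measures with the same mass which agree on finite-dimensional cylinders, a
π-system generating the uncompleted σ-algebra. -/
theorem markov_measure (t : ℝ≥0) (x : E) {A : Set Ω} (hA : MeasurableSet[𝒳.F.rightCont t] A) :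
    @Measure.map Ω Ω mΩ (rawSigma 𝒳.X univ) (𝒳.θ t) ((𝒳.P x).restrict A) =
      @Measure.bind E Ω _ (rawSigma 𝒳.X univ) (((𝒳.P x).restrict A).map (𝒳.X t)) 𝒳.rawLaw := by
  have hbind : ∀ B, MeasurableSet[rawSigma 𝒳.X univ] B →
      (@Measure.bind E Ω _ (rawSigma 𝒳.X univ) (((𝒳.P x).restrict A).map (𝒳.X t)) 𝒳.rawLaw) B =
        ∫⁻ ω in A, 𝒳.P (𝒳.X t ω) B ∂𝒳.P x := by
    intro B hB
    rw [@Measure.bind_apply _ _ _ (rawSigma 𝒳.X univ) _ _ _ hB 𝒳.measurable_rawLaw.aemeasurable]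
    simp_rw [𝒳.rawLaw_apply _ hB]
    exact lintegral_map (𝒳.measurable_P B hB) (𝒳.measurable_X t)
  have hmap : ∀ B, MeasurableSet[rawSigma 𝒳.X univ] B →
      (@Measure.map Ω Ω mΩ (rawSigma 𝒳.X univ) (𝒳.θ t) ((𝒳.P x).restrict A)) B =
        𝒳.P x (A ∩ 𝒳.θ t ⁻¹' B) := by
    intro B hB
    rw [@Measure.map_apply Ω Ω mΩ (rawSigma 𝒳.X univ) _ _ (𝒳.measurable_θ' t) _ hB,
      Measure.restrict_apply (𝒳.measurable_θ' t hB), inter_comm]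
  have hfin : @IsFiniteMeasure Ω (rawSigma 𝒳.X univ)
      (@Measure.map Ω Ω mΩ (rawSigma 𝒳.X univ) (𝒳.θ t) ((𝒳.P x).restrict A)) :=
    @Measure.isFiniteMeasure_map Ω Ω (rawSigma 𝒳.X univ) mΩ ((𝒳.P x).restrict A) _ (𝒳.θ t)
  refine @ext_of_generate_finite Ω (rawSigma 𝒳.X univ) _ _ (piiUnionInter
    (fun n => {s | MeasurableSet[MeasurableSpace.comap (𝒳.X n) inferInstance] s}) univ)
    (generateFrom_piiUnionInter_measurableSet _ _).symm ?_ hfin ?_ ?_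
  · exact isPiSystem_piiUnionInter _ (fun n => @MeasurableSpace.isPiSystem_measurableSet Ω
      (MeasurableSpace.comap (𝒳.X n) inferInstance)) _
  · rintro _ ⟨J, _, f, hf, rfl⟩
    choose! B hB hBf using hf
    classical
    -- The factors are extended by the whole space off `J`, and times are written with origin `0`,
    -- to match `markov_cylinder`.
    have hset : ⋂ s ∈ J, f s =
        ⋂ s ∈ J, 𝒳.X (s - 0) ⁻¹' (fun s => if s ∈ J then B s else univ) s := by
      refine iInter₂_congr fun s hs => ?_
      simp [hs, hBf s hs]
    have hBm : ∀ s, MeasurableSet ((fun s => if s ∈ J then B s else univ) s) := by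
      intro s
      by_cases h : s ∈ J
      · simpa [h] using hB s h
      · simp [h]
    rw [hset, hbind _ (𝒳.measurableSet_cylinder 0 J hBm), hmap _ (𝒳.measurableSet_cylinder 0 J hBm)]
    exact 𝒳.markov_cylinder J hBm 0 (fun s _ => zero_le) t x A hA
  · rw [hmap _ (@MeasurableSet.univ _ (rawSigma 𝒳.X univ)),
      hbind _ (@MeasurableSet.univ _ (rawSigma 𝒳.X univ))]
    simp

theorem markov_rawSigma (t : ℝ≥0) (x : E) {A : Set Ω} (hA : MeasurableSet[𝒳.F.rightCont t] A)
    {g : Ω → ℝ≥0∞} (hg : Measurable[rawSigma 𝒳.X univ] g) :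
    ∫⁻ ω in A, g (𝒳.θ t ω) ∂𝒳.P x =
      ∫⁻ ω in A, (∫⁻ ω', g ω' ∂𝒳.P (𝒳.X t ω)) ∂𝒳.P x := by
  rw [← @lintegral_map Ω Ω mΩ (rawSigma 𝒳.X univ) _ g _ hg (𝒳.measurable_θ' t),
    𝒳.markov_measure t x hA, @Measure.lintegral_bind _ _ _ (rawSigma 𝒳.X univ) _ _ _
      𝒳.measurable_rawLaw.aemeasurable (@Measurable.aemeasurable _ _ (rawSigma 𝒳.X univ) _ _ _ hg)]
  simp_rw [𝒳.lintegral_rawLaw _ hg]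
  exact lintegral_map (𝒳.measurable_lintegral_P hg) (𝒳.measurable_X t)

/-- A `P_ν`-null set, `ν` being the law of `X_t`, is shifted to a null set. -/
theorem ae_shift_of_isNullSet (t : ℝ≥0) (x : E) {A : Set Ω}
    (hA : IsNullSet 𝒳.X 𝒳.P ((𝒳.P x).map (𝒳.X t)) A) :
    (∀ᵐ ω ∂𝒳.P x, 𝒳.θ t ω ∉ A) ∧ ∀ᵐ ω ∂𝒳.P x, 𝒳.P (𝒳.X t ω) A = 0 := by
  obtain ⟨N, hN, hsub, hnull⟩ := hA
  have h0 : ∀ᵐ ω ∂𝒳.P x, 𝒳.P (𝒳.X t ω) N = 0 :=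
    ae_of_ae_map (𝒳.measurable_X t).aemeasurable hnull
  refine ⟨?_, ?_⟩
  · have h1 := 𝒳.markov_rawSigma t x (A := univ) (@MeasurableSet.univ _ (𝒳.F.rightCont t))
      (g := N.indicator fun _ => 1) ((@measurable_const _ _ _ (rawSigma 𝒳.X univ) 1).indicator hN)
    have h2 : ∫⁻ ω in univ, N.indicator (fun _ => (1 : ℝ≥0∞)) (𝒳.θ t ω) ∂𝒳.P x =
        𝒳.P x (𝒳.θ t ⁻¹' N) := by
      rw [Measure.restrict_univ, ← lintegral_indicator_one (𝒳.measurable_θ' t hN)]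
      rfl
    have h3 : ∫⁻ ω in univ, (∫⁻ ω', N.indicator (fun _ => (1 : ℝ≥0∞)) ω'
        ∂𝒳.P (𝒳.X t ω)) ∂𝒳.P x = 0 := by
      simp_rw [lintegral_indicator_const (𝒳.rawSigma_le _ hN), one_mul]
      rw [Measure.restrict_univ]
      exact (lintegral_congr_ae h0).trans lintegral_zero
    rw [h2, h3] at h1
    have h4 : ∀ᵐ ω ∂𝒳.P x, ω ∉ 𝒳.θ t ⁻¹' N := measure_eq_zero_iff_ae_notMem.1 h1
    filter_upwards [h4] with ω hω h using hω (hsub h)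
  · filter_upwards [h0] with ω hω using measure_mono_null hsub hω

/-- The Markov property, for functions measurable with respect to the completion and
sets in `F_{t+}`. -/
theorem markov_completed (t : ℝ≥0) (x : E) {A : Set Ω} (hA : MeasurableSet[𝒳.F.rightCont t] A)
    {g : Ω → ℝ≥0∞} (hg : Measurable[completedSigma 𝒳.X 𝒳.P univ] g) :
    ∫⁻ ω in A, g (𝒳.θ t ω) ∂𝒳.P x =
      ∫⁻ ω in A, (∫⁻ ω', g ω' ∂𝒳.P (𝒳.X t ω)) ∂𝒳.P x := by
  have := Measure.isProbabilityMeasure_map (μ := 𝒳.P x) (𝒳.measurable_X t).aemeasurable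
  obtain ⟨g', hg', hN⟩ := exists_rawSigma_version hg ((𝒳.P x).map (𝒳.X t))
  obtain ⟨h1, h2⟩ := 𝒳.ae_shift_of_isNullSet t x hN
  have e1 : ∫⁻ ω in A, g (𝒳.θ t ω) ∂𝒳.P x = ∫⁻ ω in A, g' (𝒳.θ t ω) ∂𝒳.P x :=
    lintegral_congr_ae (ae_restrict_of_ae (h1.mono fun ω hω => by simpa using hω))
  have e2 : ∫⁻ ω in A, (∫⁻ ω', g ω' ∂𝒳.P (𝒳.X t ω)) ∂𝒳.P x =
      ∫⁻ ω in A, (∫⁻ ω', g' ω' ∂𝒳.P (𝒳.X t ω)) ∂𝒳.P x :=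
    lintegral_congr_ae (ae_restrict_of_ae (h2.mono fun ω hω =>
      lintegral_congr_ae (show ∀ᵐ _ ∂_, _ from hω)))
  rw [e1, e2, 𝒳.markov_rawSigma t x hA hg']

/-- The shift is only known to be measurable into the uncompleted σ-algebra, so `g` is first
replaced by its version for the law of `X_t` as initial distribution. -/
theorem aemeasurable_shift (t : ℝ≥0) (x : E) {g : Ω → ℝ≥0∞}
    (hg : Measurable[completedSigma 𝒳.X 𝒳.P univ] g) :
    AEMeasurable (fun ω => g (𝒳.θ t ω)) (𝒳.P x) := by
  have := Measure.isProbabilityMeasure_map (μ := 𝒳.P x) (𝒳.measurable_X t).aemeasurable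
  obtain ⟨g', hg', hN⟩ := exists_rawSigma_version hg ((𝒳.P x).map (𝒳.X t))
  obtain ⟨h1, _⟩ := 𝒳.ae_shift_of_isNullSet t x hN
  exact ⟨fun ω => g' (𝒳.θ t ω),
    @Measurable.comp _ _ _ mΩ (rawSigma 𝒳.X univ) _ _ _ hg' (𝒳.measurable_θ' t),
    h1.mono fun ω hω => by simpa using hω⟩

theorem aemeasurable_lintegral_P {g : Ω → ℝ≥0∞}
    (hg : Measurable[completedSigma 𝒳.X 𝒳.P univ] g) (μ : Measure E) [IsProbabilityMeasure μ] :
    AEMeasurable (fun y => ∫⁻ ω, g ω ∂𝒳.P y) μ := by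
  obtain ⟨g', hg', N, _, hsub, hnull⟩ := exists_rawSigma_version hg μ
  refine ⟨_, 𝒳.measurable_lintegral_P hg', ?_⟩
  filter_upwards [hnull] with y hy
  exact lintegral_congr_ae (measure_mono_null hsub hy)

/-- Functions of `X_t` which are universally measurable are measurable for the completed
filtration. -/
theorem measurable_comp_X {f : E → ℝ}
    (hf : ∀ μ : Measure E, IsProbabilityMeasure μ → AEMeasurable f μ) (t : ℝ≥0) :
    Measurable[𝒳.F t] fun ω => f (𝒳.X t ω) := by
  intro B hB μ hμ
  -- Universal measurability of `f` is applied to the law of `X_t` under `P_μ`, which is this kernel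
  -- averaged over `μ`.
  have hκ : Measurable fun x => (𝒳.P x).map (𝒳.X t) := by
    refine Measure.measurable_of_measurable_coe _ fun C hC => ?_
    simp_rw [Measure.map_apply (𝒳.measurable_X t) hC]
    exact 𝒳.measurable_P _ (measurable_rawSigma 𝒳.X (mem_univ t) hC)
  have hbind : ∀ C, MeasurableSet C → (μ.bind fun x => (𝒳.P x).map (𝒳.X t)) C =
      ∫⁻ x, 𝒳.P x (𝒳.X t ⁻¹' C) ∂μ := by
    intro C hC
    rw [Measure.bind_apply hC hκ.aemeasurable]
    simp_rw [Measure.map_apply (𝒳.measurable_X t) hC]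
  have hprob : IsProbabilityMeasure (μ.bind fun x => (𝒳.P x).map (𝒳.X t)) :=
    ⟨by rw [hbind _ MeasurableSet.univ]; simp⟩
  obtain ⟨f', hf', hae⟩ := hf _ hprob
  obtain ⟨N, hsub, hN, hN0⟩ := exists_measurable_superset_of_null (ae_iff.1 hae)
  refine ⟨(fun ω => f' (𝒳.X t ω)) ⁻¹' B,
    (hf'.comp (measurable_rawSigma 𝒳.X (I := Iic t) (mem_Iic.2 le_rfl))) hB, 𝒳.X t ⁻¹' N,
    measurable_rawSigma 𝒳.X (mem_univ t) hN, ?_, ?_⟩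
  · intro ω hω
    refine hsub fun h => ?_
    simp [mem_symmDiff, h] at hω
  · rw [hbind _ hN, lintegral_eq_zero_iff
      (𝒳.measurable_P _ (measurable_rawSigma 𝒳.X (mem_univ t) hN))] at hN0
    exact hN0

end BorelRightProc

end LongForward

namespace LongForward

/-! ### Dyadic approximation of times from above -/

/-- The smallest multiple of `2⁻ᵐ` which is greater than `t`. -/
noncomputable def dyadicAbove (m : ℕ) (t : ℝ≥0) : ℝ≥0 := ((⌊t * 2 ^ m⌋₊ + 1 : ℕ) : ℝ≥0) / 2 ^ m

theorem lt_dyadicAbove (m : ℕ) (t : ℝ≥0) : t < dyadicAbove m t := by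
  rw [dyadicAbove, lt_div_iff₀ (by positivity)]
  push_cast
  exact Nat.lt_floor_add_one _

theorem dyadicAbove_le (m : ℕ) (t : ℝ≥0) : dyadicAbove m t ≤ t + (1 / 2) ^ m := by
  have h2 : (0 : ℝ≥0) < 2 ^ m := by positivity
  have h3 : (1 / 2 : ℝ≥0) ^ m * 2 ^ m = 1 := by rw [← mul_pow]; simp
  rw [dyadicAbove, div_le_iff₀ h2, add_mul, h3]
  push_cast
  gcongr
  exact Nat.floor_le zero_le

theorem tendsto_dyadicAbove (t : ℝ≥0) :
    Tendsto (fun m => dyadicAbove m t) atTop (𝓝[>] t) := by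
  rw [tendsto_nhdsWithin_iff]
  refine ⟨?_, Eventually.of_forall fun m => lt_dyadicAbove m t⟩
  have h : Tendsto (fun m : ℕ => t + (1 / 2 : ℝ≥0) ^ m) atTop (𝓝 (t + 0)) :=
    tendsto_const_nhds.add (tendsto_pow_atTop_nhds_zero_of_lt_one zero_le
      (by rw [div_lt_one] <;> norm_num))
  rw [add_zero] at h
  exact tendsto_of_tendsto_of_tendsto_of_le_of_le tendsto_const_nhds h
    (fun m => (lt_dyadicAbove m t).le) fun m => dyadicAbove_le m t

/-- The mean of an almost surely right-continuous process is a measurable function of time. -/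
theorem measurable_lintegral_of_right_continuous {Ω : Type*} [MeasurableSpace Ω]
    (μ : Measure Ω) [SFinite μ] {X : ℝ≥0 → Ω → ℝ} (hX : ∀ t, Measurable (X t))
    (hr : ∀ᵐ ω ∂μ, ∀ t, ContinuousWithinAt (fun s => X s ω) (Ici t) t) :
    Measurable fun t => ∫⁻ ω, ENNReal.ofReal (X t ω) ∂μ := by
  -- At level `m` the rounded time has countably many values, so the rounded process is jointly
  -- measurable; by right-continuity its limsup is almost surely the process itself.
  have hm : ∀ m : ℕ, Measurable fun p : ℝ≥0 × Ω => ENNReal.ofReal (X (dyadicAbove m p.1) p.2) := by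
    intro m
    have h1 : Measurable fun p : ℕ × Ω => X (((p.1 + 1 : ℕ) : ℝ≥0) / 2 ^ m) p.2 :=
      measurable_from_prod_countable_right fun k => hX (((k + 1 : ℕ) : ℝ≥0) / 2 ^ m)
    have h2 : Measurable fun p : ℝ≥0 × Ω => (⌊p.1 * 2 ^ m⌋₊, p.2) :=
      (Nat.measurable_floor.comp (measurable_fst.mul_const _)).prodMk measurable_snd
    exact (h1.comp h2).ennreal_ofReal
  have h := (Measurable.limsup hm).lintegral_prod_right' (ν := μ)
  convert! h using 1
  ext t
  refine lintegral_congr_ae ?_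
  filter_upwards [hr] with ω hω
  refine (Tendsto.limsup_eq ?_).symm
  exact (ENNReal.continuous_ofReal.tendsto _).comp
    ((((hω t).mono Ioi_subset_Ici_self).tendsto).comp (tendsto_dyadicAbove t))

/-! ### Regular variation -/

theorem tendsto_tsub_atTop_nnreal (t : ℝ≥0) : Tendsto (fun T : ℝ≥0 => T - t) atTop atTop :=
  tendsto_atTop.2 fun b => (eventually_ge_atTop (b + t)).mono fun _ hT => le_tsub_of_add_le_right hT

/-- If `p(T - t) / p(T)` converges to a positive limit for each `t > 0`, then the limit is an
exponential function of `t`. -/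
theorem exists_exponent {p : ℝ≥0 → ℝ} (hpos : ∀ t, 0 < p t) (hmeas : Measurable p)
    (hlim : ∀ t : ℝ≥0, 0 < t → ∃ b : ℝ, 0 < b ∧
      Tendsto (fun T : ℝ≥0 => p (T - t) / p T) atTop (𝓝 b)) :
    ∃ lam : ℝ, ∀ t : ℝ≥0, Tendsto (fun T : ℝ≥0 => p (T - t) / p T) atTop
      (𝓝 (Real.exp (lam * t))) := by
  set l : ℝ → ℝ := fun a => Real.log (p a.toNNReal) with hl
  have hlm : Measurable l := Real.measurable_log.comp (hmeas.comp measurable_real_toNNReal)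
  -- Extending `p` by `p 0` to negative times makes real subtraction agree with truncated
  -- subtraction, so that shifts by any real number make sense below.
  have hsub : ∀ a r : ℝ, 0 ≤ r →
      l (a - r) - l a = Real.log (p (a.toNNReal - r.toNNReal) / p a.toNNReal) := by
    intro a r hr
    rw [Real.log_div (hpos _).ne' (hpos _).ne', hl]
    simp only
    congr 3
    rw [NNReal.sub_def]
    rcases le_total 0 a with ha | ha
    · rw [Real.coe_toNNReal _ ha, Real.coe_toNNReal _ hr]
    · rw [Real.toNNReal_of_nonpos (by linarith : a - r ≤ 0), Real.toNNReal_of_nonpos]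
      rw [Real.toNNReal_of_nonpos ha, Real.coe_toNNReal _ hr]
      simpa using hr
  have hpos_lim : ∀ r : ℝ, 0 < r → ∃ c, Tendsto (fun a => l (a - r) - l a) atTop (𝓝 c) := by
    intro r hr
    obtain ⟨b, hb, hT⟩ := hlim r.toNNReal (Real.toNNReal_pos.2 hr)
    refine ⟨Real.log b, ?_⟩
    simp_rw [fun a => hsub a r hr.le]
    exact ((Real.continuousAt_log hb.ne').tendsto.comp hT).comp Real.tendsto_toNNReal_atTop
  have hall : ∀ r : ℝ, ∃ c, Tendsto (fun a => l (a - r) - l a) atTop (𝓝 c) := by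
    intro r
    rcases lt_trichotomy r 0 with hr | hr | hr
    · obtain ⟨c, hc⟩ := hpos_lim (-r) (by linarith)
      refine ⟨-c, ?_⟩
      have h := (hc.comp (tendsto_atTop_add_const_right atTop (-r) tendsto_id)).neg
      refine h.congr fun a => ?_
      simp only [Function.comp, id]
      rw [show a + -r - -r = a by ring, show a + -r = a - r by ring]
      ring
    · exact ⟨0, by simp [hr]⟩
    · exact hpos_lim r hr
  choose L hL using hall
  -- Cauchy's functional equation; a measurable solution, here a pointwise limit along the integers,
  -- is continuous and therefore linear.
  have hadd : ∀ r s, L (r + s) = L r + L s := by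
    intro r s
    have h1 : Tendsto (fun a => l (a - s - r) - l (a - s)) atTop (𝓝 (L r)) :=
      (hL r).comp (tendsto_atTop_add_const_right atTop (-s) tendsto_id)
    refine tendsto_nhds_unique (hL (r + s)) ((h1.add (hL s)).congr fun a => ?_)
    rw [show a - (r + s) = a - s - r by ring]
    ring
  let Lh : ℝ →+ ℝ := AddMonoidHom.mk' L hadd
  have hLm : Measurable Lh := by
    refine measurable_of_tendsto_metrizable (f := fun (n : ℕ) r => l (n - r) - l n) (fun n => ?_) ?_
    · exact (hlm.comp (measurable_const.sub measurable_id)).sub measurable_const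
    · rw [tendsto_pi_nhds]
      exact fun r => (hL r).comp tendsto_natCast_atTop_atTop
  have hlin : ∀ r : ℝ, L r = L 1 * r := by
    intro r
    have h := map_real_smul Lh (Measure.AddMonoidHom.continuous_of_measurable Lh hLm) r 1
    simp only [smul_eq_mul, mul_one] at h
    rw [mul_comm]
    exact h
  refine ⟨L 1, fun t => ?_⟩
  have h1 : Tendsto (fun T : ℝ≥0 => l (T - t) - l T) atTop (𝓝 (L 1 * t)) := by
    rw [← hlin]
    exact (hL t).comp (NNReal.tendsto_coe_atTop.2 tendsto_id)
  refine ((Real.continuous_exp.tendsto _).comp h1).congr fun T => ?_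
  simp only [Function.comp]
  rw [hsub T t t.2, Real.exp_log (div_pos (hpos _) (hpos _)), Real.toNNReal_coe, Real.toNNReal_coe]

/-! ### Bond prices and conditional expectations of the pricing kernel -/

namespace BorelRightProc

variable {E Ω : Type*} [MetricSpace E] [MeasurableSpace E] [BorelSpace E]
  [mΩ : MeasurableSpace Ω]
variable (𝒳 : BorelRightProc E Ω)

/-- The two densities define the same measure on `F_{t+}` by the Markov property, so they integrate
every `F_{t+}`-measurable weight alike. No integrability is needed in this form. -/
theorem markov_weighted (t : ℝ≥0) (x : E) {w : Ω → ℝ≥0∞} (hw : Measurable[𝒳.F.rightCont t] w)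
    {g : Ω → ℝ≥0∞} (hg : Measurable[completedSigma 𝒳.X 𝒳.P univ] g) :
    ∫⁻ ω, g (𝒳.θ t ω) * w ω ∂𝒳.P x =
      ∫⁻ ω, (∫⁻ ω', g ω' ∂𝒳.P (𝒳.X t ω)) * w ω ∂𝒳.P x := by
  have := Measure.isProbabilityMeasure_map (μ := 𝒳.P x) (𝒳.measurable_X t).aemeasurable
  have hle := 𝒳.F.rightCont.le t
  have hu : AEMeasurable (fun ω => g (𝒳.θ t ω)) (𝒳.P x) := 𝒳.aemeasurable_shift t x hg
  have hv : AEMeasurable (fun ω => ∫⁻ ω', g ω' ∂𝒳.P (𝒳.X t ω)) (𝒳.P x) :=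
    (𝒳.aemeasurable_lintegral_P hg _).comp_measurable (𝒳.measurable_X t)
  have hw' : Measurable w := hw.mono hle le_rfl
  have heq : ((𝒳.P x).withDensity fun ω => g (𝒳.θ t ω)).trim hle =
      ((𝒳.P x).withDensity fun ω => ∫⁻ ω', g ω' ∂𝒳.P (𝒳.X t ω)).trim hle := by
    refine @Measure.ext _ (𝒳.F.rightCont t) _ _ fun A hA => ?_
    rw [trim_measurableSet_eq hle hA, trim_measurableSet_eq hle hA,
      withDensity_apply _ (hle _ hA), withDensity_apply _ (hle _ hA), 𝒳.markov_completed t x hA hg]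
  have h1 := lintegral_withDensity_eq_lintegral_mul₀ hu hw'.aemeasurable
  have h2 := lintegral_withDensity_eq_lintegral_mul₀ hv hw'.aemeasurable
  rw [← lintegral_trim hle hw] at h1 h2
  exact h1.symm.trans ((congrArg (fun ν => ∫⁻ ω, w ω ∂ν) heq).trans h2)

variable {𝒳} {S : ℝ≥0 → Ω → ℝ} (hS : 𝒳.IsMarkovianPricingKernel S)
include hS

theorem IsMarkovianPricingKernel.measurable_F (t : ℝ≥0) : Measurable[𝒳.F t] (S t) :=
  hS.multiplicative.adapted t

theorem IsMarkovianPricingKernel.measurable (t : ℝ≥0) : Measurable (S t) :=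
  (hS.measurable_F t).mono (𝒳.F.le t) le_rfl

theorem IsMarkovianPricingKernel.bondPrice_pos (t : ℝ≥0) (x : E) : 0 < 𝒳.bondPrice S t x := by
  have hpos := hS.multiplicative.pos x
  refine (integral_pos_iff_support_of_nonneg_ae (hpos.mono fun ω h => (h t).le)
    (hS.integrable t x)).2 ?_
  have h1 : 𝒳.P x (Function.support (S t)) = 𝒳.P x univ :=
    measure_congr (eventuallyEq_univ.2 (hpos.mono fun ω h => (h t).ne'))
  rw [h1]
  simp

theorem IsMarkovianPricingKernel.ofReal_bondPrice (t : ℝ≥0) (x : E) :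
    ENNReal.ofReal (𝒳.bondPrice S t x) = ∫⁻ ω, ENNReal.ofReal (S t ω) ∂𝒳.P x :=
  ofReal_integral_eq_lintegral_ofReal (hS.integrable t x)
    ((hS.multiplicative.pos x).mono fun _ h => (h t).le)

/-- Since `S_t` is measurable only for the completed σ-algebra, bond prices, and with them `π`, are
universally measurable rather than Borel. -/
theorem IsMarkovianPricingKernel.aemeasurable_bondPrice (t : ℝ≥0) (μ : Measure E)
    (_ : IsProbabilityMeasure μ) : AEMeasurable (𝒳.bondPrice S t) μ := by
  have h : 𝒳.bondPrice S t = fun x => (∫⁻ ω, ENNReal.ofReal (S t ω) ∂𝒳.P x).toReal := by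
    ext x
    rw [← hS.ofReal_bondPrice, ENNReal.toReal_ofReal (hS.bondPrice_pos t x).le]
  rw [h]
  exact (𝒳.aemeasurable_lintegral_P ((hS.measurable_F t).mono
    (𝒳.F_le_completedSigma t) le_rfl).ennreal_ofReal μ).ennreal_toReal

/-- Measurability in the maturity is what excludes pathological solutions of Cauchy's equation in
`exists_exponent`. -/
theorem IsMarkovianPricingKernel.measurable_bondPrice (x : E) :
    Measurable fun t => 𝒳.bondPrice S t x := by
  have h := (measurable_lintegral_of_right_continuous (𝒳.P x) hS.measurable
    ((hS.semimartingale x).rcll.mono fun ω h => h.1)).ennreal_toReal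
  convert! h using 1
  ext t
  rw [← hS.ofReal_bondPrice, ENNReal.toReal_ofReal (hS.bondPrice_pos t x).le]

/-- Write `S_{t+s} = S_t · (S_s ∘ θ_t)` and apply the weighted Markov property with weight `S_t` on
`A`. This is the source of the formula for the conditional expectations. -/
theorem IsMarkovianPricingKernel.lintegral_add (t s : ℝ≥0) (x : E) {A : Set Ω}
    (hA : MeasurableSet[𝒳.F.rightCont t] A) :
    ∫⁻ ω in A, ENNReal.ofReal (S (t + s) ω) ∂𝒳.P x =
      ∫⁻ ω in A, ENNReal.ofReal (S t ω * 𝒳.bondPrice S s (𝒳.X t ω)) ∂𝒳.P x := by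
  have hA' := 𝒳.F.rightCont.le t _ hA
  have hSt : Measurable[𝒳.F.rightCont t] fun ω => ENNReal.ofReal (S t ω) :=
    ((hS.measurable_F t).mono (𝒳.F_le_rightCont t) le_rfl).ennreal_ofReal
  have hg : Measurable[completedSigma 𝒳.X 𝒳.P univ] fun ω => ENNReal.ofReal (S s ω) :=
    ((hS.measurable_F s).mono (𝒳.F_le_completedSigma s) le_rfl).ennreal_ofReal
  have h := 𝒳.markov_weighted t x (hSt.indicator hA) hg
  rw [← lintegral_indicator hA', ← lintegral_indicator hA']
  refine Eq.trans (lintegral_congr_ae ?_) (h.trans (lintegral_congr_ae ?_))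
  · filter_upwards [hS.multiplicative.mul t s x, hS.multiplicative.pos x] with ω h1 h2
    by_cases hω : ω ∈ A
    · simp only [indicator_of_mem hω, h1]
      rw [ENNReal.ofReal_mul (h2 t).le, mul_comm]
    · simp [indicator_of_notMem hω]
  · filter_upwards [hS.multiplicative.pos x] with ω h2
    by_cases hω : ω ∈ A
    · simp only [indicator_of_mem hω]
      rw [ENNReal.ofReal_mul (h2 t).le, mul_comm, hS.ofReal_bondPrice]
    · simp [indicator_of_notMem hω]

theorem IsMarkovianPricingKernel.measurable_mul_bondPrice (t s : ℝ≥0) :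
    Measurable[𝒳.F t] fun ω => S t ω * 𝒳.bondPrice S s (𝒳.X t ω) :=
  (hS.measurable_F t).mul (𝒳.measurable_comp_X (hS.aemeasurable_bondPrice s) t)

theorem IsMarkovianPricingKernel.nonneg_mul_bondPrice (t s : ℝ≥0) (x : E) :
    0 ≤ᵐ[𝒳.P x] fun ω => S t ω * 𝒳.bondPrice S s (𝒳.X t ω) :=
  (hS.multiplicative.pos x).mono fun _ h => mul_nonneg (h t).le (hS.bondPrice_pos _ _).le

theorem IsMarkovianPricingKernel.integrable_mul_bondPrice (t s : ℝ≥0) (x : E) :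
    Integrable (fun ω => S t ω * 𝒳.bondPrice S s (𝒳.X t ω)) (𝒳.P x) := by
  refine ⟨((hS.measurable_mul_bondPrice t s).mono (𝒳.F.le t) le_rfl).aestronglyMeasurable, ?_⟩
  rw [hasFiniteIntegral_iff_ofReal (hS.nonneg_mul_bondPrice t s x)]
  have h := hS.lintegral_add t s x (A := univ) (@MeasurableSet.univ _ (𝒳.F.rightCont t))
  rw [Measure.restrict_univ] at h
  rw [← h, ← hasFiniteIntegral_iff_ofReal ((hS.multiplicative.pos x).mono fun ω h => (h _).le)]
  exact (hS.integrable _ x).2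

theorem IsMarkovianPricingKernel.setIntegral_add (t s : ℝ≥0) (x : E) {A : Set Ω}
    (hA : MeasurableSet[𝒳.F.rightCont t] A) :
    ∫ ω in A, S t ω * 𝒳.bondPrice S s (𝒳.X t ω) ∂𝒳.P x = ∫ ω in A, S (t + s) ω ∂𝒳.P x := by
  rw [integral_eq_lintegral_of_nonneg_ae (ae_restrict_of_ae (hS.nonneg_mul_bondPrice t s x))
    (hS.integrable_mul_bondPrice t s x).1.restrict, integral_eq_lintegral_of_nonneg_ae
    (ae_restrict_of_ae ((hS.multiplicative.pos x).mono fun ω h => (h _).le))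
    (hS.integrable _ x).1.restrict, hS.lintegral_add t s x hA]

/-- Conditional expectations of the pricing kernel, given a `σ`-algebra between `F_t` and
`F_{t+}`. -/
theorem IsMarkovianPricingKernel.condExp_eq {t T : ℝ≥0} (htT : t ≤ T) (x : E)
    {𝒢 : Filtration ℝ≥0 mΩ} (h1 : 𝒳.F t ≤ 𝒢 t) (h2 : 𝒢 t ≤ 𝒳.F.rightCont t) :
    (𝒳.P x)[S T | 𝒢 t] =ᵐ[𝒳.P x] fun ω => S t ω * 𝒳.bondPrice S (T - t) (𝒳.X t ω) := by
  symm
  refine ae_eq_condExp_of_forall_setIntegral_eq (𝒢.le t) (hS.integrable T x)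
    (fun s _ _ => (hS.integrable_mul_bondPrice t _ x).integrableOn) (fun s hs _ => ?_) ?_
  · rw [hS.setIntegral_add t _ x (h2 _ hs), add_tsub_cancel_of_le htT]
  · exact ((hS.measurable_mul_bondPrice t _).mono h1 le_rfl).stronglyMeasurable.aestronglyMeasurable

theorem IsMarkovianPricingKernel.condExp_F {t T : ℝ≥0} (htT : t ≤ T) (x : E) :
    (𝒳.P x)[S T | 𝒳.F t] =ᵐ[𝒳.P x] fun ω => S t ω * 𝒳.bondPrice S (T - t) (𝒳.X t ω) :=
  hS.condExp_eq htT x le_rfl (𝒳.F_le_rightCont t)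

theorem IsMarkovianPricingKernel.condExp_rightCont {t T : ℝ≥0} (htT : t ≤ T) (x : E) :
    (𝒳.P x)[S T | 𝒳.F.rightCont t] =ᵐ[𝒳.P x]
      fun ω => S t ω * 𝒳.bondPrice S (T - t) (𝒳.X t ω) :=
  hS.condExp_eq htT x (𝒳.F_le_rightCont t) le_rfl

/-- The exponent and the eigenfunction, as limits of ratios of bond prices. -/
theorem IsMarkovianPricingKernel.exists_limit_data [Nonempty E]
    (hlim : ∀ t : ℝ≥0, 0 < t → ∀ x y : E, ∃ b : ℝ, 0 < b ∧
      Tendsto (fun T : ℝ≥0 => 𝒳.bondPrice S (T - t) y / 𝒳.bondPrice S T x) atTop (𝓝 b)) :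
    ∃ (lam : ℝ) (π : E → ℝ), (∀ x, 0 < π x) ∧
      (∀ μ : Measure E, IsProbabilityMeasure μ → AEMeasurable π μ) ∧
      ∀ (t : ℝ≥0) (x y : E), Tendsto
        (fun T : ℝ≥0 => 𝒳.bondPrice S (T - t) y / 𝒳.bondPrice S T x) atTop
        (𝓝 (Real.exp (lam * t) * π y / π x)) := by
  obtain ⟨x₀⟩ := ‹Nonempty E›
  have hp := fun t x => (hS.bondPrice_pos t x).ne'
  obtain ⟨lam, hlam⟩ := exists_exponent (fun t => hS.bondPrice_pos t x₀)
    (hS.measurable_bondPrice x₀) fun t ht => hlim t ht x₀ x₀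
  have hex : ∀ y, ∃ c : ℝ, 0 < c ∧
      Tendsto (fun T : ℝ≥0 => 𝒳.bondPrice S T y / 𝒳.bondPrice S T x₀) atTop (𝓝 c) := by
    intro y
    -- The hypothesis excludes `t = 0`. Dividing the two limits at `t = 1` cancels `P(T, x₀)` and
    -- leaves `P(T - 1, y) / P(T - 1, x₀)`; then `T` is shifted by one.
    obtain ⟨b, hb, hbT⟩ := hlim 1 one_pos x₀ y
    obtain ⟨c, hc, hcT⟩ := hlim 1 one_pos x₀ x₀
    refine ⟨b / c, div_pos hb hc, ?_⟩
    have h := (hbT.div hcT hc.ne').comp (tendsto_atTop_mono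
      (fun T : ℝ≥0 => le_self_add (b := 1)) tendsto_id)
    refine h.congr fun T => ?_
    have h1 : T + 1 - 1 = T := add_tsub_cancel_right T 1
    simp only [Function.comp, Pi.div_apply, id, h1]
    exact div_div_div_cancel_right₀ (hp _ _) _ _
  choose π hπ hπT using hex
  refine ⟨lam, π, hπ, fun μ hμ => ?_, fun t x y => ?_⟩
  · refine aemeasurable_of_tendsto_metrizable_ae (atTop : Filter ℕ)
      (f := fun (n : ℕ) y => 𝒳.bondPrice S n y / 𝒳.bondPrice S n x₀)
      (fun n => (hS.aemeasurable_bondPrice n μ hμ).div_const _)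
      (ae_of_all _ fun y => (hπT y).comp tendsto_natCast_atTop_atTop)
  · have h := (((hπT y).comp (tendsto_tsub_atTop_nnreal t)).mul (hlam t)).div (hπT x) (hπ x).ne'
    rw [mul_comm (Real.exp _)]
    refine h.congr fun T => ?_
    have h1 := hp (T - t) x₀
    have h2 := hp T x₀
    have h3 := hp T x
    simp only [Function.comp, Pi.div_apply]
    field_simp

end BorelRightProc

end LongForward

/-! ### The martingale `M^π` and the long forward measure -/

namespace LongForward

namespace BorelRightProc

variable {E Ω : Type*} [MetricSpace E] [MeasurableSpace E] [BorelSpace E]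
  [mΩ : MeasurableSpace Ω]

/-- A pricing kernel for which long-term `L¹`-limits exist, and for which ratios of bond prices
converge to limits given by the exponent `lam` and the function `π`. -/
structure HasLongTermLimit (𝒳 : BorelRightProc E Ω) (S : ℝ≥0 → Ω → ℝ) (lam : ℝ) (π : E → ℝ) :
    Prop where
  kernel : 𝒳.IsMarkovianPricingKernel S
  longTerm : ∀ x, 𝒳.LongTermL1 S x
  pos : ∀ x, 0 < π x
  universally_measurable : ∀ μ : Measure E, IsProbabilityMeasure μ → AEMeasurable π μ
  tendsto : ∀ (t : ℝ≥0) (x y : E), Tendsto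
    (fun T : ℝ≥0 => 𝒳.bondPrice S (T - t) y / 𝒳.bondPrice S T x) atTop
    (𝓝 (Real.exp (lam * t) * π y / π x))

variable {𝒳 : BorelRightProc E Ω} {S : ℝ≥0 → Ω → ℝ} {lam : ℝ} {π : E → ℝ}

namespace HasLongTermLimit

variable (h : 𝒳.HasLongTermLimit S lam π)
include h

theorem measurable_π (t : ℝ≥0) : Measurable[𝒳.F t] fun ω => π (𝒳.X t ω) :=
  𝒳.measurable_comp_X h.universally_measurable t

theorem measurable_π_zero (t : ℝ≥0) : Measurable[𝒳.F t] fun ω => π (𝒳.X 0 ω) :=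
  (h.measurable_π 0).mono (𝒳.F.mono zero_le) le_rfl

theorem measurable_eigenMartingale (t : ℝ≥0) :
    Measurable[𝒳.F t] (𝒳.eigenMartingale S lam π t) :=
  (((h.kernel.measurable_F t).mul_const _).mul (h.measurable_π t)).div (h.measurable_π_zero t)

theorem eigenMartingale_pos (x : E) : ∀ᵐ ω ∂𝒳.P x, ∀ t, 0 < 𝒳.eigenMartingale S lam π t ω := by
  filter_upwards [h.kernel.multiplicative.pos x] with ω hω t
  exact div_pos (mul_pos (mul_pos (hω t) (Real.exp_pos _)) (h.pos _)) (h.pos _)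

theorem eigenMartingale_zero (x : E) : ∀ᵐ ω ∂𝒳.P x, 𝒳.eigenMartingale S lam π 0 ω = 1 := by
  filter_upwards [h.kernel.multiplicative.zero x] with ω hω
  simp [eigenMartingale, hω, (h.pos _).ne']

/-- This is the pointwise identification of the limit. Integer maturities suffice for it, and they
let the exceptional null sets of the conditional expectations be collected later. -/
theorem tendsto_ratio (t : ℝ≥0) (x : E) : ∀ᵐ ω ∂𝒳.P x, Tendsto (fun n : ℕ =>
    S t ω * 𝒳.bondPrice S ((n : ℝ≥0) - t) (𝒳.X t ω) / 𝒳.bondPrice S n x) atTop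
      (𝓝 (𝒳.eigenMartingale S lam π t ω)) := by
  filter_upwards [𝒳.X_zero x] with ω hω
  have h1 := ((h.tendsto t x (𝒳.X t ω)).comp tendsto_natCast_atTop_atTop).const_mul (S t ω)
  rw [eigenMartingale, hω, mul_assoc, mul_div_assoc]
  refine h1.congr fun n => ?_
  simp only [Function.comp]
  rw [mul_div_assoc]

omit h in
theorem integrable_ratio (T t : ℝ≥0) (x : E) : Integrable
    (fun ω => ((𝒳.P x)[S T | 𝒳.F t]) ω / 𝒳.bondPrice S T x) (𝒳.P x) :=
  integrable_condExp.div_const _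

/-- The normalized conditional expectations `E_x[S_T | F_t] / E_x[S_T]` converge in `L¹` to
the martingale `M^π`. -/
theorem tendsto_eLpNorm (t : ℝ≥0) (x : E) : Tendsto (fun T : ℝ≥0 =>
    eLpNorm ((fun ω => ((𝒳.P x)[S T | 𝒳.F t]) ω / 𝒳.bondPrice S T x) -
      𝒳.eigenMartingale S lam π t) 1 (𝒳.P x)) atTop (𝓝 0) := by
  -- At `t = 0`, where nothing is assumed, the normalized price and `M^π` are both almost surely
  -- `1`.
  rcases eq_or_ne t 0 with rfl | ht
  · refine tendsto_const_nhds.congr fun T => ?_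
    rw [eq_comm, eLpNorm_eq_zero_iff _ one_ne_zero]
    · filter_upwards [h.kernel.condExp_F (zero_le (a := T)) x, 𝒳.X_zero x,
        h.eigenMartingale_zero x, h.kernel.multiplicative.zero x] with ω h1 h2 h3 h4
      rw [Pi.sub_apply, h1, h2, h3, h4, tsub_zero, one_mul,
        div_self (h.kernel.bondPrice_pos T x).ne', sub_self, Pi.zero_apply]
    · exact (integrable_ratio T 0 x).1.sub
        ((h.measurable_eigenMartingale 0).mono (𝒳.F.le 0) le_rfl).aestronglyMeasurable
  · obtain ⟨M, hM, _, hT⟩ := h.longTerm x t (pos_iff_ne_zero.2 ht)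
    have hMm : AEStronglyMeasurable M (𝒳.P x) := (hM.mono (𝒳.F.le t)).aestronglyMeasurable
    -- Along the integers the ratios converge in measure both to the assumed limit `M` and to `M^π`;
    -- uniqueness turns the `L¹`-limit into `M^π`.
    have hm1 : TendstoInMeasure (𝒳.P x) (fun (n : ℕ) ω =>
        ((𝒳.P x)[S (n : ℝ≥0) | 𝒳.F t]) ω / 𝒳.bondPrice S n x) atTop M :=
      tendstoInMeasure_of_tendsto_eLpNorm one_ne_zero (fun n => (integrable_ratio n t x).1) hMm
        (hT.comp tendsto_natCast_atTop_atTop)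
    have hm2 : TendstoInMeasure (𝒳.P x) (fun (n : ℕ) ω =>
        ((𝒳.P x)[S (n : ℝ≥0) | 𝒳.F t]) ω / 𝒳.bondPrice S n x) atTop
        (𝒳.eigenMartingale S lam π t) := by
      refine tendstoInMeasure_of_tendsto_ae (fun n => (integrable_ratio n t x).1) ?_
      obtain ⟨n₀, hn₀⟩ := exists_nat_ge t
      have hae : ∀ᵐ ω ∂𝒳.P x, ∀ n : ℕ, n₀ ≤ n → ((𝒳.P x)[S (n : ℝ≥0) | 𝒳.F t]) ω =
          S t ω * 𝒳.bondPrice S ((n : ℝ≥0) - t) (𝒳.X t ω) := by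
        refine ae_all_iff.2 fun n => ?_
        by_cases hn : n₀ ≤ n
        · filter_upwards [h.kernel.condExp_F (hn₀.trans (Nat.cast_le.2 hn)) x] with ω hω _ using hω
        · exact ae_of_all _ fun _ h => absurd h hn
      filter_upwards [h.tendsto_ratio t x, hae] with ω h1 h2
      refine h1.congr' ?_
      filter_upwards [eventually_ge_atTop n₀] with n hn
      rw [h2 n hn]
    refine hT.congr fun T => eLpNorm_congr_ae ?_
    filter_upwards [tendstoInMeasure_ae_unique hm1 hm2] with ω hω
    rw [Pi.sub_apply, hω]

/-- One maturity at finite `L¹`-distance is enough, as the normalized price is integrable. -/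
theorem integrable_eigenMartingale (t : ℝ≥0) (x : E) :
    Integrable (𝒳.eigenMartingale S lam π t) (𝒳.P x) := by
  obtain ⟨T, hT⟩ := ((h.tendsto_eLpNorm t x).eventually (gt_mem_nhds one_pos)).exists
  have h1 : Integrable ((fun ω => ((𝒳.P x)[S T | 𝒳.F t]) ω / 𝒳.bondPrice S T x) -
      𝒳.eigenMartingale S lam π t) (𝒳.P x) :=
    memLp_one_iff_integrable.1 ⟨(integrable_ratio T t x).1.sub
      ((h.measurable_eigenMartingale t).mono (𝒳.F.le t) le_rfl).aestronglyMeasurable,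
      hT.trans ENNReal.one_lt_top⟩
  simpa using (integrable_ratio (S := S) T t x).sub h1

theorem tendsto_setIntegral (t : ℝ≥0) (x : E) (A : Set Ω) : Tendsto (fun T : ℝ≥0 =>
    ∫ ω in A, ((𝒳.P x)[S T | 𝒳.F t]) ω / 𝒳.bondPrice S T x ∂𝒳.P x) atTop
    (𝓝 (∫ ω in A, 𝒳.eigenMartingale S lam π t ω ∂𝒳.P x)) :=
  tendsto_setIntegral_of_L1' _ (h.integrable_eigenMartingale t x).1
    (Eventually.of_forall fun T => integrable_ratio T t x) (h.tendsto_eLpNorm t x) A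

/-- Conditioning on `F_t` and on `F_{t+}` gives the same formula, so the averaging property extends
to sets of `F_{t+}`. The right-hand side is free of `t`, and this produces the martingale property
in the limit. -/
theorem setIntegral_ratio {t T : ℝ≥0} (htT : t ≤ T) (x : E) {A : Set Ω}
    (hA : MeasurableSet[𝒳.F.rightCont t] A) :
    ∫ ω in A, ((𝒳.P x)[S T | 𝒳.F t]) ω / 𝒳.bondPrice S T x ∂𝒳.P x =
      (∫ ω in A, S T ω ∂𝒳.P x) / 𝒳.bondPrice S T x := by
  rw [integral_div, ← setIntegral_condExp (𝒳.F.rightCont.le t) (h.kernel.integrable T x) hA]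
  congr 1
  refine setIntegral_congr_ae (𝒳.F.rightCont.le t _ hA) ?_
  filter_upwards [h.kernel.condExp_F htT x, h.kernel.condExp_rightCont htT x] with ω h1 h2 _
  rw [h1, h2]

theorem setIntegral_eigenMartingale_eq {s t : ℝ≥0} (hst : s ≤ t) (x : E) {A : Set Ω}
    (hA : MeasurableSet[𝒳.F.rightCont s] A) :
    ∫ ω in A, 𝒳.eigenMartingale S lam π s ω ∂𝒳.P x =
      ∫ ω in A, 𝒳.eigenMartingale S lam π t ω ∂𝒳.P x := by
  refine tendsto_nhds_unique_of_eventuallyEq (h.tendsto_setIntegral s x A)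
    (h.tendsto_setIntegral t x A) ?_
  filter_upwards [eventually_ge_atTop t] with T hT
  rw [h.setIntegral_ratio (hst.trans hT) x hA,
    h.setIntegral_ratio hT x (𝒳.F.rightCont.mono hst _ hA)]

/-- Needed twice: for `F`, as in the conclusion, and for its right-continuous enlargement, as in
Doob regularization. -/
theorem martingale_of_filtration {𝒢 : Filtration ℝ≥0 mΩ} (h1 : ∀ t, 𝒳.F t ≤ 𝒢 t)
    (h2 : ∀ t, 𝒢 t ≤ 𝒳.F.rightCont t) (x : E) :
    Martingale (𝒳.eigenMartingale S lam π) 𝒢 (𝒳.P x) := by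
  have hm : StronglyAdapted 𝒢 (𝒳.eigenMartingale S lam π) := fun t =>
    ((h.measurable_eigenMartingale t).mono (h1 t) le_rfl).stronglyMeasurable
  refine ⟨hm, fun s t hst => (ae_eq_condExp_of_forall_setIntegral_eq (𝒢.le s)
    (h.integrable_eigenMartingale t x)
    (fun A _ _ => (h.integrable_eigenMartingale s x).integrableOn) (fun A hA _ => ?_)
    (hm s).aestronglyMeasurable).symm⟩
  exact h.setIntegral_eigenMartingale_eq hst x (h2 s _ hA)

theorem martingale (x : E) : Martingale (𝒳.eigenMartingale S lam π) 𝒳.F (𝒳.P x) :=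
  h.martingale_of_filtration (fun _ => le_rfl) 𝒳.F_le_rightCont x

theorem martingale_rightCont (x : E) :
    Martingale (𝒳.eigenMartingale S lam π) 𝒳.F.rightCont (𝒳.P x) :=
  h.martingale_of_filtration 𝒳.F_le_rightCont (fun _ => le_rfl) x

theorem integral_eigenMartingale (t : ℝ≥0) (x : E) :
    ∫ ω, 𝒳.eigenMartingale S lam π t ω ∂𝒳.P x = 1 := by
  have h1 := h.setIntegral_eigenMartingale_eq (zero_le (a := t)) x
    (@MeasurableSet.univ _ (𝒳.F.rightCont 0))
  rw [Measure.restrict_univ] at h1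
  rw [← h1, integral_congr_ae (h.eigenMartingale_zero x)]
  simp

theorem kernel_mul_π (t : ℝ≥0) (x : E) : ∀ᵐ ω ∂𝒳.P x, S t ω * π (𝒳.X t ω) =
    Real.exp (-lam * t) * π x * 𝒳.eigenMartingale S lam π t ω := by
  filter_upwards [𝒳.X_zero x] with ω hω
  have h2 := (h.pos x).ne'
  have h3 := (Real.exp_pos (lam * t)).ne'
  rw [eigenMartingale, hω, neg_mul, Real.exp_neg]
  field_simp

theorem isPosEigenfunction : 𝒳.IsPosEigenfunction S lam π where
  pos := h.pos
  universally_measurable := h.universally_measurable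
  integrable t x := ((h.integrable_eigenMartingale t x).const_mul _).congr
    ((h.kernel_mul_π t x).mono fun _ hω => hω.symm)
  eigen t x := by
    rw [integral_congr_ae (h.kernel_mul_π t x), integral_const_mul, h.integral_eigenMartingale,
      mul_one]

theorem isPosMultiplicativeFunctional_transitionIndependent :
    𝒳.IsPosMultiplicativeFunctional (𝒳.transitionIndependent lam π) where
  adapted t := ((h.measurable_π t).const_mul _).div (h.measurable_π_zero t)
  zero x := ae_of_all _ fun ω => by simp [transitionIndependent, (h.pos _).ne']
  pos x := ae_of_all _ fun ω t => div_pos (mul_pos (Real.exp_pos _) (h.pos _)) (h.pos _)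
  mul t s x := ae_of_all _ fun ω => by
    simp only [transitionIndependent, 𝒳.X_shift, add_zero, NNReal.coe_add, mul_add, Real.exp_add]
    have h1 := (h.pos (𝒳.X t ω)).ne'
    have h2 := (h.pos (𝒳.X 0 ω)).ne'
    field_simp

theorem hasEigenFactorization : 𝒳.HasEigenFactorization S lam π where
  martingale := h.martingale
  multiplicative :=
    { adapted := h.measurable_eigenMartingale
      zero := h.eigenMartingale_zero
      pos := h.eigenMartingale_pos
      mul := fun t s x => by
        filter_upwards [h.kernel.multiplicative.mul t s x] with ω hω
        simp only [eigenMartingale, 𝒳.X_shift, add_zero, NNReal.coe_add, mul_add, Real.exp_add, hω]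
        have h1 := (h.pos (𝒳.X t ω)).ne'
        have h2 := (h.pos (𝒳.X 0 ω)).ne'
        field_simp }
  multiplicative' :=
    { adapted := fun t => ((h.measurable_π_zero t).const_mul _).div (h.measurable_π t)
      zero := fun x => ae_of_all _ fun ω => by simp [(h.pos _).ne']
      pos := fun x => ae_of_all _ fun ω t =>
        div_pos (mul_pos (Real.exp_pos _) (h.pos _)) (h.pos _)
      mul := fun t s x => ae_of_all _ fun ω => by
        simp only [𝒳.X_shift, add_zero, NNReal.coe_add, mul_add, Real.exp_add]
        have h1 := (h.pos (𝒳.X t ω)).ne'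
        have h2 := (h.pos (𝒳.X (t + s) ω)).ne'
        field_simp }
  factorization t ω := by
    have h1 := (h.pos (𝒳.X t ω)).ne'
    have h2 := (h.pos (𝒳.X 0 ω)).ne'
    have h3 := (Real.exp_pos (lam * t)).ne'
    rw [eigenMartingale, neg_mul, Real.exp_neg]
    field_simp

/-- Before the first roll-over date there is a single bond, bought at time `0` for `P(T, x)`; the
factor `S_t` cancels. -/
theorem kernel_mul_rollover {t T : ℝ≥0} (htT : t < T) (x : E) :
    ∀ᵐ ω ∂𝒳.P x, S t ω * 𝒳.rollover S x T t ω =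
      ((𝒳.P x)[S T | 𝒳.F t]) ω / 𝒳.bondPrice S T x := by
  have hk : ⌊t / T⌋₊ = 0 := by
    rw [Nat.floor_eq_zero, div_lt_one (zero_le.trans_lt htT)]
    exact htT
  filter_upwards [h.kernel.condExp_F (zero_le (a := T)) x, 𝒳.X_zero x,
    h.kernel.multiplicative.zero x, h.kernel.multiplicative.pos x] with ω h1 h2 h3 h4
  have h5 : ((𝒳.P x)[S T | 𝒳.F 0]) ω = 𝒳.bondPrice S T x := by
    rw [h1, h2, h3, one_mul, tsub_zero]
  have h6 := (h4 t).ne'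
  simp only [rollover, zeroCoupon, hk]
  simp only [zero_add, Finset.range_one, Finset.prod_singleton, Nat.cast_one, one_mul,
    Nat.cast_zero, zero_mul, h5, h3, div_one]
  field_simp

theorem forwardMeasure_apply {t T : ℝ≥0} (htT : t < T) (x : E) {A : Set Ω}
    (hA : MeasurableSet[𝒳.F t] A) :
    𝒳.forwardMeasure S x T t A = ENNReal.ofReal
      (∫ ω in A, ((𝒳.P x)[S T | 𝒳.F t]) ω / 𝒳.bondPrice S T x ∂𝒳.P x) := by
  rw [forwardMeasure, trim_measurableSet_eq _ hA, withDensity_apply _ (𝒳.F.le t _ hA),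
    ofReal_integral_eq_lintegral_ofReal (integrable_ratio T t x).integrableOn]
  · refine lintegral_congr_ae (ae_restrict_of_ae ?_)
    filter_upwards [h.kernel_mul_rollover htT x] with ω hω
    rw [hω]
  · refine ae_restrict_of_ae ?_
    filter_upwards [h.kernel.condExp_F htT.le x, h.kernel.nonneg_mul_bondPrice t (T - t) x]
      with ω h1 h2
    rw [Pi.zero_apply, h1]
    exact div_nonneg h2 (h.kernel.bondPrice_pos T x).le

theorem eigenMeasure_apply (t : ℝ≥0) (x : E) {A : Set Ω} (hA : MeasurableSet[𝒳.F t] A) :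
    𝒳.eigenMeasure S lam π x t A = ENNReal.ofReal
      (∫ ω in A, 𝒳.eigenMartingale S lam π t ω ∂𝒳.P x) := by
  rw [eigenMeasure, trim_measurableSet_eq _ hA, withDensity_apply _ (𝒳.F.le t _ hA),
    ofReal_integral_eq_lintegral_ofReal (h.integrable_eigenMartingale t x).integrableOn]
  exact ae_restrict_of_ae ((h.eigenMartingale_pos x).mono fun ω hω => (hω t).le)

theorem isLongForwardMeasure (x : E) :
    𝒳.IsLongForwardMeasure S x (𝒳.eigenMeasure S lam π x) := by
  refine ⟨fun t => ?_, fun s t hst A hA => ?_, fun t A hA => ?_, fun t A hA => ?_⟩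
  · rw [h.eigenMeasure_apply t x (@MeasurableSet.univ _ (𝒳.F t)), Measure.restrict_univ,
      h.integral_eigenMartingale, ENNReal.ofReal_one]
  · rw [h.eigenMeasure_apply s x hA, h.eigenMeasure_apply t x (𝒳.F.mono hst _ hA),
      h.setIntegral_eigenMartingale_eq hst x (𝒳.F_le_rightCont s _ hA)]
  · have hm := (h.measurable_eigenMartingale t).mono (𝒳.F.le t) le_rfl
    rw [eigenMeasure, trim_measurableSet_eq _ hA,
      withDensity_apply_eq_zero hm.ennreal_ofReal]
    -- Equivalence of the measures is the almost sure positivity of the density.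
    have h1 : 𝒳.P x ({ω | ENNReal.ofReal (𝒳.eigenMartingale S lam π t ω) ≠ 0} ∩ A) =
        𝒳.P x A := by
      refine measure_congr ?_
      filter_upwards [h.eigenMartingale_pos x] with ω hω
      have : ω ∈ {ω | ENNReal.ofReal (𝒳.eigenMartingale S lam π t ω) ≠ 0} := by
        simpa using hω t
      exact propext ⟨fun h => h.2, fun h => ⟨this, h⟩⟩
    rw [h1]
  · rw [h.eigenMeasure_apply t x hA]
    refine ((ENNReal.continuous_ofReal.tendsto _).comp (h.tendsto_setIntegral t x A)).congr' ?_
    filter_upwards [eventually_gt_atTop t] with T hT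
    exact (h.forwardMeasure_apply hT x hA).symm

end HasLongTermLimit

end BorelRightProc

end LongForward

namespace LongForward

/-! ### Paths along the dyadic numbers -/

/-- The nonnegative dyadic numbers. -/
def dyadics : Set ℝ≥0 := range fun p : ℕ × ℕ => (p.1 : ℝ≥0) / 2 ^ p.2

theorem countable_dyadics : dyadics.Countable := countable_range _

theorem natCast_mem_dyadics (n : ℕ) : (n : ℝ≥0) ∈ dyadics := ⟨(n, 0), by simp⟩

theorem div_mem_dyadics (k m : ℕ) : (k : ℝ≥0) / 2 ^ m ∈ dyadics := ⟨(k, m), rfl⟩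

theorem dyadicAbove_mem (m : ℕ) (t : ℝ≥0) : dyadicAbove m t ∈ dyadics := div_mem_dyadics _ _

theorem tendsto_dyadicAbove_dyadics (t : ℝ≥0) :
    Tendsto (fun m => dyadicAbove m t) atTop (𝓝[>] t ⊓ 𝓟 dyadics) :=
  tendsto_inf.2 ⟨tendsto_dyadicAbove t,
    tendsto_principal.2 (Eventually.of_forall fun m => dyadicAbove_mem m t)⟩

instance neBot_nhdsGT_dyadics (t : ℝ≥0) : (𝓝[>] t ⊓ 𝓟 dyadics).NeBot :=
  (tendsto_dyadicAbove_dyadics t).neBot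

theorem exists_dyadic_eq {q : ℝ≥0} (hq : q ∈ dyadics) :
    ∃ m₀ : ℕ, ∀ m ≥ m₀, ∃ k : ℕ, q = (k : ℝ≥0) / 2 ^ m := by
  obtain ⟨⟨k, i⟩, rfl⟩ := hq
  refine ⟨i, fun m hm => ⟨k * 2 ^ (m - i), ?_⟩⟩
  obtain ⟨d, rfl⟩ := Nat.exists_eq_add_of_le hm
  simp only [add_tsub_cancel_left]
  push_cast
  rw [pow_add, mul_div_mul_right _ _ (by positivity)]

/-- The path `f` crosses `[a, b]` upwards `j` times at dyadic times in `(u, n]`. -/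
def Upcrosses (f : ℝ≥0 → ℝ) (a b : ℝ) (n : ℝ≥0) : ℕ → ℝ≥0 → Prop
  | 0, u => u ≤ n
  | j + 1, u => ∃ s ∈ dyadics, ∃ t ∈ dyadics, u < s ∧ s < t ∧ f s < a ∧ b < f t ∧
      Upcrosses f a b n j t

theorem Upcrosses.anti {f : ℝ≥0 → ℝ} {a b : ℝ} {n : ℝ≥0} {j : ℕ} {u v : ℝ≥0}
    (h : Upcrosses f a b n j u) (hvu : v ≤ u) : Upcrosses f a b n j v := by
  cases j with
  | zero => exact hvu.trans h
  | succ j =>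
    obtain ⟨s, hs, t, ht, hus, h'⟩ := h
    exact ⟨s, hs, t, ht, hvu.trans_lt hus, h'⟩

theorem Upcrosses.le {f : ℝ≥0 → ℝ} {a b : ℝ} {n : ℝ≥0} {j : ℕ} {u : ℝ≥0}
    (h : Upcrosses f a b n j u) : u ≤ n := by
  induction j generalizing u with
  | zero => exact h
  | succ j ih =>
    obtain ⟨s, _, t, _, hus, hst, _, _, h'⟩ := h
    exact (hus.trans hst).le.trans (ih h')

/-- Once the grid of mesh `2⁻ᵐ` contains all the crossing times, each crossing is seen by the
discrete counter. The counter registers an upcrossing ending at index `l` only before `l + 1`; the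
slack `+ 1` in the bound on `N` carries this through the induction. -/
theorem Upcrosses.le_upcrossingsBefore {Ω : Type*} {X : ℝ≥0 → Ω → ℝ} {ω : Ω} {a b : ℝ}
    (hab : a < b) {n j : ℕ} {u : ℝ≥0} (h : Upcrosses (fun t => X t ω) a b n j u) :
    ∀ᶠ m : ℕ in atTop, ∀ N : ℕ, (N : ℝ≥0) ≤ u * 2 ^ m + 1 →
      upcrossingsBefore a b (fun k : ℕ => X ((k : ℝ≥0) / 2 ^ m)) N ω + j ≤
        upcrossingsBefore a b (fun k : ℕ => X ((k : ℝ≥0) / 2 ^ m)) (n * 2 ^ m + 1) ω := by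
  induction j generalizing u with
  | zero =>
    refine Eventually.of_forall fun m N hN => ?_
    refine upcrossingsBefore_mono hab ?_ ω
    have h1 : (N : ℝ≥0) ≤ ((n * 2 ^ m + 1 : ℕ) : ℝ≥0) := by
      refine hN.trans ?_
      push_cast
      gcongr
      exact h.le
    exact_mod_cast h1
  | succ j ih =>
    obtain ⟨s, hs, t, ht, hus, hst, hfs, hft, h'⟩ := h
    obtain ⟨m₁, hm₁⟩ := exists_dyadic_eq hs
    obtain ⟨m₂, hm₂⟩ := exists_dyadic_eq ht
    filter_upwards [ih h', eventually_ge_atTop m₁, eventually_ge_atTop m₂] with m h1 h2 h3 N hN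
    obtain ⟨k, rfl⟩ := hm₁ m h2
    obtain ⟨l, rfl⟩ := hm₂ m h3
    have hpow : (0 : ℝ≥0) < 2 ^ m := by positivity
    have hNk : N ≤ k := by
      have h4 : (N : ℝ≥0) < k + 1 := by
        refine hN.trans_lt ?_
        gcongr
        exact (lt_div_iff₀ hpow).1 hus
      exact Nat.lt_succ_iff.1 (by exact_mod_cast h4)
    have hkl : k ≤ l := by
      have h4 : (k : ℝ≥0) < l := (div_lt_div_iff_of_pos_right hpow).1 hst
      exact (Nat.cast_lt.1 h4).le
    have h5 := upcrossingsBefore_lt_of_exists_upcrossing hab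
      (f := fun k : ℕ => X ((k : ℝ≥0) / 2 ^ m)) (ω := ω) hNk hfs hkl hft
    have h6 := h1 (l + 1) (by
      rw [div_mul_cancel₀ _ hpow.ne']
      push_cast
      exact le_rfl)
    omega

/-- Regularity of a path along the dyadic numbers, on all bounded intervals: boundedness, and
finitely many upcrossings of each interval. -/
structure DyadicRegular (f : ℝ≥0 → ℝ) : Prop where
  bounded : ∀ n : ℕ, ∃ C : ℝ, ∀ q ∈ dyadics, q ≤ n → |f q| ≤ C
  upcrosses : ∀ (n : ℕ) (a b : ℚ), a < b → ∃ j, ¬ Upcrosses f a b n j 0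

theorem DyadicRegular.exists_tendsto_of_frequently {f : ℝ≥0 → ℝ} (h : DyadicRegular f)
    {l : Filter ℝ≥0} [l.NeBot] {n : ℕ} (hn : ∀ᶠ q in l, q ∈ dyadics ∧ q ≤ n)
    (hl : ∀ a b : ℝ, (∃ᶠ q in l, f q < a) → (∃ᶠ q in l, b < f q) →
      ∀ j, Upcrosses f a b n j 0) :
    ∃ c, Tendsto f l (𝓝 c) := by
  obtain ⟨C, hC⟩ := h.bounded n
  refine tendsto_of_no_upcrossings Rat.denseRange_cast ?_
    (isBoundedUnder_of_eventually_le (a := C) (hn.mono fun q hq => (abs_le.1 (hC q hq.1 hq.2)).2))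
    (isBoundedUnder_of_eventually_ge (a := -C) (hn.mono fun q hq => (abs_le.1 (hC q hq.1 hq.2)).1))
  rintro _ ⟨a, rfl⟩ _ ⟨b, rfl⟩ hab ⟨h1, h2⟩
  obtain ⟨j, hj⟩ := h.upcrosses n a b (by exact_mod_cast hab)
  exact hj (hl a b h1 h2 j)

/-- If the path oscillated across `[a, b]` to the right of `t`, crossings could be found arbitrarily
close to `t`. Each new one is inserted before those already found, so the induction keeps a margin
`t < u`. -/
theorem DyadicRegular.exists_tendsto_right {f : ℝ≥0 → ℝ} (h : DyadicRegular f) (t : ℝ≥0) :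
    ∃ c, Tendsto f (𝓝[>] t ⊓ 𝓟 dyadics) (𝓝 c) := by
  obtain ⟨n, hn⟩ := exists_nat_gt t
  have hlt : ∀ v, t < v → ∀ᶠ q in 𝓝[>] t ⊓ 𝓟 dyadics, q ∈ dyadics ∧ t < q ∧ q < v := by
    intro v hv
    rw [eventually_inf_principal]
    filter_upwards [Ioo_mem_nhdsGT hv] with q hq hqd using ⟨hqd, hq.1, hq.2⟩
  refine h.exists_tendsto_of_frequently (n := n) ((hlt n hn).mono fun q hq => ⟨hq.1, hq.2.2.le⟩) ?_
  intro a b ha hb j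
  suffices hs : ∃ u, t < u ∧ Upcrosses f a b n j u by
    obtain ⟨u, _, hu⟩ := hs
    exact hu.anti zero_le
  induction j with
  | zero => exact ⟨n, hn, le_rfl⟩
  | succ j ih =>
    obtain ⟨u, htu, hu⟩ := ih
    obtain ⟨q, hqb, hqd, htq, hqu⟩ := (hb.and_eventually (hlt u htu)).exists
    obtain ⟨p, hpa, hpd, htp, hpq⟩ := (ha.and_eventually (hlt q htq)).exists
    obtain ⟨v, htv, hvp⟩ := exists_between htp
    exact ⟨v, htv, p, hpd, q, hqd, hvp, hpq, hpa, hqb, hu.anti hqu.le⟩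

/-- Here crossings accumulate from the left and new ones are appended later, so the inductive
statement holds from every starting time `u < t`. -/
theorem DyadicRegular.exists_tendsto_left {f : ℝ≥0 → ℝ} (h : DyadicRegular f) (t : ℝ≥0) :
    ∃ c, Tendsto f (𝓝[<] t ⊓ 𝓟 dyadics) (𝓝 c) := by
  rcases (𝓝[<] t ⊓ 𝓟 dyadics).eq_or_neBot with hbot | hne
  · exact ⟨0, by rw [hbot]; exact tendsto_bot⟩
  obtain ⟨n, hn⟩ := exists_nat_gt t
  have hlt : ∀ v, v < t → ∀ᶠ q in 𝓝[<] t ⊓ 𝓟 dyadics, q ∈ dyadics ∧ v < q ∧ q < t := by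
    intro v hv
    rw [eventually_inf_principal]
    filter_upwards [Ioo_mem_nhdsLT hv] with q hq hqd using ⟨hqd, hq.1, hq.2⟩
  have ht : 0 < t := by
    by_contra h0
    have h1 : t = 0 := le_antisymm (not_lt.1 h0) zero_le
    rw [h1, show Iio (0 : ℝ≥0) = ∅ from Set.eq_empty_of_forall_notMem
      fun x (hx : x < 0) => not_lt_zero hx, nhdsWithin_empty, bot_inf_eq] at hne
    exact hne.ne rfl
  refine h.exists_tendsto_of_frequently (n := n) ((hlt 0 ht).mono fun q hq =>
    ⟨hq.1, (hq.2.2.trans hn).le⟩) ?_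
  intro a b ha hb j
  suffices hs : ∀ u, u < t → Upcrosses f a b n j u from hs 0 ht
  induction j with
  | zero => exact fun u hu => (hu.trans hn).le
  | succ j ih =>
    intro u hu
    obtain ⟨p, hpa, hpd, hup, hpt⟩ := (ha.and_eventually (hlt u hu)).exists
    obtain ⟨q, hqb, hqd, hpq, hqt⟩ := (hb.and_eventually (hlt p hpt)).exists
    exact ⟨p, hpd, q, hqd, hup, hpq, hpa, hqb, ih q hqt⟩

/-- If `g` is the right-limit of `f` along the dyadic numbers, and `f` has left limits along the
dyadic numbers, then `g` is right-continuous with left limits. -/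
theorem isRCLL_of_tendsto_dyadics {f g : ℝ≥0 → ℝ}
    (hr : ∀ t, Tendsto f (𝓝[>] t ⊓ 𝓟 dyadics) (𝓝 (g t)))
    (hl : ∀ t, ∃ c, Tendsto f (𝓝[<] t ⊓ 𝓟 dyadics) (𝓝 c)) : IsRCLL g := by
  -- Values of `g` are limits of dyadic values of `f` just to the right, so bounds by closed balls
  -- pass from `f` on an interval to `g`.
  have key : ∀ (s v : ℝ≥0) (c ε : ℝ), s < v →
      (∀ q ∈ dyadics, s < q → q < v → f q ∈ Metric.closedBall c ε) →
      g s ∈ Metric.closedBall c ε := by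
    intro s v c ε hsv hf
    refine Metric.isClosed_closedBall.mem_of_tendsto (hr s) ?_
    rw [eventually_inf_principal]
    filter_upwards [Ioo_mem_nhdsGT hsv] with q hq hqd using hf q hqd hq.1 hq.2
  refine ⟨fun t => ?_, fun t ht => ?_⟩
  · rw [← continuousWithinAt_Ioi_iff_Ici]
    refine Metric.nhds_basis_closedBall.tendsto_right_iff.2 fun ε hε => ?_
    have h := (hr t).eventually (Metric.closedBall_mem_nhds (g t) hε)
    rw [eventually_inf_principal, Filter.Eventually, mem_nhdsGT_iff_exists_Ioo_subset] at h
    obtain ⟨v, hv, hsub⟩ := h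
    filter_upwards [Ioo_mem_nhdsGT hv] with s hs
    exact key s v _ ε hs.2 fun q hqd hsq hqv => hsub ⟨hs.1.trans hsq, hqv⟩ hqd
  · obtain ⟨c, hc⟩ := hl t
    refine ⟨c, Metric.nhds_basis_closedBall.tendsto_right_iff.2 fun ε hε => ?_⟩
    have h := hc.eventually (Metric.closedBall_mem_nhds c hε)
    rw [eventually_inf_principal, Filter.Eventually, mem_nhdsLT_iff_exists_Ioo_subset' ht] at h
    obtain ⟨v, hv, hsub⟩ := h
    filter_upwards [Ioo_mem_nhdsLT hv] with s hs
    exact key s t _ ε hs.2 fun q hqd hsq hqt => hsub ⟨hs.1.trans hsq, hqt⟩ hqd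

/-! ### Right-continuous paths with left limits -/

theorem nhdsLT_zero_nnreal : 𝓝[<] (0 : ℝ≥0) = ⊥ := by
  rw [show Iio (0 : ℝ≥0) = ∅ from
    Set.eq_empty_of_forall_notMem fun x (hx : x < 0) => not_lt_zero hx, nhdsWithin_empty]

theorem IsRCLL.exists_left {f : ℝ≥0 → ℝ} (hf : IsRCLL f) (t : ℝ≥0) :
    ∃ l, Tendsto f (𝓝[<] t) (𝓝 l) := by
  rcases eq_or_ne t 0 with rfl | ht
  · exact ⟨0, by rw [nhdsLT_zero_nnreal]; exact tendsto_bot⟩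
  · exact hf.2 t (pos_iff_ne_zero.2 ht)

/-- One-sided limits bound the path near each point, and `[0, t]` is compact. -/
theorem IsRCLL.bounded {f : ℝ≥0 → ℝ} (hf : IsRCLL f) (t : ℝ≥0) :
    ∃ C, ∀ s ≤ t, |f s| ≤ C := by
  suffices h : ∃ C, ∀ s ∈ Icc 0 t, |f s| ≤ C by
    obtain ⟨C, hC⟩ := h
    exact ⟨C, fun s hs => hC s ⟨zero_le, hs⟩⟩
  refine isCompact_Icc.induction_on (p := fun A => ∃ C, ∀ s ∈ A, |f s| ≤ C) ⟨0, by simp⟩ ?_ ?_ ?_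
  · rintro A B hAB ⟨C, hC⟩
    exact ⟨C, fun s hs => hC s (hAB hs)⟩
  · rintro A B ⟨C, hC⟩ ⟨D, hD⟩
    refine ⟨max C D, fun s hs => ?_⟩
    rcases hs with hs | hs
    · exact (hC s hs).trans (le_max_left _ _)
    · exact (hD s hs).trans (le_max_right _ _)
  · intro x _
    obtain ⟨l, hl⟩ := hf.exists_left x
    have h1 : ∀ᶠ s in 𝓝[<] x, |f s| ≤ max (|l| + 1) (|f x| + 1) :=
      (hl.abs.eventually (gt_mem_nhds (lt_add_one |l|))).mono fun s hs =>
        hs.le.trans (le_max_left _ _)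
    have h2 : ∀ᶠ s in 𝓝[≥] x, |f s| ≤ max (|l| + 1) (|f x| + 1) :=
      ((hf.1 x).tendsto.abs.eventually (gt_mem_nhds (lt_add_one |f x|))).mono fun s hs =>
        hs.le.trans (le_max_right _ _)
    refine ⟨{s | |f s| ≤ max (|l| + 1) (|f x| + 1)}, mem_nhdsWithin_of_mem_nhds ?_, _,
      fun s hs => hs⟩
    rw [← nhdsLT_sup_nhdsGE]
    exact mem_sup.2 ⟨h1, h2⟩

theorem IsRCLL.mul {f g : ℝ≥0 → ℝ} (hf : IsRCLL f) (hg : IsRCLL g) :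
    IsRCLL fun t => f t * g t := by
  refine ⟨fun t => (hf.1 t).mul (hg.1 t), fun t ht => ?_⟩
  obtain ⟨l, hl⟩ := hf.2 t ht
  obtain ⟨k, hk⟩ := hg.2 t ht
  exact ⟨_, hl.mul hk⟩

theorem IsRCLL.sub {f g : ℝ≥0 → ℝ} (hf : IsRCLL f) (hg : IsRCLL g) :
    IsRCLL fun t => f t - g t := by
  refine ⟨fun t => (hf.1 t).sub (hg.1 t), fun t ht => ?_⟩
  obtain ⟨l, hl⟩ := hf.2 t ht
  obtain ⟨k, hk⟩ := hg.2 t ht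
  exact ⟨_, hl.sub hk⟩

theorem IsRCLL.inv {f : ℝ≥0 → ℝ} (hf : IsRCLL f) (h0 : ∀ t, 0 < f t)
    (hl : ∀ t, 0 < t → ∃ l, 0 < l ∧ Tendsto f (𝓝[<] t) (𝓝 l)) : IsRCLL fun t => (f t)⁻¹ := by
  refine ⟨fun t => (hf.1 t).inv₀ (h0 t).ne', fun t ht => ?_⟩
  obtain ⟨l, hl0, hl⟩ := hl t ht
  exact ⟨_, hl.inv₀ hl0.ne'⟩

/-- Bounds for a right-continuous path are determined by the dyadic times. -/
theorem exists_dyadic_of_lt {f : ℝ≥0 → ℝ} (hf : ∀ t, ContinuousWithinAt f (Ici t) t) {n : ℕ}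
    {s : ℝ≥0} (hs : s ≤ n) {c : ℝ} (hc : c < |f s|) : ∃ q ∈ dyadics, q ≤ n ∧ c < |f q| := by
  rcases hs.eq_or_lt with rfl | hs
  · exact ⟨n, natCast_mem_dyadics n, le_rfl, hc⟩
  · have h1 : ∀ᶠ q in 𝓝[>] s, c < |f q| :=
      ((hf s).mono Ioi_subset_Ici_self).abs.eventually (lt_mem_nhds hc)
    obtain ⟨q, hq, hq2⟩ := ((h1.and (Ioo_mem_nhdsGT hs)).filter_mono inf_le_left |>.and
      (eventually_inf_principal.2 (Eventually.of_forall fun q (hq : q ∈ dyadics) => hq) :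
        ∀ᶠ q in 𝓝[>] s ⊓ 𝓟 dyadics, q ∈ dyadics)).exists
    exact ⟨q, hq2, hq.2.2.le, hq.1⟩

end LongForward

/-! ### Doob regularization of martingales -/

namespace LongForward

section Regularization

variable {Ω : Type*} {mΩ : MeasurableSpace Ω} {μ : Measure Ω} {𝒢 : Filtration ℝ≥0 mΩ}
  {N : ℝ≥0 → Ω → ℝ}

/-- A filtration observed at a sequence of times. -/
def sampledFiltration (𝒢 : Filtration ℝ≥0 mΩ) {s : ℕ → ℝ≥0} (hs : Monotone s) :
    Filtration ℕ mΩ where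
  seq k := 𝒢 (s k)
  mono' _ _ hij := 𝒢.mono (hs hij)
  le' k := 𝒢.le (s k)

theorem martingale_sampled (hN : Martingale N 𝒢 μ) {s : ℕ → ℝ≥0} (hs : Monotone s) :
    Martingale (fun k => N (s k)) (sampledFiltration 𝒢 hs) μ :=
  ⟨fun k => hN.1 (s k), fun i j hij => hN.2 (s i) (s j) (hs hij)⟩

theorem monotone_dyadic (m : ℕ) : Monotone fun k : ℕ => (k : ℝ≥0) / 2 ^ m :=
  fun i j hij => by
    have h : (i : ℝ≥0) ≤ j := Nat.cast_le.2 hij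
    simp only
    gcongr

theorem integral_abs_mono (hN : Martingale N 𝒢 μ) {s t : ℝ≥0} (hst : s ≤ t) :
    ∫ ω, |N s ω| ∂μ ≤ ∫ ω, |N t ω| ∂μ := by
  refine le_trans (integral_congr_ae ?_).le (integral_abs_condExp_le (m := 𝒢 s) (N t))
  filter_upwards [hN.2 s t hst] with ω hω
  rw [hω]

theorem measure_eq_zero_of_le_div {A : Set Ω} (K : ℝ)
    (h : ∀ j : ℕ, μ A ≤ ENNReal.ofReal (K / (j + 1))) : μ A = 0 := by
  have h1 : Tendsto (fun j : ℕ => ENNReal.ofReal (K / (j + 1))) atTop (𝓝 (ENNReal.ofReal 0)) :=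
    (ENNReal.continuous_ofReal.tendsto 0).comp (by
      simpa using (tendsto_one_div_add_atTop_nhds_zero_nat (𝕜 := ℝ)).const_mul K |>.congr
        fun j => by rw [mul_one_div])
  rw [ENNReal.ofReal_zero] at h1
  exact le_antisymm (ge_of_tendsto' h1 h) zero_le

/-- Monotone exhaustion of the dyadic times in `[0, n]` by finite grids. -/
theorem setOf_exists_dyadic_eq (n : ℕ) (p : ℝ≥0 → Ω → Prop) :
    {ω | ∃ q ∈ dyadics, q ≤ n ∧ p q ω} =
      ⋃ m : ℕ, {ω | ∃ k ≤ n * 2 ^ m, p ((k : ℝ≥0) / 2 ^ m) ω} := by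
  ext ω
  simp only [mem_iUnion]
  constructor
  · rintro ⟨q, hq, hqn, hp⟩
    obtain ⟨m, hm⟩ := exists_dyadic_eq hq
    obtain ⟨k, rfl⟩ := hm m le_rfl
    refine ⟨m, k, ?_, hp⟩
    have h : (k : ℝ≥0) ≤ ((n * 2 ^ m : ℕ) : ℝ≥0) := by
      push_cast
      exact (div_le_iff₀ (by positivity)).1 hqn
    exact_mod_cast h
  · rintro ⟨m, k, hk, hp⟩
    refine ⟨_, div_mem_dyadics k m, ?_, hp⟩
    rw [div_le_iff₀ (by positivity)]
    exact_mod_cast hk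

theorem monotone_setOf_exists_dyadic (n : ℕ) (p : ℝ≥0 → Ω → Prop) :
    Monotone fun m : ℕ => {ω | ∃ k ≤ n * 2 ^ m, p ((k : ℝ≥0) / 2 ^ m) ω} := by
  refine monotone_nat_of_le_succ fun m ω => ?_
  rintro ⟨k, hk, hp⟩
  refine ⟨k * 2, ?_, ?_⟩
  · rw [pow_succ, ← mul_assoc]
    gcongr
  · have h : ((k * 2 : ℕ) : ℝ≥0) / 2 ^ (m + 1) = (k : ℝ≥0) / 2 ^ m := by
      push_cast
      rw [pow_succ, mul_div_mul_right _ _ (by norm_num)]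
    rw [h]
    exact hp

theorem mul_pow_div_pow (n m : ℕ) : ((n * 2 ^ m : ℕ) : ℝ≥0) / 2 ^ m = n := by
  push_cast
  exact mul_div_cancel_right₀ _ (by positivity)

variable [IsFiniteMeasure μ]

/-- Doob's maximal inequality over the dyadic times. -/
theorem measure_exists_dyadic_lt_le (hN : Martingale N 𝒢 μ) (n : ℕ) {c : ℝ} (hc : 0 < c) :
    μ {ω | ∃ q ∈ dyadics, q ≤ n ∧ c < |N q ω|} ≤ ENNReal.ofReal ((∫ ω, |N n ω| ∂μ) / c) := by
  rw [setOf_exists_dyadic_eq n fun q ω => c < |N q ω|,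
    (monotone_setOf_exists_dyadic n fun q ω => c < |N q ω|).measure_iUnion]
  refine iSup_le fun m => ?_
  have hY := martingale_sampled hN (monotone_dyadic m)
  -- The maximum of the martingale and its negative is the submartingale `|N|`, sampled along the
  -- grid.
  have hsub := hY.submartingale.sup hY.neg.submartingale
  have hmax := maximal_ineq hsub (fun k ω => (abs_nonneg (N ((k : ℝ≥0) / 2 ^ m) ω)))
    (ε := c.toNNReal) (n * 2 ^ m)
  have hint : Integrable (fun ω => |N n ω|) μ := (hN.integrable n).abs
  have hle : c.toNNReal • μ {ω | ∃ k ≤ n * 2 ^ m, c < |N ((k : ℝ≥0) / 2 ^ m) ω|} ≤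
      ENNReal.ofReal (∫ ω, |N n ω| ∂μ) := by
    refine le_trans ?_ (hmax.trans (ENNReal.ofReal_le_ofReal ?_))
    · rw [ENNReal.smul_def, smul_eq_mul]
      refine mul_le_mul' le_rfl (measure_mono ?_)
      rintro ω ⟨k, hk, hkc⟩
      rw [mem_ofPred_eq, Real.coe_toNNReal _ hc.le, Finset.le_sup'_iff]
      exact ⟨k, by simpa [Nat.lt_succ_iff] using hk, hkc.le⟩
    · have heq : ((fun k : ℕ => N ((k : ℝ≥0) / 2 ^ m)) ⊔ -fun k : ℕ => N ((k : ℝ≥0) / 2 ^ m))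
          (n * 2 ^ m) = fun ω => |N n ω| := by
        ext ω
        simp only [Pi.sup_apply, Pi.neg_apply, mul_pow_div_pow]
        rfl
      rw [heq]
      exact setIntegral_le_integral hint (ae_of_all _ fun ω => abs_nonneg _)
  rw [ENNReal.smul_def, smul_eq_mul, mul_comm] at hle
  have hc' : (c.toNNReal : ℝ≥0∞) = ENNReal.ofReal c := rfl
  rw [hc'] at hle
  rw [ENNReal.ofReal_div_of_pos hc]
  exact (ENNReal.le_div_iff_mul_le (Or.inl (by simpa using hc))
    (Or.inl ENNReal.ofReal_ne_top)).2 hle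

theorem ae_bounded_dyadics (hN : Martingale N 𝒢 μ) :
    ∀ᵐ ω ∂μ, ∀ n : ℕ, ∃ C : ℝ, ∀ q ∈ dyadics, q ≤ n → |N q ω| ≤ C := by
  refine ae_all_iff.2 fun n => ?_
  refine measure_eq_zero_of_le_div (∫ ω, |N n ω| ∂μ) fun j => ?_
  refine (measure_mono fun ω hω => ?_).trans (measure_exists_dyadic_lt_le hN n (c := j + 1)
    (by positivity))
  by_contra hcon
  refine hω ⟨j + 1, fun q hq hqn => ?_⟩
  by_contra h
  exact hcon ⟨q, hq, hqn, not_le.1 h⟩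

/-- Doob's upcrossing inequality with a bound independent of the mesh: the last grid index
overshoots `n` by one step, which stays below `n + 1`, and `E|N|` is nondecreasing in time. -/
theorem lintegral_upcrossingsBefore_le (hN : Martingale N 𝒢 μ) (n m : ℕ) {a b : ℝ}
    (hab : a < b) :
    ∫⁻ ω, (upcrossingsBefore a b (fun k : ℕ => N ((k : ℝ≥0) / 2 ^ m)) (n * 2 ^ m + 1) ω : ℝ≥0∞) ∂μ
      ≤ ENNReal.ofReal ((∫ ω, (|N (n + 1) ω| + |a|) ∂μ) / (b - a)) := by
  have hY := martingale_sampled hN (monotone_dyadic m)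
  have hint := hY.stronglyAdapted.integrable_upcrossingsBefore (μ := μ) hab (N := n * 2 ^ m + 1)
  have h1 := hY.submartingale.mul_integral_upcrossingsBefore_le_integral_pos_part a b
    (n * 2 ^ m + 1)
  have htime : (((n * 2 ^ m + 1 : ℕ) : ℝ≥0) / 2 ^ m) ≤ n + 1 := by
    rw [div_le_iff₀ (by positivity)]
    push_cast
    rw [add_mul, one_mul]
    gcongr
    exact one_le_pow₀ (by norm_num)
  have h2 : ∫ ω, (N (((n * 2 ^ m + 1 : ℕ) : ℝ≥0) / 2 ^ m) ω - a)⁺ ∂μ ≤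
      ∫ ω, (|N (n + 1) ω| + |a|) ∂μ := by
    have h3 := integral_abs_mono hN htime
    have hi : ∀ t, Integrable (fun ω => |N t ω|) μ := fun t => (hN.integrable t).abs
    calc _ ≤ ∫ ω, (|N (((n * 2 ^ m + 1 : ℕ) : ℝ≥0) / 2 ^ m) ω| + |a|) ∂μ := by
          refine integral_mono ((hN.integrable _).sub (integrable_const a)).pos_part
            ((hi _).add (integrable_const _)) fun ω => ?_
          exact (sup_le (le_abs_self _) (abs_nonneg _)).trans (abs_sub _ _)
      _ ≤ _ := by
          rw [integral_add (hi _) (integrable_const _), integral_add (hi _) (integrable_const _)]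
          gcongr
  have h4 : ∫ ω, (upcrossingsBefore a b (fun k : ℕ => N ((k : ℝ≥0) / 2 ^ m)) (n * 2 ^ m + 1) ω : ℝ)
      ∂μ ≤ (∫ ω, (|N (n + 1) ω| + |a|) ∂μ) / (b - a) := by
    rw [le_div_iff₀ (sub_pos.2 hab), mul_comm]
    exact h1.trans h2
  refine le_trans (le_of_eq ?_) (ENNReal.ofReal_le_ofReal h4)
  rw [ofReal_integral_eq_lintegral_ofReal hint (ae_of_all _ fun ω => Nat.cast_nonneg _)]
  simp_rw [ENNReal.ofReal_natCast]

theorem ae_upcrosses_dyadics (hN : Martingale N 𝒢 μ) (n : ℕ) {a b : ℝ} (hab : a < b) :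
    ∀ᵐ ω ∂μ, ∃ j, ¬ Upcrosses (fun t => N t ω) a b n j 0 := by
  set U : ℕ → Ω → ℝ≥0∞ := fun m ω =>
    (upcrossingsBefore a b (fun k : ℕ => N ((k : ℝ≥0) / 2 ^ m)) (n * 2 ^ m + 1) ω : ℝ≥0∞) with hU
  have hm : ∀ m, Measurable (U m) := fun m =>
    measurable_from_top.comp ((martingale_sampled hN (monotone_dyadic
      m)).stronglyAdapted.measurable_upcrossingsBefore hab)
  -- By Fatou the lower limit of the counts is almost surely finite, whereas arbitrarily many dyadic
  -- crossings would force it to be infinite.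
  have hfin : ∫⁻ ω, liminf (fun m => U m ω) atTop ∂μ ≠ ∞ := by
    refine ne_top_of_le_ne_top ENNReal.ofReal_ne_top ((lintegral_liminf_le hm).trans ?_)
      (b := ENNReal.ofReal ((∫ ω, (|N (n + 1) ω| + |a|) ∂μ) / (b - a)))
    refine liminf_le_of_le (by isBoundedDefault) fun c hc => ?_
    obtain ⟨m, hcm⟩ := hc.exists
    exact hcm.trans (lintegral_upcrossingsBefore_le hN n m hab)
  filter_upwards [ae_lt_top (Measurable.liminf hm) hfin] with ω hω
  by_contra hcon
  push Not at hcon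
  refine hω.ne (ENNReal.eq_top_of_forall_nnreal_le fun r => ?_)
  obtain ⟨j, hj⟩ := exists_nat_ge r
  refine le_liminf_of_le (by isBoundedDefault) ?_
  filter_upwards [(hcon j).le_upcrossingsBefore hab] with m h
  have h1 := h 0 (by simp)
  have h2 : j ≤ upcrossingsBefore a b (fun k : ℕ => N ((k : ℝ≥0) / 2 ^ m)) (n * 2 ^ m + 1) ω := by
    omega
  calc (r : ℝ≥0∞) ≤ ((j : ℝ≥0) : ℝ≥0∞) := by exact_mod_cast hj
    _ ≤ U m ω := by
      simp only [hU, ENNReal.coe_natCast]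
      exact_mod_cast h2

theorem ae_dyadicRegular (hN : Martingale N 𝒢 μ) : ∀ᵐ ω ∂μ, DyadicRegular fun t => N t ω := by
  have h : ∀ᵐ ω ∂μ, ∀ (n : ℕ) (a b : ℚ), a < b → ∃ j, ¬ Upcrosses (fun t => N t ω) a b n j 0 := by
    refine ae_all_iff.2 fun n => ae_all_iff.2 fun a => ae_all_iff.2 fun b => ?_
    by_cases hab : a < b
    · exact (ae_upcrosses_dyadics hN n (Rat.cast_lt.2 hab)).mono fun ω hω _ => hω
    · exact ae_of_all _ fun _ h => absurd h hab
  filter_upwards [ae_bounded_dyadics hN, h] with ω h1 h2 using ⟨h1, h2⟩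

/-- The right-limits, along the dyadic numbers, of a process. -/
noncomputable def dyadicLim (N : ℝ≥0 → Ω → ℝ) (t : ℝ≥0) (ω : Ω) : ℝ :=
  limUnder (𝓝[>] t ⊓ 𝓟 dyadics) fun s => N s ω

theorem ae_tendsto_dyadicLim (hN : Martingale N 𝒢 μ) : ∀ᵐ ω ∂μ, ∀ t,
    Tendsto (fun s => N s ω) (𝓝[>] t ⊓ 𝓟 dyadics) (𝓝 (dyadicLim N t ω)) :=
  (ae_dyadicRegular hN).mono fun _ h t => tendsto_nhds_limUnder (h.exists_tendsto_right t)

theorem ae_isRCLL_dyadicLim (hN : Martingale N 𝒢 μ) :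
    ∀ᵐ ω ∂μ, IsRCLL fun t => dyadicLim N t ω := by
  filter_upwards [ae_tendsto_dyadicLim hN, ae_dyadicRegular hN] with ω h1 h2
  exact isRCLL_of_tendsto_dyadics h1 h2.exists_tendsto_left

/-- The limsup ignores initial terms, hence is `𝒢 j`-measurable for every `j > t`, and `𝒢` is
right-continuous. -/
theorem measurable_limsup_dyadicAbove [h𝒢 : 𝒢.IsRightContinuous] (hN : StronglyAdapted 𝒢 N)
    (t : ℝ≥0) : Measurable[𝒢 t] fun ω => limsup (fun m => N (dyadicAbove m t) ω) atTop := by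
  have h1 : ∀ j, t < j →
      Measurable[𝒢 j] fun ω => limsup (fun m => N (dyadicAbove m t) ω) atTop := by
    intro j hj
    obtain ⟨m₀, hm₀⟩ := eventually_atTop.1
      ((tendsto_dyadicAbove t).eventually (Ioo_mem_nhdsGT hj))
    have h2 : (fun ω => limsup (fun m => N (dyadicAbove m t) ω) atTop) =
        fun ω => limsup (fun m => N (dyadicAbove (m + m₀) t) ω) atTop := by
      ext ω
      exact (limsup_nat_add (fun m => N (dyadicAbove m t) ω) m₀).symm
    rw [h2]
    exact Measurable.limsup fun m => ((hN _).measurable).mono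
      (𝒢.mono (hm₀ (m + m₀) (Nat.le_add_left _ _)).2.le) le_rfl
  intro B hB
  refine h𝒢.RC t _ ?_
  rw [Filtration.rightCont_eq, MeasurableSpace.measurableSet_iInf]
  intro j
  rw [MeasurableSpace.measurableSet_iInf]
  exact fun hj => h1 j hj hB

/-- **Regularization**: the right-limits of a martingale of a right-continuous filtration are a
version of it, with paths which are right-continuous with left limits. -/
theorem dyadicLim_ae_eq [h𝒢 : 𝒢.IsRightContinuous] (hN : Martingale N 𝒢 μ) (t : ℝ≥0) :
    dyadicLim N t =ᵐ[μ] N t := by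
  have hlim : ∀ᵐ ω ∂μ, Tendsto (fun m => N (dyadicAbove m t) ω) atTop
      (𝓝 (dyadicLim N t ω)) :=
    (ae_tendsto_dyadicLim hN).mono fun ω h => (h t).comp (tendsto_dyadicAbove_dyadics t)
  have hle : ∀ m, dyadicAbove m t ≤ t + 1 := fun m =>
    (dyadicAbove_le m t).trans (by gcongr; exact pow_le_one₀ zero_le (by
      rw [div_le_one] <;> norm_num))
  -- The values just after `t` are conditional expectations of the single variable `N (t + 1)`;
  -- uniform integrability upgrades almost sure convergence to `L¹`.
  have hui : UniformIntegrable (fun m => N (dyadicAbove m t)) 1 μ :=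
    ((hN.integrable (t + 1)).uniformIntegrable_condExp (ℱ := fun m => 𝒢 (dyadicAbove m t))
      fun m => 𝒢.le _).ae_eq fun m => hN.2 _ _ (hle m)
  have hmem : MemLp (dyadicLim N t) 1 μ := hui.memLp_of_ae_tendsto hlim
  have hL1 := tendsto_Lp_finite_of_tendsto_ae le_rfl ENNReal.one_ne_top
    (fun m => (hN.integrable _).1) hmem hui.unifIntegrable hlim
  have hae : dyadicLim N t =ᵐ[μ] fun ω => limsup (fun m => N (dyadicAbove m t) ω) atTop :=
    hlim.mono fun ω h => h.limsup_eq.symm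
  have h1 : dyadicLim N t =ᵐ[μ] μ[N t | 𝒢 t] := by
    refine ae_eq_condExp_of_forall_setIntegral_eq (𝒢.le t) (hN.integrable t)
      (fun _ _ _ => (memLp_one_iff_integrable.1 hmem).integrableOn) (fun A hA _ => ?_)
      ⟨_, (measurable_limsup_dyadicAbove hN.1 t).stronglyMeasurable, hae⟩
    refine tendsto_nhds_unique (tendsto_setIntegral_of_L1' _ hmem.1
      (Eventually.of_forall fun m => hN.integrable _) hL1 A) ?_
    refine tendsto_const_nhds.congr fun m => ?_
    exact hN.setIntegral_eq (lt_dyadicAbove m t).le hA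
  exact h1.trans (hN.2 t t le_rfl)

omit [IsFiniteMeasure μ] in
-- The event is split according to the first index with `Y k < ε`: there `Y k` is below `ε`, and the
-- martingale property carries its integral over to the final index.
theorem setIntegral_exists_lt_le {𝒢 : Filtration ℕ mΩ} [IsFiniteMeasure μ] {Y : ℕ → Ω → ℝ}
    (hY : Martingale Y 𝒢 μ) (ε : ℝ) (K : ℕ) :
    ∫ ω in {ω | ∃ k ≤ K, Y k ω < ε}, Y K ω ∂μ ≤ ε * μ.real {ω | ∃ k ≤ K, Y k ω < ε} := by
  have hmeas : ∀ k K, k ≤ K → MeasurableSet[𝒢 K] {ω | Y k ω < ε} := fun k K hk =>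
    𝒢.mono hk _ (@measurableSet_lt _ _ _ _ _ (𝒢 k) _ _ _ _ _ (hY.1 k).measurable
      (@measurable_const _ _ _ (𝒢 k) _))
  have hA : ∀ K, MeasurableSet[𝒢 K] {ω | ∃ k ≤ K, Y k ω < ε} := by
    intro K
    have h : {ω | ∃ k ≤ K, Y k ω < ε} = ⋃ k ∈ Iic K, {ω | Y k ω < ε} := by
      ext ω; simp
    rw [h]
    exact MeasurableSet.biUnion (to_countable _) fun k hk => hmeas k K hk
  induction K with
  | zero =>
    have h := setIntegral_mono_on (hY.integrable 0).integrableOn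
      (integrable_const ε).integrableOn (𝒢.le _ _ (hA 0)) (fun ω hω => by
        obtain ⟨k, hk, hω⟩ := hω
        rw [Nat.le_zero.1 hk] at hω
        exact hω.le)
    rwa [setIntegral_const, smul_eq_mul, mul_comm] at h
  | succ K ih =>
    set A := {ω | ∃ k ≤ K, Y k ω < ε} with hAdef
    set B := Aᶜ ∩ {ω | Y (K + 1) ω < ε} with hBdef
    have hAB : {ω | ∃ k ≤ K + 1, Y k ω < ε} = A ∪ B := by
      ext ω
      simp only [hAdef, hBdef, mem_union, mem_inter_iff, mem_compl_iff, mem_ofPred_eq]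
      constructor
      · rintro ⟨k, hk, h⟩
        by_cases h' : ∃ k ≤ K, Y k ω < ε
        · exact Or.inl h'
        · refine Or.inr ⟨h', ?_⟩
          rcases Nat.le_succ_iff.1 hk with hk | rfl
          · exact absurd ⟨k, hk, h⟩ h'
          · exact h
      · rintro (⟨k, hk, h⟩ | ⟨_, h⟩)
        · exact ⟨k, by omega, h⟩
        · exact ⟨K + 1, le_rfl, h⟩
    have hdisj : Disjoint A B := disjoint_compl_right.mono_right inter_subset_left
    have hAm := 𝒢.le _ _ (hA K)
    have hBm : MeasurableSet B := hAm.compl.inter (𝒢.le _ _ (hmeas (K + 1) (K + 1) le_rfl))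
    have h1 : ∫ ω in B, Y (K + 1) ω ∂μ ≤ ε * μ.real B := by
      have h := setIntegral_mono_on (hY.integrable (K + 1)).integrableOn
        (integrable_const ε).integrableOn hBm (fun ω hω => hω.2.le)
      rwa [setIntegral_const, smul_eq_mul, mul_comm] at h
    rw [hAB, setIntegral_union hdisj hBm (hY.integrable _).integrableOn
      (hY.integrable _).integrableOn, measureReal_union hdisj hBm, mul_add,
      ← hY.setIntegral_eq (Nat.le_succ K) (hA K)]
    exact add_le_add ih h1

/-- A strictly positive martingale is bounded away from `0` on the dyadic times of a bounded
interval. -/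
theorem ae_exists_pos_le_dyadics (hN : Martingale N 𝒢 μ) (hpos : ∀ t, ∀ᵐ ω ∂μ, 0 < N t ω) :
    ∀ᵐ ω ∂μ, ∀ n : ℕ, ∃ ε : ℝ, 0 < ε ∧ ∀ q ∈ dyadics, q ≤ n → ε ≤ N q ω := by
  refine ae_all_iff.2 fun n => ?_
  set A : ℝ → Set Ω := fun ε => {ω | ∃ q ∈ dyadics, q ≤ n ∧ N q ω < ε} with hA
  have hAm : ∀ ε, MeasurableSet (A ε) := by
    intro ε
    have h : A ε = ⋃ q ∈ {q | q ∈ dyadics ∧ q ≤ n}, {ω | N q ω < ε} := by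
      ext ω; simp [hA, and_assoc]
    rw [h]
    exact MeasurableSet.biUnion (countable_dyadics.mono fun q hq => hq.1) fun q _ =>
      measurableSet_lt ((hN.1 q).measurable.mono (𝒢.le q) le_rfl) measurable_const
  have hle : ∀ ε : ℝ, 0 < ε → ∫ ω in A ε, N n ω ∂μ ≤ ε * μ.real univ := by
    intro ε hε
    have hEq : A ε = _ := setOf_exists_dyadic_eq n fun q ω => N q ω < ε
    have hgm : ∀ m : ℕ, MeasurableSet {ω | ∃ k ≤ n * 2 ^ m, N ((k : ℝ≥0) / 2 ^ m) ω < ε} := by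
      intro m
      have h : {ω | ∃ k ≤ n * 2 ^ m, N ((k : ℝ≥0) / 2 ^ m) ω < ε} =
          ⋃ k ∈ Iic (n * 2 ^ m), {ω | N ((k : ℝ≥0) / 2 ^ m) ω < ε} := by
        ext ω; simp
      rw [h]
      exact MeasurableSet.biUnion (to_countable _) fun k _ =>
        measurableSet_lt ((hN.1 _).measurable.mono (𝒢.le _) le_rfl) measurable_const
    rw [hEq]
    refine le_of_tendsto' (tendsto_setIntegral_of_monotone hgm
      (monotone_setOf_exists_dyadic n fun q ω => N q ω < ε) (hN.integrable n).integrableOn)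
      fun m => ?_
    have h := setIntegral_exists_lt_le (martingale_sampled hN (monotone_dyadic m)) ε (n * 2 ^ m)
    simp only [mul_pow_div_pow] at h
    exact h.trans (mul_le_mul_of_nonneg_left (measureReal_mono (subset_univ _)) hε.le)
  -- On `Z` the infimum over the dyadic times is at most `0`. Letting `ε` tend to `0` in `hle` shows
  -- that `N n` has integral zero over `Z`; being positive, it forces `Z` to be null.
  set Z := ⋂ j : ℕ, A (1 / ((j : ℝ) + 1)) with hZ
  have hnn : 0 ≤ᵐ[μ] N n := (hpos n).mono fun ω h => h.le
  have hZ0 : ∫ ω in Z, N n ω ∂μ = 0 := by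
    refine le_antisymm ?_ (integral_nonneg_of_ae (ae_restrict_of_ae hnn))
    have h1 : Tendsto (fun j : ℕ => 1 / ((j : ℝ) + 1) * μ.real univ) atTop (𝓝 0) := by
      simpa using (tendsto_one_div_add_atTop_nhds_zero_nat (𝕜 := ℝ)).mul_const (μ.real univ)
    refine ge_of_tendsto' h1 fun j => le_trans ?_ (hle (1 / ((j : ℝ) + 1)) (by positivity))
    exact setIntegral_mono_set (hN.integrable n).integrableOn (ae_restrict_of_ae hnn)
      (iInter_subset _ j).eventuallyLE
  rw [setIntegral_eq_zero_iff_of_nonneg_ae (ae_restrict_of_ae hnn) (hN.integrable n).integrableOn]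
    at hZ0
  have hZnull : ∀ᵐ ω ∂μ, ω ∉ Z := by
    have h1 := (ae_restrict_iff' (MeasurableSet.iInter fun j => hAm _)).1 hZ0
    filter_upwards [h1, hpos n] with ω h1 h2 h3
    exact h2.ne' (h1 h3)
  filter_upwards [hZnull] with ω hω
  simp only [hZ, mem_iInter, not_forall] at hω
  obtain ⟨j, hj⟩ := hω
  refine ⟨1 / ((j : ℝ) + 1), by positivity, fun q hq hqn => ?_⟩
  by_contra h
  exact hj ⟨q, hq, hqn, not_le.1 h⟩

theorem ae_dyadicLim_pos (hN : Martingale N 𝒢 μ) (hpos : ∀ t, ∀ᵐ ω ∂μ, 0 < N t ω) :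
    ∀ᵐ ω ∂μ, ∀ t, 0 < dyadicLim N t ω := by
  filter_upwards [ae_tendsto_dyadicLim hN, ae_exists_pos_le_dyadics hN hpos] with ω h1 h2 t
  obtain ⟨n, hn⟩ := exists_nat_gt t
  obtain ⟨ε, hε, h3⟩ := h2 n
  refine hε.trans_le (ge_of_tendsto (h1 t) ?_)
  rw [eventually_inf_principal]
  filter_upwards [Ioo_mem_nhdsGT hn] with q hq hqd using h3 q hqd hq.2.le

omit [IsFiniteMeasure μ] in
/-- A process with right-continuous paths agrees at all dyadic times with any version of it, and
its bounds are determined by them. -/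
theorem measure_exists_lt_le_dyadics {V N : ℝ≥0 → Ω → ℝ}
    (hV : ∀ᵐ ω ∂μ, ∀ t, ContinuousWithinAt (fun s => V s ω) (Ici t) t)
    (hVN : ∀ t, V t =ᵐ[μ] N t) {t : ℝ≥0} {n : ℕ} (htn : t ≤ n) (c : ℝ) :
    μ {ω | ∃ s ≤ t, c < |V s ω|} ≤ μ {ω | ∃ q ∈ dyadics, q ≤ n ∧ c < |N q ω|} := by
  refine measure_mono_ae ?_
  have h1 : ∀ᵐ ω ∂μ, ∀ q ∈ dyadics, V q ω = N q ω :=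
    (ae_ball_iff countable_dyadics).2 fun q _ => hVN q
  filter_upwards [hV, h1] with ω h1 h2
  rintro ⟨s, hs, hc⟩
  obtain ⟨q, hq, hqn, hqc⟩ := exists_dyadic_of_lt h1 (hs.trans htn) hc
  exact ⟨q, hq, hqn, by rwa [← h2 q hq]⟩

/-- Paths which are right-continuous with left limits are bounded in probability. -/
theorem exists_measure_lt_le {V N : ℝ≥0 → Ω → ℝ} (hV : ∀ᵐ ω ∂μ, IsRCLL fun t => V t ω)
    (hVN : ∀ t, V t =ᵐ[μ] N t) (hN : ∀ t, Measurable (N t)) (t : ℝ≥0) {ε : ℝ} (hε : 0 < ε) :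
    ∃ c : ℝ, 0 < c ∧ μ {ω | ∃ s ≤ t, c < |V s ω|} ≤ ENNReal.ofReal ε := by
  obtain ⟨n, hn⟩ := exists_nat_ge t
  set A : ℕ → Set Ω := fun j => {ω | ∃ q ∈ dyadics, q ≤ n ∧ (j : ℝ) < |N q ω|} with hA
  have hAm : ∀ j, MeasurableSet (A j) := by
    intro j
    have h : A j = ⋃ q ∈ {q | q ∈ dyadics ∧ q ≤ n}, {ω | (j : ℝ) < |N q ω|} := by
      ext ω; simp [hA, and_assoc]
    rw [h]
    exact MeasurableSet.biUnion (countable_dyadics.mono fun q hq => hq.1) fun q _ =>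
      measurableSet_lt measurable_const (hN q).abs
  have hanti : Antitone A := by
    rintro i j hij ω ⟨q, hq, hqn, h⟩
    exact ⟨q, hq, hqn, (Nat.cast_le.2 hij).trans_lt h⟩
  have h0 : μ (⋂ j, A j) = 0 := by
    have h1 : ∀ᵐ ω ∂μ, ∀ q ∈ dyadics, V q ω = N q ω :=
      (ae_ball_iff countable_dyadics).2 fun q _ => hVN q
    refine measure_mono_null ?_ (hV.and h1)
    rintro ω hω ⟨h2, h3⟩
    obtain ⟨C, hC⟩ := h2.bounded n
    obtain ⟨j, hj⟩ := exists_nat_ge C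
    obtain ⟨q, hq, hqn, h4⟩ := mem_iInter.1 hω j
    rw [← h3 q hq] at h4
    exact absurd ((hC q hqn).trans hj) (not_le.2 h4)
  have hT := tendsto_measure_iInter_atTop (μ := μ) (fun j => (hAm j).nullMeasurableSet) hanti
    ⟨0, measure_ne_top _ _⟩
  rw [h0] at hT
  obtain ⟨j, hj, hj0⟩ := ((hT.eventually (gt_mem_nhds (ENNReal.ofReal_pos.2 hε))).and
    (eventually_gt_atTop 0)).exists
  exact ⟨j, Nat.cast_pos.2 hj0, (measure_exists_lt_le_dyadics (hV.mono fun ω h => h.1) hVN hn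
    _).trans hj.le⟩

end Regularization

end LongForward

/-! ### Good integrators: reduction to deterministic grids -/

namespace LongForward

section GridIntegrator

variable {Ω : Type*} {mΩ : MeasurableSpace Ω}

/-- The elementary integral, along a deterministic grid, of the integrand with values `h k` on
`(s k, s (k + 1)]`. -/
def gridIntegral (n : ℕ) (s : ℕ → ℝ≥0) (h : ℕ → Ω → ℝ) (X : ℝ≥0 → Ω → ℝ) (ω : Ω) : ℝ :=
  ∑ k ∈ Finset.range n, h k ω * (X (s (k + 1)) ω - X (s k) ω)

/-- Elementary integrals along deterministic grids in `[0, t]` are small in probability,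
if the integrands are small. -/
def IsGridIntegrator (F : Filtration ℝ≥0 mΩ) (μ : Measure Ω) (X : ℝ≥0 → Ω → ℝ) : Prop :=
  ∀ t : ℝ≥0, ∀ ε : ℝ, 0 < ε → ∃ δ : ℝ, 0 < δ ∧ ∀ (n : ℕ) (s : ℕ → ℝ≥0), Monotone s →
    (∀ k, s k ≤ t) → ∀ h : ℕ → Ω → ℝ, (∀ k, Measurable[F (s k)] (h k)) →
    (∀ k ω, |h k ω| ≤ δ) → μ {ω | ε ≤ |gridIntegral n s h X ω|} ≤ ENNReal.ofReal ε

variable {F : Filtration ℝ≥0 mΩ} {μ : Measure Ω}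

theorem IsSemimartingale.isGridIntegrator {X : ℝ≥0 → Ω → ℝ} (hX : IsSemimartingale F μ X) :
    IsGridIntegrator F μ X := by
  intro t ε hε
  obtain ⟨δ, hδ, H⟩ := hX.good_integrator t ε hε
  refine ⟨δ, hδ, fun n s hs hst h hm hb => ?_⟩
  let I : SimplePredictable F :=
    { n := n
      τ := fun i _ => s i
      isStoppingTime := fun i => isStoppingTime_const F (s i)
      mono := fun i _ => hs (Nat.le_succ i)
      H₀ := fun _ => 0
      measurable_H₀ := @measurable_const _ _ _ (F 0) _
      H := h
      measurable_H := fun i => by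
        rw [IsStoppingTime.measurableSpace_const]
        exact hm i }
  have hI := H I ⟨fun ω => by simpa [I] using hδ.le, fun i ω => hb i ω⟩
  have heq : ∀ ω, I.integral X t ω = gridIntegral n s h X ω := by
    intro ω
    simp only [SimplePredictable.integral, gridIntegral, I, zero_mul, zero_add, min_eq_left (hst _)]
  simpa only [heq] using hI

/-- Fatou's lemma for sets, by continuity from below of the outer measure; no measurability of `A`
or `B m` is required. -/
theorem measure_le_of_forall_eventually {A : Set Ω} {B : ℕ → Set Ω} {c : ℝ≥0∞}
    (h : ∀ᵐ ω ∂μ, ω ∈ A → ∀ᶠ m in atTop, ω ∈ B m) (hB : ∀ m, μ (B m) ≤ c) : μ A ≤ c := by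
  have h1 : μ A ≤ μ (⋃ M : ℕ, ⋂ m ≥ M, B m) := by
    refine measure_mono_ae ?_
    filter_upwards [h] with ω hω hA
    obtain ⟨M, hM⟩ := eventually_atTop.1 (hω hA)
    exact mem_iUnion.2 ⟨M, mem_iInter₂.2 hM⟩
  have hmono : Monotone fun M : ℕ => ⋂ m ≥ M, B m := fun M M' hMM' =>
    biInter_subset_biInter_left fun m (hm : M' ≤ m) => hMM'.trans hm
  rw [hmono.measure_iUnion] at h1
  exact h1.trans (iSup_le fun M => (measure_mono (biInter_subset_of_mem (le_refl M))).trans (hB M))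

/-- Telescoping over `[i, j)`. Constancy of `y` from `K` on, that is, stopping at `t`, permits `j >
K`. -/
theorem sum_ite_mul_sub (y : ℕ → ℝ) {i j K : ℕ} (hij : i ≤ j) (hy : ∀ k ≥ K, y k = y K) :
    ∑ k ∈ Finset.range K, (if i ≤ k ∧ k < j then 1 else 0) * (y (k + 1) - y k) = y j - y i := by
  have h1 : ∑ k ∈ Finset.range K, (if i ≤ k ∧ k < j then 1 else 0) * (y (k + 1) - y k) =
      ∑ k ∈ Finset.range (max K j), (if i ≤ k ∧ k < j then 1 else 0) * (y (k + 1) - y k) := by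
    refine Finset.sum_subset (Finset.range_mono (le_max_left _ _)) fun k _ hk => ?_
    have hk' : K ≤ k := by simpa using hk
    rw [hy k hk', hy (k + 1) (by omega), sub_self, mul_zero]
  have h2 : ∑ k ∈ Finset.range (max K j), (if i ≤ k ∧ k < j then 1 else 0) * (y (k + 1) - y k) =
      ∑ k ∈ Finset.Ico i j, (y (k + 1) - y k) := by
    simp only [ite_mul, one_mul, zero_mul]
    rw [← Finset.sum_filter]
    refine Finset.sum_congr ?_ fun _ _ => rfl
    ext k
    simp only [Finset.mem_filter, Finset.mem_range, Finset.mem_Ico]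
    constructor
    · exact fun h => h.2
    · exact fun h => ⟨h.2.trans_le (le_max_right _ _), h⟩
  rw [h1, h2, Finset.sum_Ico_eq_sub _ hij, Finset.sum_range_sub, Finset.sum_range_sub]
  ring

/-- The intervals `[c i, c (i + 1))` are disjoint, so at most one term is nonzero. Recording that
the sum vanishes from `c n` on makes the induction close. -/
theorem abs_sum_ite_le {c : ℕ → ℕ} (hc : Monotone c) {H : ℕ → ℝ} {δ : ℝ} (hδ : 0 ≤ δ)
    (hH : ∀ i, |H i| ≤ δ) (k n : ℕ) :
    |∑ i ∈ Finset.range n, H i * (if c i ≤ k ∧ k < c (i + 1) then 1 else 0)| ≤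
      if k < c n then δ else 0 := by
  induction n with
  | zero =>
    simp only [Finset.range_zero, Finset.sum_empty, abs_zero]
    split_ifs <;> simp [hδ]
  | succ n ih =>
    rw [Finset.sum_range_succ]
    by_cases h1 : k < c n
    · have h2 : k < c (n + 1) := h1.trans_le (hc (Nat.le_succ n))
      rw [if_pos h1] at ih
      rw [if_pos h2, if_neg (by omega), mul_zero, add_zero]
      exact ih
    · rw [if_neg h1, abs_nonpos_iff] at ih
      rw [ih, zero_add]
      by_cases h2 : k < c (n + 1)
      · rw [if_pos h2, if_pos ⟨not_lt.1 h1, h2⟩, mul_one]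
        exact hH n
      · rw [if_neg h2, if_neg (fun h => h2 h.2), mul_zero, abs_zero]

theorem ceil_le_iff_le_div (r : ℝ≥0) (m k : ℕ) : ⌈r * 2 ^ m⌉₊ ≤ k ↔ r ≤ (k : ℝ≥0) / 2 ^ m := by
  rw [Nat.ceil_le, le_div_iff₀ (by positivity)]

/-- The dyadic approximations of `r` from above, stopped at `t`. -/
theorem tendsto_min_ceil (r t : ℝ≥0) :
    Tendsto (fun m : ℕ => min ((⌈r * 2 ^ m⌉₊ : ℝ≥0) / 2 ^ m) t) atTop (𝓝[≥] (min r t)) := by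
  have h1 : ∀ m : ℕ, r ≤ (⌈r * 2 ^ m⌉₊ : ℝ≥0) / 2 ^ m := fun m =>
    (ceil_le_iff_le_div r m _).1 le_rfl
  have h2 : ∀ m : ℕ, (⌈r * 2 ^ m⌉₊ : ℝ≥0) / 2 ^ m ≤ dyadicAbove m r := by
    intro m
    rw [dyadicAbove]
    gcongr
    exact Nat.ceil_le_floor_add_one _
  have h3 : Tendsto (fun m : ℕ => (⌈r * 2 ^ m⌉₊ : ℝ≥0) / 2 ^ m) atTop (𝓝 r) :=
    tendsto_of_tendsto_of_tendsto_of_le_of_le tendsto_const_nhds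
      ((tendsto_dyadicAbove r).mono_right nhdsWithin_le_nhds) h1 h2
  exact tendsto_nhdsWithin_iff.2 ⟨h3.min tendsto_const_nhds,
    Eventually.of_forall fun m => min_le_min_right t (h1 m)⟩

theorem measurable_indicator_stoppingTime {τ : Ω → WithTop ℝ≥0} (hτ : IsStoppingTime F τ)
    {H : Ω → ℝ} (hH : Measurable[hτ.measurableSpace] H) (u : ℝ≥0) :
    Measurable[F u] ({ω | τ ω ≤ u}.indicator H) := by
  classical
  intro B hB
  rw [indicator_preimage, Set.ite]
  refine MeasurableSet.union ((hH hB).2 u) (MeasurableSet.diff ?_ (hτ u))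
  exact (@measurable_const _ _ _ (F u) (0 : ℝ)) hB

/-- A grid integrator with a right-continuous version is a semimartingale. -/
theorem IsGridIntegrator.isSemimartingale {N V : ℝ≥0 → Ω → ℝ} (hN : IsGridIntegrator F μ N)
    (hNm : ∀ t, Measurable[F t] (N t)) (hV : ∀ᵐ ω ∂μ, IsRCLL fun t => V t ω)
    (hVN : ∀ t, V t =ᵐ[μ] N t) {C : ℝ} (hC : 0 ≤ C) (h0 : ∀ᵐ ω ∂μ, |V 0 ω| ≤ C) :
    IsSemimartingale F μ V where
  adapted t := ⟨N t, (hNm t).stronglyMeasurable, hVN t⟩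
  rcll := hV
  good_integrator t ε hε := by
    obtain ⟨δ, hδ, hgrid⟩ := hN t (ε / 2) (by positivity)
    -- The second bound keeps the time-zero term below `ε / 4`, so that the remaining sum exceeds `ε
    -- / 2`, strictly.
    refine ⟨min δ (ε / (4 * (C + 1))), lt_min hδ (by positivity), fun I hI => ?_⟩
    set c : ℕ → Ω → ℕ → ℕ := fun m ω i => ⌈I.τ i ω * 2 ^ m⌉₊ with hc
    set s : ℕ → ℕ → ℝ≥0 := fun m k => min ((k : ℝ≥0) / 2 ^ m) t with hs
    have hcmono : ∀ m ω, Monotone (c m ω) := fun m ω => monotone_nat_of_le_succ fun i =>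
      Nat.ceil_mono (by gcongr; exact I.mono i ω)
    have hsmono : ∀ m, Monotone (s m) := fun m => (monotone_dyadic m).min monotone_const
    set K : ℕ → ℕ := fun m => ⌈t * 2 ^ m⌉₊ with hK
    have hsK : ∀ m k, K m ≤ k → s m k = t := fun m k hk =>
      min_eq_right ((ceil_le_iff_le_div t m k).1 hk)
    have hsK' : ∀ m k, k < K m → s m k = (k : ℝ≥0) / 2 ^ m := by
      intro m k hk
      refine min_eq_left (le_of_not_ge fun h => ?_)
      exact absurd ((ceil_le_iff_le_div t m k).2 h) (not_le.2 hk)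
    -- The integrand with stopping times rounded up to multiples of `2⁻ᵐ`. It is cut off at `K m`:
    -- from there on the stopped grid sits at `t`, increments vanish, and `F (s m k)` would be too
    -- small for adaptedness.
    set h : ℕ → ℕ → Ω → ℝ := fun m k ω => if k < K m then
      ∑ i ∈ Finset.range I.n, I.H i ω * (if c m ω i ≤ k ∧ k < c m ω (i + 1) then 1 else 0)
      else 0 with hh
    have hmeas : ∀ m k, Measurable[F (s m k)] (h m k) := by
      intro m k
      by_cases hk : k < K m
      · rw [hsK' m k hk]
        simp only [hh, hk, if_true]
        refine Finset.measurable_fun_sum _ fun i _ => ?_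
        have h1 := measurable_indicator_stoppingTime (I.isStoppingTime i) (I.measurable_H i)
          ((k : ℝ≥0) / 2 ^ m)
        have h2 : MeasurableSet[F ((k : ℝ≥0) / 2 ^ m)]
            {ω | (I.τ (i + 1) ω : WithTop ℝ≥0) ≤ ((k : ℝ≥0) / 2 ^ m : ℝ≥0)} :=
          I.isStoppingTime (i + 1) _
        have h3 : (fun ω => I.H i ω * (if c m ω i ≤ k ∧ k < c m ω (i + 1) then 1 else 0)) =
            {ω | (I.τ (i + 1) ω : WithTop ℝ≥0) ≤ ((k : ℝ≥0) / 2 ^ m : ℝ≥0)}ᶜ.indicator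
              ({ω | (I.τ i ω : WithTop ℝ≥0) ≤ ((k : ℝ≥0) / 2 ^ m : ℝ≥0)}.indicator (I.H i)) := by
          ext ω
          have hlt : k < c m ω (i + 1) ↔ ¬ I.τ (i + 1) ω ≤ (k : ℝ≥0) / 2 ^ m := by
            rw [← ceil_le_iff_le_div, not_le]
          have hle : c m ω i ≤ k ↔ I.τ i ω ≤ (k : ℝ≥0) / 2 ^ m := ceil_le_iff_le_div _ _ _
          simp only [hlt, hle]
          simp only [indicator, mem_compl_iff, mem_ofPred_eq, WithTop.coe_le_coe]
          by_cases ha : I.τ i ω ≤ (k : ℝ≥0) / 2 ^ m <;>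
            by_cases hb : I.τ (i + 1) ω ≤ (k : ℝ≥0) / 2 ^ m <;> simp [ha, hb]
        rw [h3]
        exact h1.indicator h2.compl
      · simp only [hh, hk, if_false]
        exact @measurable_const _ _ _ (F (s m k)) _
    have hbound : ∀ m k ω, |h m k ω| ≤ δ := by
      intro m k ω
      by_cases hk : k < K m
      · simp only [hh, hk, if_true]
        refine (abs_sum_ite_le (hcmono m ω) hδ.le
          (fun i => (hI.2 i ω).trans (min_le_left _ _)) k I.n).trans ?_
        split_ifs
        · exact le_rfl
        · exact hδ.le
      · simp only [hh, hk, if_false, abs_zero]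
        exact hδ.le
    have hsum : ∀ m ω, gridIntegral (K m) (s m) (h m) V ω = ∑ i ∈ Finset.range I.n,
        I.H i ω * (V (s m (c m ω (i + 1))) ω - V (s m (c m ω i)) ω) := by
      intro m ω
      have e1 : gridIntegral (K m) (s m) (h m) V ω = ∑ k ∈ Finset.range (K m),
          ∑ i ∈ Finset.range I.n, I.H i ω * ((if c m ω i ≤ k ∧ k < c m ω (i + 1) then 1 else 0) *
            (V (s m (k + 1)) ω - V (s m k) ω)) := by
        refine Finset.sum_congr rfl fun k hk => ?_
        simp only [hh, Finset.mem_range.1 hk, if_true, Finset.sum_mul, mul_assoc]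
      rw [e1, Finset.sum_comm]
      refine Finset.sum_congr rfl fun i _ => ?_
      rw [← Finset.mul_sum, sum_ite_mul_sub (fun k => V (s m k) ω) (hcmono m ω (Nat.le_succ i))]
      intro k hk
      simp only [hsK m k hk, hsK m (K m) le_rfl]
    -- Rounded times approach the stopping times from the right; this is where right-continuity of
    -- `V` enters.
    have hlim : ∀ᵐ ω ∂μ, Tendsto (fun m => gridIntegral (K m) (s m) (h m) V ω) atTop
        (𝓝 (∑ i ∈ Finset.range I.n,
          I.H i ω * (V (min (I.τ (i + 1) ω) t) ω - V (min (I.τ i ω) t) ω))) := by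
      filter_upwards [hV] with ω hω
      simp_rw [hsum]
      refine tendsto_finsetSum _ fun i _ => Tendsto.const_mul _ (Tendsto.sub ?_ ?_)
      · exact (hω.1 _).tendsto.comp (tendsto_min_ceil _ t)
      · exact (hω.1 _).tendsto.comp (tendsto_min_ceil _ t)
    have hVN' : ∀ᵐ ω ∂μ, ∀ m k, V (s m k) ω = N (s m k) ω :=
      ae_all_iff.2 fun m => ae_all_iff.2 fun k => hVN _
    refine measure_le_of_forall_eventually
      (B := fun m => {ω | ε / 2 ≤ |gridIntegral (K m) (s m) (h m) N ω|}) ?_ fun m => ?_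
    · filter_upwards [hlim, hVN', h0] with ω h1 h2 h3 hω
      have h4 : |I.H₀ ω * V 0 ω| ≤ ε / 4 := by
        rw [abs_mul]
        calc |I.H₀ ω| * |V 0 ω| ≤ ε / (4 * (C + 1)) * (C + 1) := by
              gcongr
              · exact (hI.1 ω).trans (min_le_right _ _)
              · linarith
          _ = ε / 4 := by field_simp
      have h5 : ε / 2 < |∑ i ∈ Finset.range I.n,
          I.H i ω * (V (min (I.τ (i + 1) ω) t) ω - V (min (I.τ i ω) t) ω)| := by
        have h6 := (show ε ≤ |I.integral V t ω| from hω).trans (abs_add_le _ _)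
        linarith
      filter_upwards [h1.abs.eventually (lt_mem_nhds h5)] with m hm
      have h7 : gridIntegral (K m) (s m) (h m) V ω = gridIntegral (K m) (s m) (h m) N ω := by
        simp only [gridIntegral, h2]
      rw [← h7]
      exact hm.le
    · exact (hgrid (K m) (s m) (hsmono m) (fun k => min_le_right _ _) (h m) (hmeas m)
        (hbound m)).trans (ENNReal.ofReal_le_ofReal (by linarith))

end GridIntegrator

end LongForward

/-! ### A weak-type inequality for martingale transforms -/

namespace LongForward

section MartingaleTransform

variable {Ω : Type*} {mΩ : MeasurableSpace Ω} {μ : Measure Ω}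

theorem memLp_top_mul {f g : Ω → ℝ} (hf : MemLp f ∞ μ) (hg : MemLp g ∞ μ) :
    MemLp (fun ω => f ω * g ω) ∞ μ :=
  hg.mul hf

theorem integral_mul_condExp_of_memLp_top [IsFiniteMeasure μ] {𝒢 : Filtration ℕ mΩ} {k : ℕ}
    {U Z : Ω → ℝ} (hU : StronglyMeasurable[𝒢 k] U) (hUb : MemLp U ∞ μ) (hZ : MemLp Z ∞ μ) :
    ∫ ω, U ω * (μ[Z | 𝒢 k]) ω ∂μ = ∫ ω, U ω * Z ω ∂μ := by
  have h := condExp_mul_of_stronglyMeasurable_left (m := 𝒢 k) hU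
    ((memLp_top_mul hUb hZ).integrable le_top) (hZ.integrable le_top)
  rw [← integral_condExp (μ := μ) (f := fun ω => U ω * Z ω) (𝒢.le k)]
  exact (integral_congr_ae h).symm

theorem memLp_top_condExp [IsFiniteMeasure μ] {𝒢 : Filtration ℕ mΩ} {k : ℕ} {Z : Ω → ℝ} {c : ℝ}
    (hZ : ∀ ω, |Z ω| ≤ c) : MemLp (μ[Z | 𝒢 k]) ∞ μ :=
  memLp_top_of_bound (stronglyMeasurable_condExp.mono (𝒢.le k)).aestronglyMeasurable c
    (ae_bdd_abs_condExp_of_ae_bdd_abs (ae_of_all _ hZ))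

/-- The transform of the martingale part of a bounded supermartingale is bounded in `L²`. -/
theorem integral_sq_transform_le [IsFiniteMeasure μ] {𝒢 : Filtration ℕ mΩ} {Z : ℕ → Ω → ℝ} {c : ℝ}
    (hZm : StronglyAdapted 𝒢 Z) (hZ0 : ∀ k ω, 0 ≤ Z k ω) (hZc : ∀ k ω, Z k ω ≤ c)
    (hsup : ∀ k, μ[Z (k + 1) | 𝒢 k] ≤ᵐ[μ] Z k) {h : ℕ → Ω → ℝ} (hm : ∀ k, Measurable[𝒢 k] (h k))
    {δ : ℝ} (hb : ∀ k ω, |h k ω| ≤ δ) (n : ℕ) :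
    ∫ ω, (∑ k ∈ Finset.range n, h k ω * (Z (k + 1) ω - (μ[Z (k + 1) | 𝒢 k]) ω)) ^ 2 ∂μ ≤
      δ ^ 2 * ((∫ ω, Z n ω ^ 2 ∂μ) - (∫ ω, Z 0 ω ^ 2 ∂μ) +
        2 * c * ((∫ ω, Z 0 ω ∂μ) - ∫ ω, Z n ω ∂μ)) := by
  set p : ℕ → Ω → ℝ := fun k => μ[Z (k + 1) | 𝒢 k] with hp
  set W : ℕ → Ω → ℝ := fun n ω => ∑ k ∈ Finset.range n, h k ω * (Z (k + 1) ω - p k ω) with hW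
  have hZabs : ∀ k ω, |Z k ω| ≤ c := fun k ω => by
    rw [abs_of_nonneg (hZ0 k ω)]; exact hZc k ω
  have hZL : ∀ k, MemLp (Z k) ∞ μ := fun k =>
    memLp_top_of_bound ((hZm k).mono (𝒢.le k)).aestronglyMeasurable c (ae_of_all _ (hZabs k))
  have hpL : ∀ k, MemLp (p k) ∞ μ := fun k => memLp_top_condExp (hZabs (k + 1))
  have hpm : ∀ k, StronglyMeasurable[𝒢 k] (p k) := fun k => stronglyMeasurable_condExp
  have hhL : ∀ k, MemLp (h k) ∞ μ := fun k =>
    memLp_top_of_bound ((hm k).mono (𝒢.le k) le_rfl).aestronglyMeasurable δ (ae_of_all _ (hb k))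
  have hWs : ∀ n, StronglyMeasurable[𝒢 n] (W n) ∧ MemLp (W n) ∞ μ := by
    intro n
    induction n with
    | zero =>
      have h0 : W 0 = fun _ => 0 := by ext ω; simp [hW]
      rw [h0]
      exact ⟨stronglyMeasurable_const, MemLp.zero⟩
    | succ n ih =>
      have h1 : W (n + 1) = fun ω => W n ω + h n ω * (Z (n + 1) ω - p n ω) := by
        ext ω; simp only [hW, Finset.sum_range_succ]
      have hle := 𝒢.mono (Nat.le_succ n)
      rw [h1]
      refine ⟨(ih.1.mono hle).add (((hm n).mono hle le_rfl).stronglyMeasurable.mul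
        ((hZm (n + 1)).sub ((hpm n).mono hle))), ih.2.add (memLp_top_mul (hhL n)
          ((hZL (n + 1)).sub (hpL n)))⟩
  have hint : ∀ {f : Ω → ℝ}, MemLp f ∞ μ → Integrable f μ := fun hf => hf.integrable le_top
  have hpint : ∀ k, ∫ ω, p k ω ∂μ = ∫ ω, Z (k + 1) ω ∂μ := fun k => integral_condExp (𝒢.le k)
  suffices hmain : ∫ ω, W n ω ^ 2 ∂μ ≤ _ from hmain
  induction n with
  | zero => simp [hW]
  | succ n ih =>
    have hdL : MemLp (fun ω => Z (n + 1) ω - p n ω) ∞ μ := (hZL (n + 1)).sub (hpL n)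
    have hU : StronglyMeasurable[𝒢 n] fun ω => W n ω * h n ω :=
      (hWs n).1.mul (hm n).stronglyMeasurable
    have hUL := memLp_top_mul (hWs n).2 (hhL n)
    have hsq : ∀ {f : Ω → ℝ}, MemLp f ∞ μ → Integrable (fun ω => f ω ^ 2) μ := fun {f} hf => by
      simpa only [sq] using hint (memLp_top_mul hf hf)
    -- Martingale increments are orthogonal to the past.
    have hcross : ∫ ω, (W n ω * h n ω) * (Z (n + 1) ω - p n ω) ∂μ = 0 := by
      simp_rw [mul_sub]
      rw [integral_sub (hint (memLp_top_mul hUL (hZL _))) (hint (memLp_top_mul hUL (hpL _))),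
        integral_mul_condExp_of_memLp_top hU hUL (hZL (n + 1)), sub_self]
    have hpp : ∫ ω, p n ω * Z (n + 1) ω ∂μ = ∫ ω, p n ω ^ 2 ∂μ := by
      rw [← integral_mul_condExp_of_memLp_top (hpm n) (hpL n) (hZL (n + 1))]
      simp only [sq]
      rfl
    have hd2 : ∫ ω, (Z (n + 1) ω - p n ω) ^ 2 ∂μ =
        (∫ ω, Z (n + 1) ω ^ 2 ∂μ) - ∫ ω, p n ω ^ 2 ∂μ := by
      have e : ∀ ω, (Z (n + 1) ω - p n ω) ^ 2 =
          Z (n + 1) ω ^ 2 - 2 * (p n ω * Z (n + 1) ω) + p n ω ^ 2 := fun ω => by ring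
      simp_rw [e]
      have i1 := hint (memLp_top_mul (hpL n) (hZL (n + 1)))
      have i2 : Integrable (fun ω => Z (n + 1) ω ^ 2 - 2 * (p n ω * Z (n + 1) ω)) μ :=
        (hsq (hZL _)).sub (i1.const_mul 2)
      rw [integral_add i2 (hsq (hpL n)),
        integral_sub (hsq (hZL _)) (i1.const_mul 2), integral_const_mul, hpp]
      ring
    -- From `Z² - p² = (Z - p)(Z + p)` and `p ≤ Z ≤ c`; added to `hd2` this gives a telescoping
    -- bound.
    have hZp : (∫ ω, Z n ω ^ 2 ∂μ) - ∫ ω, p n ω ^ 2 ∂μ ≤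
        2 * c * ((∫ ω, Z n ω ∂μ) - ∫ ω, Z (n + 1) ω ∂μ) := by
      rw [← hpint, ← integral_sub (hsq (hZL n)) (hsq (hpL n)),
        ← integral_sub (hint (hZL n)) (hint (hpL n)), ← integral_const_mul]
      refine integral_mono_ae ((hsq (hZL n)).sub (hsq (hpL n)))
        (((hint (hZL n)).sub (hint (hpL n))).const_mul _) ?_
      filter_upwards [hsup n] with ω h1
      have h2 : p n ω ≤ Z n ω := h1
      have h3 := hZc n ω
      have h4 := hZ0 n ω
      change Z n ω ^ 2 - p n ω ^ 2 ≤ 2 * c * (Z n ω - p n ω)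
      nlinarith
    have hthird : ∫ ω, h n ω ^ 2 * (Z (n + 1) ω - p n ω) ^ 2 ∂μ ≤
        δ ^ 2 * ∫ ω, (Z (n + 1) ω - p n ω) ^ 2 ∂μ := by
      rw [← integral_const_mul]
      refine integral_mono ?_ ((hsq hdL).const_mul _) fun ω => ?_
      · simpa only [mul_pow] using hsq (memLp_top_mul (hhL n) hdL)
      · exact mul_le_mul_of_nonneg_right
          (sq_le_sq' (abs_le.1 (hb n ω)).1 (abs_le.1 (hb n ω)).2) (sq_nonneg _)
    have hexp : ∫ ω, W (n + 1) ω ^ 2 ∂μ = (∫ ω, W n ω ^ 2 ∂μ) +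
        ∫ ω, h n ω ^ 2 * (Z (n + 1) ω - p n ω) ^ 2 ∂μ := by
      have e : ∀ ω, W (n + 1) ω ^ 2 = W n ω ^ 2 +
          2 * ((W n ω * h n ω) * (Z (n + 1) ω - p n ω)) +
            h n ω ^ 2 * (Z (n + 1) ω - p n ω) ^ 2 := fun ω => by
        simp only [hW, Finset.sum_range_succ]
        ring
      simp_rw [e]
      have i1 := hint (memLp_top_mul hUL hdL)
      have i2 : Integrable (fun ω => h n ω ^ 2 * (Z (n + 1) ω - p n ω) ^ 2) μ := by
        simpa only [mul_pow] using hsq (memLp_top_mul (hhL n) hdL)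
      have i3 : Integrable (fun ω => W n ω ^ 2 +
          2 * ((W n ω * h n ω) * (Z (n + 1) ω - p n ω))) μ :=
        (hsq (hWs n).2).add (i1.const_mul 2)
      rw [integral_add i3 i2,
        integral_add (hsq (hWs n).2) (i1.const_mul 2), integral_const_mul, hcross]
      ring
    rw [hexp]
    nlinarith [sq_nonneg δ]

/-- Doob's maximal inequality for the absolute value of a martingale. -/
theorem measure_exists_lt_le [IsFiniteMeasure μ] {𝒢 : Filtration ℕ mΩ} {Y : ℕ → Ω → ℝ}
    (hY : Martingale Y 𝒢 μ) (n : ℕ) {c : ℝ} (hc : 0 < c) :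
    μ {ω | ∃ k ≤ n, c < |Y k ω|} ≤ ENNReal.ofReal ((∫ ω, |Y n ω| ∂μ) / c) := by
  have hsub := hY.submartingale.sup hY.neg.submartingale
  have hmax := maximal_ineq hsub (fun k ω => (abs_nonneg (Y k ω))) (ε := c.toNNReal) n
  have hle : c.toNNReal • μ {ω | ∃ k ≤ n, c < |Y k ω|} ≤ ENNReal.ofReal (∫ ω, |Y n ω| ∂μ) := by
    refine le_trans ?_ (hmax.trans (ENNReal.ofReal_le_ofReal
      (setIntegral_le_integral (hY.integrable n).abs (ae_of_all _ fun ω => abs_nonneg _))))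
    rw [ENNReal.smul_def, smul_eq_mul]
    refine mul_le_mul' le_rfl (measure_mono ?_)
    rintro ω ⟨k, hk, hkc⟩
    rw [mem_ofPred_eq, Real.coe_toNNReal _ hc.le, Finset.le_sup'_iff]
    exact ⟨k, by simpa [Nat.lt_succ_iff] using hk, hkc.le⟩
  rw [ENNReal.smul_def, smul_eq_mul, mul_comm, show (c.toNNReal : ℝ≥0∞) = ENNReal.ofReal c from rfl]
    at hle
  rw [ENNReal.ofReal_div_of_pos hc]
  exact (ENNReal.le_div_iff_mul_le (Or.inl (by simpa using hc))
    (Or.inl ENNReal.ofReal_ne_top)).2 hle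

theorem measure_le_integral_div [IsFiniteMeasure μ] {f : Ω → ℝ} (hf : 0 ≤ᵐ[μ] f)
    (hi : Integrable f μ) {ε : ℝ} (hε : 0 < ε) :
    μ {ω | ε ≤ f ω} ≤ ENNReal.ofReal ((∫ ω, f ω ∂μ) / ε) := by
  have h := mul_meas_ge_le_integral_of_nonneg hf hi ε
  rw [← ofReal_measureReal (measure_ne_top μ _)]
  refine ENNReal.ofReal_le_ofReal ?_
  rw [le_div_iff₀ hε, mul_comm]
  exact h

/-- A weak-type estimate for transforms of nonnegative martingales. -/
theorem measure_transform_le [IsProbabilityMeasure μ] {𝒢 : Filtration ℕ mΩ} {Y : ℕ → Ω → ℝ}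
    (hY : Martingale Y 𝒢 μ) (hnn : ∀ k, 0 ≤ᵐ[μ] Y k) {h : ℕ → Ω → ℝ}
    (hm : ∀ k, Measurable[𝒢 k] (h k)) {δ : ℝ} (hb : ∀ k ω, |h k ω| ≤ δ) (hδ : 0 ≤ δ) (n : ℕ)
    {c ε : ℝ} (hc : 0 < c) (hε : 0 < ε) :
    μ {ω | ε ≤ |∑ k ∈ Finset.range n, h k ω * (Y (k + 1) ω - Y k ω)|} ≤
      ENNReal.ofReal ((∫ ω, |Y n ω| ∂μ) / c + 12 * (δ * c / ε) ^ 2 + 2 * (δ * c / ε)) := by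
  -- Capping at `c` gives a bounded supermartingale which agrees almost surely with `Y` while `|Y| ≤
  -- c`. The maximum with `0` only makes nonnegativity hold everywhere.
  set Z : ℕ → Ω → ℝ := fun k ω => max 0 (min (Y k ω) c) with hZ
  have hZm : StronglyAdapted 𝒢 Z := fun k =>
    ((@measurable_const _ _ _ (𝒢 k) (0 : ℝ)).max ((hY.1 k).measurable.min
      (@measurable_const _ _ _ (𝒢 k) c))).stronglyMeasurable
  have hZ0 : ∀ k ω, 0 ≤ Z k ω := fun k ω => le_max_left _ _
  have hZc : ∀ k ω, Z k ω ≤ c := fun k ω => max_le hc.le (min_le_right _ _)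
  have hZi : ∀ k, Integrable (Z k) μ := fun k => by
    refine Integrable.of_bound ((hZm k).mono (𝒢.le k)).aestronglyMeasurable c
      (ae_of_all _ fun ω => ?_)
    rw [Real.norm_eq_abs, abs_of_nonneg (hZ0 k ω)]
    exact hZc k ω
  have hsup : ∀ k, μ[Z (k + 1) | 𝒢 k] ≤ᵐ[μ] Z k := by
    intro k
    have h1 : μ[Z (k + 1) | 𝒢 k] ≤ᵐ[μ] μ[Y (k + 1) | 𝒢 k] :=
      condExp_mono (hZi _) (hY.integrable _) ((hnn (k + 1)).mono fun ω hω =>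
        max_le hω (min_le_left _ _))
    have h2 : μ[Z (k + 1) | 𝒢 k] ≤ᵐ[μ] μ[fun _ => c | 𝒢 k] :=
      condExp_mono (hZi _) (integrable_const c) (ae_of_all _ fun ω => hZc _ ω)
    rw [condExp_const (𝒢.le k)] at h2
    filter_upwards [h1, h2, hY.2 k (k + 1) (Nat.le_succ k)] with ω h1 h2 h3
    exact le_max_of_le_right (le_min (h1.trans h3.le) h2)
  have hL2 := integral_sq_transform_le hZm hZ0 hZc hsup hm hb n
  set p : ℕ → Ω → ℝ := fun k => μ[Z (k + 1) | 𝒢 k] with hp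
  set W : Ω → ℝ := fun ω => ∑ k ∈ Finset.range n, h k ω * (Z (k + 1) ω - p k ω) with hW
  set A : Ω → ℝ := fun ω => ∑ k ∈ Finset.range n, (Z k ω - p k ω) with hA
  have hpi : ∀ k, Integrable (p k) μ := fun k => integrable_condExp
  have hAi : Integrable A μ := integrable_finsetSum _ fun k _ => (hZi k).sub (hpi k)
  have hA0 : 0 ≤ᵐ[μ] A := by
    filter_upwards [ae_all_iff.2 hsup] with ω hω
    exact Finset.sum_nonneg fun k _ => sub_nonneg.2 (hω k)
  have hZint : ∀ k, 0 ≤ ∫ ω, Z k ω ∂μ ∧ ∫ ω, Z k ω ∂μ ≤ c := by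
    intro k
    refine ⟨integral_nonneg (hZ0 k), ?_⟩
    have := integral_mono (hZi k) (integrable_const c) (hZc k)
    simpa using this
  have hAint : ∫ ω, A ω ∂μ ≤ c := by
    have e : ∫ ω, A ω ∂μ = (∫ ω, Z 0 ω ∂μ) - ∫ ω, Z n ω ∂μ := by
      have e0 : ∀ k, Integrable (fun ω => Z k ω - p k ω) μ := fun k => (hZi k).sub (hpi k)
      simp only [hA]
      rw [integral_finsetSum _ fun k _ => e0 k]
      have e1 : ∀ k, ∫ ω, (Z k ω - p k ω) ∂μ = -((∫ ω, Z (k + 1) ω ∂μ) - ∫ ω, Z k ω ∂μ) := by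
        intro k
        rw [integral_sub (hZi k) (hpi k), hp, integral_condExp (𝒢.le k)]
        ring
      simp_rw [e1]
      rw [Finset.sum_neg_distrib, Finset.sum_range_sub fun k => ∫ ω, Z k ω ∂μ]
      ring
    rw [e]
    linarith [(hZint 0).2, (hZint n).1]
  have hZabs : ∀ k ω, |Z k ω| ≤ c := fun k ω => by
    rw [abs_of_nonneg (hZ0 k ω)]; exact hZc k ω
  have hWL : MemLp W ∞ μ := by
    refine memLp_finsetSum _ fun k _ => memLp_top_mul
      (memLp_top_of_bound ((hm k).mono (𝒢.le k) le_rfl).aestronglyMeasurable δ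
        (ae_of_all _ (hb k))) (MemLp.sub ?_ (memLp_top_condExp (hZabs (k + 1))))
    exact memLp_top_of_bound ((hZm _).mono (𝒢.le _)).aestronglyMeasurable c
      (ae_of_all _ (hZabs _))
  have hW2 : Integrable (fun ω => W ω ^ 2) μ := by
    simpa only [sq] using (memLp_top_mul hWL hWL).integrable le_top
  have hW3 : ∫ ω, W ω ^ 2 ∂μ ≤ 3 * (δ * c) ^ 2 := by
    refine hL2.trans ?_
    have h1 : ∫ ω, Z n ω ^ 2 ∂μ ≤ c ^ 2 := by
      have := integral_mono_of_nonneg (μ := μ) (f := fun ω => Z n ω ^ 2) (g := fun _ => c ^ 2)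
        (ae_of_all _ fun ω => sq_nonneg _) (integrable_const _)
        (ae_of_all _ fun ω => pow_le_pow_left₀ (hZ0 n ω) (hZc n ω) 2)
      simpa using this
    have h2 : 0 ≤ ∫ ω, Z 0 ω ^ 2 ∂μ := integral_nonneg fun ω => sq_nonneg _
    have h3 : 2 * c * ((∫ ω, Z 0 ω ∂μ) - ∫ ω, Z n ω ∂μ) ≤ 2 * c * c := by
      have := (hZint 0).2
      have := (hZint n).1
      gcongr
      linarith
    calc _ ≤ δ ^ 2 * (3 * c ^ 2) := by
          gcongr
          linarith
      _ = _ := by ring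
  -- Unless `Y` exceeds `c`, the Doob decomposition of `Z` splits the transform into the
  -- `L²`-bounded `W` and a part dominated by `δ A`, with `A` increasing in `n` almost surely and of
  -- mean at most `c`. One of the two must reach `ε / 2`.
  have hsub : {ω | ε ≤ |∑ k ∈ Finset.range n, h k ω * (Y (k + 1) ω - Y k ω)|} ≤ᵐ[μ]
      ({ω | ∃ k ≤ n, c < |Y k ω|} ∪ ({ω | (ε / 2) ^ 2 ≤ W ω ^ 2} ∪ {ω | ε / 2 ≤ δ * A ω}) :
        Set Ω) := by
    filter_upwards [ae_all_iff.2 hnn, ae_all_iff.2 hsup] with ω h1 h2 hω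
    by_cases hbig : ∃ k ≤ n, c < |Y k ω|
    · exact Or.inl hbig
    refine Or.inr ?_
    push Not at hbig
    have hYZ : ∀ k ≤ n, Y k ω = Z k ω := by
      intro k hk
      simp only [hZ]
      rw [min_eq_left ((le_abs_self _).trans (hbig k hk)),
        max_eq_right (show (0 : ℝ) ≤ Y k ω from h1 k)]
    have hdec : ∑ k ∈ Finset.range n, h k ω * (Y (k + 1) ω - Y k ω) =
        W ω - ∑ k ∈ Finset.range n, h k ω * (Z k ω - p k ω) := by
      rw [hW, ← Finset.sum_sub_distrib]
      refine Finset.sum_congr rfl fun k hk => ?_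
      have hk' := Finset.mem_range.1 hk
      rw [hYZ k hk'.le, hYZ (k + 1) hk']
      ring
    have hAb : |∑ k ∈ Finset.range n, h k ω * (Z k ω - p k ω)| ≤ δ * A ω := by
      rw [hA, Finset.mul_sum]
      refine (Finset.abs_sum_le_sum_abs _ _).trans (Finset.sum_le_sum fun k _ => ?_)
      have h3 : 0 ≤ Z k ω - p k ω := sub_nonneg.2 (h2 k)
      rw [abs_mul, abs_of_nonneg h3]
      gcongr
      exact hb k ω
    have hω' : ε ≤ |∑ k ∈ Finset.range n, h k ω * (Y (k + 1) ω - Y k ω)| := hω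
    rw [hdec] at hω'
    have h4 := hω'.trans (abs_sub _ _)
    rcases le_total (ε / 2) |W ω| with h5 | h5
    · left
      have := pow_le_pow_left₀ (by positivity) h5 2
      rwa [sq_abs] at this
    · right
      change ε / 2 ≤ δ * A ω
      linarith
  have hb1 := measure_exists_lt_le hY n hc
  have hb2 : μ {ω | (ε / 2) ^ 2 ≤ W ω ^ 2} ≤ ENNReal.ofReal (12 * (δ * c / ε) ^ 2) := by
    refine (measure_le_integral_div (ae_of_all _ fun ω => sq_nonneg _) hW2 (by positivity)).trans
      (ENNReal.ofReal_le_ofReal ?_)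
    rw [div_le_iff₀ (by positivity)]
    refine hW3.trans (le_of_eq ?_)
    field_simp
    ring
  have hb3 : μ {ω | ε / 2 ≤ δ * A ω} ≤ ENNReal.ofReal (2 * (δ * c / ε)) := by
    refine (measure_le_integral_div (hA0.mono fun ω hω => mul_nonneg hδ hω) (hAi.const_mul δ)
      (by positivity)).trans (ENNReal.ofReal_le_ofReal ?_)
    rw [integral_const_mul, div_le_iff₀ (by positivity)]
    calc δ * ∫ ω, A ω ∂μ ≤ δ * c := by gcongr
      _ = _ := by field_simp
  calc _ ≤ _ := measure_mono_ae hsub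
    _ ≤ _ + (_ + _) := (measure_union_le _ _).trans (add_le_add le_rfl (measure_union_le _ _))
    _ ≤ _ := add_le_add hb1 (add_le_add hb2 hb3)
    _ = _ := by
      have i0 : 0 ≤ ∫ ω, |Y n ω| ∂μ := integral_nonneg fun ω => abs_nonneg _
      rw [← ENNReal.ofReal_add (by positivity) (by positivity),
        ← ENNReal.ofReal_add (by positivity) (by positivity), ← add_assoc]

/-- Nonnegative martingales are good integrators along deterministic grids. -/
theorem isGridIntegrator_of_martingale [IsProbabilityMeasure μ] {F : Filtration ℝ≥0 mΩ}
    {N : ℝ≥0 → Ω → ℝ} (hN : Martingale N F μ) (hnn : ∀ t, 0 ≤ᵐ[μ] N t) :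
    IsGridIntegrator F μ N := by
  intro t ε hε
  set e := ∫ ω, |N t ω| ∂μ with he
  have he0 : 0 ≤ e := integral_nonneg fun ω => abs_nonneg _
  -- This `c` makes the maximal term at most `ε / 2`. With `δ = x ε / c` the ratio `δ c / ε` is `x`,
  -- and `12 x² + 2 x ≤ 14 x ≤ ε / 2`.
  set c := 2 * (e + 1) / ε with hc
  have hc0 : 0 < c := by positivity
  set x := min 1 (ε / 28) with hx
  have hx0 : 0 < x := lt_min one_pos (by positivity)
  refine ⟨x * ε / c, by positivity, fun n s hs hst h hm hb => ?_⟩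
  refine (measure_transform_le (martingale_sampled hN hs) (fun k => hnn (s k)) hm hb
    (by positivity) n hc0 hε).trans (ENNReal.ofReal_le_ofReal ?_)
  have h1 : x * ε / c * c / ε = x := by field_simp
  rw [h1]
  have h2 : (∫ ω, |N (s n) ω| ∂μ) / c ≤ ε / 2 := by
    rw [div_le_iff₀ hc0]
    refine (integral_abs_mono hN (hst n)).trans ?_
    rw [hc, ← he]
    field_simp
    linarith
  have h3 : x ≤ 1 := min_le_left _ _
  have h4 : x ≤ ε / 28 := min_le_right _ _
  nlinarith

end MartingaleTransform

end LongForward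

/-! ### Quotients of good integrators -/

namespace LongForward

/-- The projection of `x` onto `[-c, c]`. -/
def truncate (c x : ℝ) : ℝ := max (-c) (min x c)

theorem abs_truncate_le {c : ℝ} (hc : 0 ≤ c) (x : ℝ) : |truncate c x| ≤ c :=
  abs_le.2 ⟨le_max_left _ _, max_le (by linarith) (min_le_right _ _)⟩

theorem truncate_eq_self {c x : ℝ} (h : |x| ≤ c) : truncate c x = x := by
  rw [truncate, min_eq_left (abs_le.1 h).2, max_eq_right (abs_le.1 h).1]

theorem measurable_truncate (c : ℝ) : Measurable (truncate c) := by
  unfold truncate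
  fun_prop

section Quotient

variable {Ω : Type*} {mΩ : MeasurableSpace Ω} {F : Filtration ℝ≥0 mΩ} {μ : Measure Ω}

/-- The maxima of `|X|` over finite subsets of `[0, t]` are uniformly bounded in probability. -/
def IsGridBounded (μ : Measure Ω) (X : ℝ≥0 → Ω → ℝ) : Prop :=
  ∀ t : ℝ≥0, ∀ ε : ℝ, 0 < ε → ∃ c : ℝ, 0 < c ∧ ∀ (n : ℕ) (s : ℕ → ℝ≥0), (∀ k, s k ≤ t) →
    μ {ω | ∃ k ≤ n, c < |X (s k) ω|} ≤ ENNReal.ofReal ε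

theorem isGridBounded_of_isRCLL [IsFiniteMeasure μ] {V N : ℝ≥0 → Ω → ℝ}
    (hV : ∀ᵐ ω ∂μ, IsRCLL fun t => V t ω) (hVN : ∀ t, V t =ᵐ[μ] N t)
    (hN : ∀ t, Measurable (N t)) : IsGridBounded μ N := by
  intro t ε hε
  obtain ⟨c, hc, h⟩ := exists_measure_lt_le hV hVN hN t hε
  refine ⟨c, hc, fun n s hs => (measure_mono_ae ?_).trans h⟩
  filter_upwards [ae_all_iff.2 fun k => hVN (s k)] with ω hω
  rintro ⟨k, _, hk⟩
  exact ⟨s k, hs k, by rwa [hω k]⟩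

/-- The sums of the squared increments along grids in `[0, t]` are bounded in probability. -/
theorem IsGridIntegrator.exists_measure_sum_sq_le {X : ℝ≥0 → Ω → ℝ} (hX : IsGridIntegrator F μ X)
    (hXm : ∀ t, Measurable[F t] (X t)) (hXb : IsGridBounded μ X) (t : ℝ≥0) {ε : ℝ} (hε : 0 < ε) :
    ∃ K : ℝ, 0 < K ∧ ∀ (n : ℕ) (s : ℕ → ℝ≥0), Monotone s → (∀ k, s k ≤ t) →
      μ {ω | K < ∑ k ∈ Finset.range n, (X (s (k + 1)) ω - X (s k) ω) ^ 2} ≤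
        ENNReal.ofReal ε := by
  obtain ⟨c, hc, hb⟩ := hXb t (ε / 2) (by positivity)
  obtain ⟨δ, hδ, hI⟩ := hX t (ε / 2) (by positivity)
  refine ⟨c ^ 2 + c / δ * ε, by positivity, fun n s hs hst => ?_⟩
  -- Integrating a multiple of `X` against itself: summation by parts expresses the sum of squares
  -- as `X_n² - X_0² - 2 ∑ X ΔX`. Truncation keeps the integrand below `δ`.
  set h : ℕ → Ω → ℝ := fun k ω => δ / c * truncate c (X (s k) ω) with hh
  have h1 := hI n s hs hst h
    (fun k => ((measurable_truncate c).comp (hXm (s k))).const_mul _) fun k ω => by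
      rw [hh, abs_mul, abs_of_pos (by positivity)]
      calc δ / c * |truncate c (X (s k) ω)| ≤ δ / c * c := by
            gcongr
            exact abs_truncate_le hc.le _
        _ = δ := by field_simp
  have hsub : {ω | c ^ 2 + c / δ * ε < ∑ k ∈ Finset.range n, (X (s (k + 1)) ω - X (s k) ω) ^ 2} ⊆
      {ω | ∃ k ≤ n, c < |X (s k) ω|} ∪ {ω | ε / 2 ≤ |gridIntegral n s h X ω|} := by
    intro ω hω
    by_contra hcon
    simp only [mem_union, mem_ofPred_eq, not_or, not_exists, not_and, not_lt, not_le] at hcon hω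
    obtain ⟨h2, h3⟩ := hcon
    have h4 : gridIntegral n s h X ω = δ / c *
        ∑ k ∈ Finset.range n, X (s k) ω * (X (s (k + 1)) ω - X (s k) ω) := by
      rw [gridIntegral, Finset.mul_sum]
      refine Finset.sum_congr rfl fun k hk => ?_
      simp only [hh]
      rw [truncate_eq_self (h2 k (Finset.mem_range.1 hk).le), mul_assoc]
    rw [h4, abs_mul, abs_of_pos (by positivity)] at h3
    have h5 : ∑ k ∈ Finset.range n, (X (s (k + 1)) ω - X (s k) ω) ^ 2 =
        X (s n) ω ^ 2 - X (s 0) ω ^ 2 -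
          2 * ∑ k ∈ Finset.range n, X (s k) ω * (X (s (k + 1)) ω - X (s k) ω) := by
      rw [← Finset.sum_range_sub (fun k => X (s k) ω ^ 2), Finset.mul_sum,
        ← Finset.sum_sub_distrib]
      exact Finset.sum_congr rfl fun k _ => by ring
    set A := ∑ k ∈ Finset.range n, X (s k) ω * (X (s (k + 1)) ω - X (s k) ω)
    have h6 : |A| < c / δ * (ε / 2) := by
      have h7 := mul_lt_mul_of_pos_left h3 (show 0 < c / δ by positivity)
      have h8 : c / δ * (δ / c * |A|) = |A| := by field_simp
      rwa [h8] at h7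
    have h9 : X (s n) ω ^ 2 ≤ c ^ 2 :=
      sq_le_sq' (abs_le.1 (h2 n le_rfl)).1 (abs_le.1 (h2 n le_rfl)).2
    nlinarith [neg_abs_le A, sq_nonneg (X (s 0) ω)]
  refine (measure_mono hsub).trans ((measure_union_le _ _).trans ((add_le_add (hb n s hst)
    h1).trans ?_))
  rw [← ENNReal.ofReal_add (by positivity) (by positivity), add_halves]

/-- A discrete Itô formula for `x / z`: two first-order terms with coefficients known at the left
endpoint, and an exact remainder of second order. -/
theorem mul_inv_sub_mul_inv {x x' z z' : ℝ} (hz : z ≠ 0) (hz' : z' ≠ 0) :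
    x' * z'⁻¹ - x * z⁻¹ = z⁻¹ * (x' - x) - x * z⁻¹ ^ 2 * (z' - z) +
      (x' * z⁻¹ ^ 2 * z'⁻¹ * (z' - z) ^ 2 - z⁻¹ ^ 2 * ((x' - x) * (z' - z))) := by
  field_simp
  ring

theorem abs_quotient_remainder_le {x x' z z' c : ℝ} (hx' : |x'| ≤ c) (hz : |z⁻¹| ≤ c)
    (hz' : |z'⁻¹| ≤ c) :
    |x' * z⁻¹ ^ 2 * z'⁻¹ * (z' - z) ^ 2 - z⁻¹ ^ 2 * ((x' - x) * (z' - z))| ≤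
      c ^ 4 * (z' - z) ^ 2 + c ^ 2 * ((x' - x) ^ 2 + (z' - z) ^ 2) := by
  have hc : 0 ≤ c := (abs_nonneg _).trans hx'
  have h1 : |x' * z⁻¹ ^ 2 * z'⁻¹ * (z' - z) ^ 2| ≤ c ^ 4 * (z' - z) ^ 2 := by
    rw [abs_mul, abs_mul, abs_mul, abs_pow, abs_of_nonneg (sq_nonneg (z' - z)),
      show c ^ 4 = c * c ^ 2 * c by ring]
    gcongr
  have h2 : |z⁻¹ ^ 2 * ((x' - x) * (z' - z))| ≤ c ^ 2 * ((x' - x) ^ 2 + (z' - z) ^ 2) := by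
    rw [abs_mul, abs_pow]
    have h3 : |(x' - x) * (z' - z)| ≤ (x' - x) ^ 2 + (z' - z) ^ 2 := by
      rw [abs_le]
      constructor <;> nlinarith [sq_nonneg (x' - x + (z' - z)), sq_nonneg (x' - x - (z' - z)),
        sq_nonneg (x' - x), sq_nonneg (z' - z)]
    gcongr
  exact (abs_sub _ _).trans (add_le_add h1 h2)

/-- Quotients of grid integrators are grid integrators. -/
theorem IsGridIntegrator.mul_inv {X Z : ℝ≥0 → Ω → ℝ} (hX : IsGridIntegrator F μ X)
    (hZ : IsGridIntegrator F μ Z) (hXm : ∀ t, Measurable[F t] (X t))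
    (hZm : ∀ t, Measurable[F t] (Z t)) (hXb : IsGridBounded μ X) (hZb : IsGridBounded μ Z)
    (hZib : IsGridBounded μ fun t ω => (Z t ω)⁻¹) (h0 : ∀ᵐ ω ∂μ, ∀ t, Z t ω ≠ 0) :
    IsGridIntegrator F μ fun t ω => X t ω * (Z t ω)⁻¹ := by
  intro t ε hε
  -- Six exceptional events of measure at most `ε / 8` each; off them two grid integrals and the
  -- remainder each contribute at most `ε / 8`.
  have hη : 0 < ε / 8 := by positivity
  obtain ⟨c₁, hc₁, hb₁⟩ := hXb t _ hη
  obtain ⟨c₂, hc₂, hb₂⟩ := hZib t _ hη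
  obtain ⟨K₁, hK₁, hq₁⟩ := hX.exists_measure_sum_sq_le hXm hXb t hη
  obtain ⟨K₂, hK₂, hq₂⟩ := hZ.exists_measure_sum_sq_le hZm hZb t hη
  obtain ⟨δ₁, hδ₁, hi₁⟩ := hX t _ hη
  obtain ⟨δ₂, hδ₂, hi₂⟩ := hZ t _ hη
  set c := max c₁ c₂ with hc
  have hc0 : 0 < c := lt_max_of_lt_left hc₁
  set R := c ^ 4 * K₂ + c ^ 2 * (K₁ + K₂) with hR
  have hR0 : 0 < R := by positivity
  set δ := min (δ₁ / c) (min (δ₂ / (c * c ^ 2)) (ε / 8 / R)) with hδdef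
  have hδ : 0 < δ := by positivity
  have hδ1 : δ * c ≤ δ₁ := (le_div_iff₀ hc0).1 (min_le_left _ _)
  have hδ2 : δ * (c * c ^ 2) ≤ δ₂ :=
    (le_div_iff₀ (by positivity)).1 ((min_le_right _ _).trans (min_le_left _ _))
  have hδ3 : δ * R ≤ ε / 8 :=
    (le_div_iff₀ hR0).1 ((min_le_right _ _).trans (min_le_right _ _))
  refine ⟨δ, hδ, fun n s hs hst h hm hb => ?_⟩
  set h₁ : ℕ → Ω → ℝ := fun k ω => h k ω * truncate c (Z (s k) ω)⁻¹ with hh₁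
  set h₂ : ℕ → Ω → ℝ := fun k ω =>
    h k ω * (truncate c (X (s k) ω) * truncate c (Z (s k) ω)⁻¹ ^ 2) with hh₂
  have e₁ := hi₁ n s hs hst h₁
    (fun k => (hm k).mul ((measurable_truncate c).comp (hZm (s k)).inv)) fun k ω => by
      rw [hh₁, abs_mul]
      exact (mul_le_mul (hb k ω) (abs_truncate_le hc0.le _) (abs_nonneg _) hδ.le).trans hδ1
  have e₂ := hi₂ n s hs hst h₂
    (fun k => (hm k).mul (((measurable_truncate c).comp (hXm (s k))).mul
      (((measurable_truncate c).comp (hZm (s k)).inv).pow_const 2))) fun k ω => by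
      rw [hh₂, abs_mul, abs_mul, abs_pow]
      refine (mul_le_mul (hb k ω) (mul_le_mul (abs_truncate_le hc0.le _)
        (pow_le_pow_left₀ (abs_nonneg _) (abs_truncate_le hc0.le _) 2) (by positivity) hc0.le)
        (by positivity) hδ.le).trans hδ2
  set A₁ := {ω | ∃ k ≤ n, c₁ < |X (s k) ω|}
  set A₂ := {ω | ∃ k ≤ n, c₂ < |(Z (s k) ω)⁻¹|}
  set A₃ := {ω | K₁ < ∑ k ∈ Finset.range n, (X (s (k + 1)) ω - X (s k) ω) ^ 2}
  set A₄ := {ω | K₂ < ∑ k ∈ Finset.range n, (Z (s (k + 1)) ω - Z (s k) ω) ^ 2}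
  set A₅ := {ω | ε / 8 ≤ |gridIntegral n s h₁ X ω|}
  set A₆ := {ω | ε / 8 ≤ |gridIntegral n s h₂ Z ω|}
  have hsub : ∀ᵐ ω ∂μ, ε ≤ |gridIntegral n s h (fun t ω => X t ω * (Z t ω)⁻¹) ω| →
      ω ∈ ((A₁ ∪ A₂) ∪ (A₃ ∪ A₄)) ∪ (A₅ ∪ A₆) := by
    filter_upwards [h0] with ω hz hω
    by_contra hcon
    simp only [A₁, A₂, A₃, A₄, A₅, A₆, mem_union, mem_ofPred_eq, not_or, not_exists, not_and,
      not_lt, not_le] at hcon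
    obtain ⟨⟨⟨a1, a2⟩, a3, a4⟩, a5, a6⟩ := hcon
    have b1 : ∀ k ≤ n, |X (s k) ω| ≤ c := fun k hk => (a1 k hk).trans (le_max_left _ _)
    have b2 : ∀ k ≤ n, |(Z (s k) ω)⁻¹| ≤ c := fun k hk => (a2 k hk).trans (le_max_right _ _)
    set r : ℕ → ℝ := fun k =>
      X (s (k + 1)) ω * (Z (s k) ω)⁻¹ ^ 2 * (Z (s (k + 1)) ω)⁻¹ *
        (Z (s (k + 1)) ω - Z (s k) ω) ^ 2 -
      (Z (s k) ω)⁻¹ ^ 2 * ((X (s (k + 1)) ω - X (s k) ω) * (Z (s (k + 1)) ω - Z (s k) ω)) with hr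
    have hdecomp : gridIntegral n s h (fun t ω => X t ω * (Z t ω)⁻¹) ω =
        gridIntegral n s h₁ X ω - gridIntegral n s h₂ Z ω +
          ∑ k ∈ Finset.range n, h k ω * r k := by
      simp only [gridIntegral]
      rw [← Finset.sum_sub_distrib, ← Finset.sum_add_distrib]
      refine Finset.sum_congr rfl fun k hk => ?_
      have hk' := (Finset.mem_range.1 hk).le
      rw [mul_inv_sub_mul_inv (hz (s k)) (hz (s (k + 1)))]
      simp only [hh₁, hh₂, hr, truncate_eq_self (b1 k hk'), truncate_eq_self (b2 k hk')]
      ring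
    have hrem : |∑ k ∈ Finset.range n, h k ω * r k| ≤ δ * R := by
      calc |∑ k ∈ Finset.range n, h k ω * r k|
          ≤ ∑ k ∈ Finset.range n, |h k ω * r k| := Finset.abs_sum_le_sum_abs _ _
        _ ≤ ∑ k ∈ Finset.range n, δ * (c ^ 4 * (Z (s (k + 1)) ω - Z (s k) ω) ^ 2 +
            c ^ 2 * ((X (s (k + 1)) ω - X (s k) ω) ^ 2 +
              (Z (s (k + 1)) ω - Z (s k) ω) ^ 2)) := by
          refine Finset.sum_le_sum fun k hk => ?_
          have hk' := Finset.mem_range.1 hk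
          rw [abs_mul]
          exact mul_le_mul (hb k ω) (abs_quotient_remainder_le (b1 (k + 1) hk') (b2 k hk'.le)
            (b2 (k + 1) hk')) (abs_nonneg _) hδ.le
        _ = δ * (c ^ 4 * (∑ k ∈ Finset.range n, (Z (s (k + 1)) ω - Z (s k) ω) ^ 2) +
            c ^ 2 * ((∑ k ∈ Finset.range n, (X (s (k + 1)) ω - X (s k) ω) ^ 2) +
              ∑ k ∈ Finset.range n, (Z (s (k + 1)) ω - Z (s k) ω) ^ 2)) := by
          simp only [Finset.mul_sum, ← Finset.sum_add_distrib]
        _ ≤ δ * R := mul_le_mul_of_nonneg_left (by rw [hR]; gcongr) hδ.le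
    rw [hdecomp] at hω
    have t1 := abs_add_le (gridIntegral n s h₁ X ω - gridIntegral n s h₂ Z ω)
      (∑ k ∈ Finset.range n, h k ω * r k)
    have t2 := abs_sub (gridIntegral n s h₁ X ω) (gridIntegral n s h₂ Z ω)
    linarith
  refine (measure_mono_ae hsub).trans ?_
  have u : ∀ {A B : Set Ω} {a b : ℝ}, 0 ≤ a → 0 ≤ b → μ A ≤ ENNReal.ofReal a →
      μ B ≤ ENNReal.ofReal b → μ (A ∪ B) ≤ ENNReal.ofReal (a + b) := by
    intro A B a b ha hb hA hB
    rw [ENNReal.ofReal_add ha hb]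
    exact (measure_union_le _ _).trans (add_le_add hA hB)
  have hη' := hη.le
  refine (u (by positivity) (by positivity) (u (by positivity) (by positivity)
    (u hη' hη' (hb₁ n s hst) (hb₂ n s hst)) (u hη' hη' (hq₁ n s hs hst) (hq₂ n s hs hst)))
    (u hη' hη' e₁ e₂)).trans (ENNReal.ofReal_le_ofReal (by linarith))

end Quotient

end LongForward

/-! ### The long bond -/

namespace LongForward

theorem isRCLL_const (c : ℝ) : IsRCLL fun _ => c :=
  ⟨fun _ => continuousWithinAt_const, fun _ _ => ⟨c, tendsto_const_nhds⟩⟩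

/-- A path which agrees on each interval `[kT, (k + 1)T)` with a path that is right-continuous with
left limits has this property too. -/
theorem isRCLL_floor {T : ℝ≥0} (hT : 0 < T) {g : ℕ → ℝ≥0 → ℝ} (hg : ∀ k, IsRCLL (g k)) :
    IsRCLL fun t => g ⌊t / T⌋₊ t := by
  have hfloor : ∀ (k : ℕ) (s : ℝ≥0), (k : ℝ≥0) * T ≤ s → s < ((k : ℝ≥0) + 1) * T →
      ⌊s / T⌋₊ = k := by
    intro k s h1 h2
    rw [Nat.floor_eq_iff zero_le, le_div_iff₀ hT, div_lt_iff₀ hT]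
    exact ⟨h1, h2⟩
  refine ⟨fun t => ?_, fun t ht => ?_⟩
  · have h1 : (⌊t / T⌋₊ : ℝ≥0) * T ≤ t := (le_div_iff₀ hT).1 (Nat.floor_le zero_le)
    have h2 : t < ((⌊t / T⌋₊ : ℝ≥0) + 1) * T := (div_lt_iff₀ hT).1 (Nat.lt_floor_add_one _)
    refine ((hg ⌊t / T⌋₊).1 t).congr_of_eventuallyEq ?_ rfl
    filter_upwards [Ico_mem_nhdsGE h2] with s hs
    rw [hfloor _ s (h1.trans hs.1) hs.2]
  -- The ceiling less one, and not the floor, gives the interval just to the left of `t` when `t` is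
  -- a multiple of `T`.
  · obtain ⟨k, hk⟩ : ∃ k, ⌈t / T⌉₊ = k + 1 :=
      Nat.exists_eq_succ_of_ne_zero (Nat.ceil_pos.2 (div_pos ht hT)).ne'
    have h1 : (k : ℝ≥0) * T < t := by
      rw [← lt_div_iff₀ hT, ← Nat.lt_ceil, hk]
      exact Nat.lt_succ_self k
    have h2 : t ≤ ((k : ℝ≥0) + 1) * T := by
      rw [← div_le_iff₀ hT]
      have := Nat.le_ceil (t / T)
      rw [hk] at this
      exact_mod_cast this
    obtain ⟨l, hl⟩ := (hg k).2 t ht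
    refine ⟨l, hl.congr' ?_⟩
    filter_upwards [Ioo_mem_nhdsLT h1] with s hs
    rw [hfloor k s hs.1.le (hs.2.trans_le h2)]

namespace BorelRightProc

variable {E Ω : Type*} [MetricSpace E] [MeasurableSpace E] [BorelSpace E]
  [mΩ : MeasurableSpace Ω]

/-- A version of `E_x[S_T | F_t]`, `t ≤ T`, with paths which are right-continuous with left
limits. -/
noncomputable def condPrice (𝒳 : BorelRightProc E Ω) (S : ℝ≥0 → Ω → ℝ) (x : E) (T : ℝ≥0) :
    ℝ≥0 → Ω → ℝ :=
  dyadicLim fun t => (𝒳.P x)[S T | 𝒳.F.rightCont t]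

/-- The version of the roll-over process with paths which are right-continuous with left limits. -/
noncomputable def rolloverVersion (𝒳 : BorelRightProc E Ω) (S : ℝ≥0 → Ω → ℝ) (x : E) (T t : ℝ≥0)
    (ω : Ω) : ℝ :=
  (∏ i ∈ Finset.range (⌊t / T⌋₊ + 1), 𝒳.zeroCoupon S x ((i + 1 : ℕ) * T) (i * T) ω)⁻¹ *
    (𝒳.condPrice S x ((⌊t / T⌋₊ + 1 : ℕ) * T) t ω * (S t ω)⁻¹)

/-- The version of `M_t^π / S_t` with paths which are right-continuous with left limits. -/
noncomputable def longBond (𝒳 : BorelRightProc E Ω) (S : ℝ≥0 → Ω → ℝ) (lam : ℝ) (π : E → ℝ)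
    (t : ℝ≥0) (ω : Ω) : ℝ :=
  dyadicLim (𝒳.eigenMartingale S lam π) t ω * (S t ω)⁻¹

variable {𝒳 : BorelRightProc E Ω} {S : ℝ≥0 → Ω → ℝ} {lam : ℝ} {π : E → ℝ}

theorem martingale_condExp_rightCont (x : E) (T : ℝ≥0) :
    Martingale (fun t => (𝒳.P x)[S T | 𝒳.F.rightCont t]) 𝒳.F.rightCont (𝒳.P x) :=
  martingale_condExp _ _ _

theorem ae_isRCLL_condPrice (x : E) (T : ℝ≥0) :
    ∀ᵐ ω ∂𝒳.P x, IsRCLL fun t => 𝒳.condPrice S x T t ω :=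
  ae_isRCLL_dyadicLim (martingale_condExp_rightCont x T)

namespace IsMarkovianPricingKernel

variable (hS : 𝒳.IsMarkovianPricingKernel S)
include hS

theorem ae_isRCLL_inv (x : E) : ∀ᵐ ω ∂𝒳.P x, IsRCLL fun t => (S t ω)⁻¹ := by
  filter_upwards [(hS.semimartingale x).rcll, hS.multiplicative.pos x, hS.left_limits_pos x]
    with ω h1 h2 h3 using h1.inv h2 h3

theorem condPrice_ae_eq {t T : ℝ≥0} (htT : t ≤ T) (x : E) :
    𝒳.condPrice S x T t =ᵐ[𝒳.P x] (𝒳.P x)[S T | 𝒳.F t] :=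
  (dyadicLim_ae_eq (martingale_condExp_rightCont x T) t).trans
    ((hS.condExp_rightCont htT x).trans (hS.condExp_F htT x).symm)

theorem isRolloverProc_rolloverVersion (x : E) {T : ℝ≥0} (hT : 0 < T) :
    𝒳.IsRolloverProc S x T (𝒳.rolloverVersion S x T) := by
  refine ⟨?_, fun t => ?_⟩
  · filter_upwards [hS.ae_isRCLL_inv x,
      ae_all_iff.2 fun k : ℕ => ae_isRCLL_condPrice (S := S) x ((k + 1 : ℕ) * T)] with ω h1 h2
    exact isRCLL_floor hT (g := fun k t =>
      (∏ i ∈ Finset.range (k + 1), 𝒳.zeroCoupon S x ((i + 1 : ℕ) * T) (i * T) ω)⁻¹ *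
        (𝒳.condPrice S x ((k + 1 : ℕ) * T) t ω * (S t ω)⁻¹)) fun k =>
      (isRCLL_const _).mul ((h2 k).mul h1)
  · have h1 : t ≤ ((⌊t / T⌋₊ + 1 : ℕ) : ℝ≥0) * T := by
      rw [← div_le_iff₀ hT]
      push_cast
      exact (Nat.lt_floor_add_one _).le
    filter_upwards [hS.condPrice_ae_eq h1 x] with ω h2
    simp only [rolloverVersion, rollover, h2, zeroCoupon, div_eq_mul_inv (_ : ℝ)]

/-- Only the conditional expectation at time `0` has to be identified, so a single null set serves
all `s < T`. -/
theorem rolloverVersion_eq (x : E) (T : ℝ≥0) : ∀ᵐ ω ∂𝒳.P x, ∀ s < T,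
    𝒳.rolloverVersion S x T s ω =
      𝒳.condPrice S x T s ω * (𝒳.bondPrice S T x)⁻¹ * (S s ω)⁻¹ := by
  filter_upwards [hS.condExp_F (zero_le (a := T)) x, 𝒳.X_zero x, hS.multiplicative.zero x]
    with ω h1 h2 h3 s hs
  have hk : ⌊s / T⌋₊ = 0 := by
    rw [Nat.floor_eq_zero, div_lt_one (zero_le.trans_lt hs)]
    exact hs
  have h5 : ((𝒳.P x)[S T | 𝒳.F 0]) ω = 𝒳.bondPrice S T x := by
    rw [h1, h2, h3, one_mul, tsub_zero]
  simp only [rolloverVersion, zeroCoupon, hk]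
  simp only [zero_add, Finset.range_one, Finset.prod_singleton, Nat.cast_one, one_mul,
    Nat.cast_zero, zero_mul, h5, h3, div_one]
  ring

end IsMarkovianPricingKernel

namespace HasLongTermLimit

variable (h : 𝒳.HasLongTermLimit S lam π)
include h

theorem dyadicLim_eigenMartingale_ae_eq (t : ℝ≥0) (x : E) :
    dyadicLim (𝒳.eigenMartingale S lam π) t =ᵐ[𝒳.P x] 𝒳.eigenMartingale S lam π t :=
  dyadicLim_ae_eq (h.martingale_rightCont x) t

theorem ae_isRCLL_longBond (x : E) : ∀ᵐ ω ∂𝒳.P x, IsRCLL fun t => 𝒳.longBond S lam π t ω := by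
  filter_upwards [ae_isRCLL_dyadicLim (h.martingale_rightCont x), h.kernel.ae_isRCLL_inv x]
    with ω h1 h2 using h1.mul h2

theorem longBond_pos (x : E) : ∀ᵐ ω ∂𝒳.P x, ∀ t, 0 < 𝒳.longBond S lam π t ω := by
  filter_upwards [ae_dyadicLim_pos (h.martingale_rightCont x) fun t =>
    (h.eigenMartingale_pos x).mono fun ω hω => hω t, h.kernel.multiplicative.pos x]
    with ω h1 h2 t using mul_pos (h1 t) (inv_pos.2 (h2 t))

theorem longBond_ae_eq (t : ℝ≥0) (x : E) : ∀ᵐ ω ∂𝒳.P x,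
    𝒳.longBond S lam π t ω = Real.exp (lam * t) * π (𝒳.X t ω) / π x := by
  filter_upwards [h.dyadicLim_eigenMartingale_ae_eq t x, 𝒳.X_zero x,
    h.kernel.multiplicative.pos x] with ω h1 h2 h3
  have h4 := (h3 t).ne'
  rw [longBond, h1, eigenMartingale, h2]
  field_simp

/-- A positive martingale divided by the semimartingale `S`. The positive left limits of `S` enter
through the boundedness of `1 / S` in probability. -/
theorem isSemimartingale_longBond (x : E) :
    IsSemimartingale 𝒳.F (𝒳.P x) (𝒳.longBond S lam π) := by
  have hSm := h.kernel.semimartingale x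
  have hMm := h.measurable_eigenMartingale
  have hgrid := (isGridIntegrator_of_martingale (h.martingale x) fun t =>
    (h.eigenMartingale_pos x).mono fun ω hω => (hω t).le).mul_inv hSm.isGridIntegrator hMm
    h.kernel.measurable_F
    (isGridBounded_of_isRCLL (ae_isRCLL_dyadicLim (h.martingale_rightCont x))
      (fun t => h.dyadicLim_eigenMartingale_ae_eq t x) fun t => (hMm t).mono (𝒳.F.le t) le_rfl)
    (isGridBounded_of_isRCLL hSm.rcll (fun t => Filter.EventuallyEq.rfl) h.kernel.measurable)
    (isGridBounded_of_isRCLL (h.kernel.ae_isRCLL_inv x) (fun t => Filter.EventuallyEq.rfl)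
      fun t => (h.kernel.measurable t).inv)
    ((h.kernel.multiplicative.pos x).mono fun ω hω t => (hω t).ne')
  refine hgrid.isSemimartingale (fun t => (hMm t).mul (h.kernel.measurable_F t).inv)
    (h.ae_isRCLL_longBond x) (fun t => ?_) zero_le_one ?_
  · filter_upwards [h.dyadicLim_eigenMartingale_ae_eq t x] with ω hω
    rw [longBond, hω]
  · filter_upwards [h.longBond_ae_eq 0 x, 𝒳.X_zero x] with ω h1 h2
    rw [h1, h2]
    simp [(h.pos x).ne']

/-- The normalized martingales `E_x[S_T | F_t] / E_x[S_T]` converge to `M^π`, in `L¹`. -/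
theorem eventually_integral_abs_le (n : ℝ≥0) (x : E) {a : ℝ} (ha : 0 < a) : ∀ᶠ T : ℝ≥0 in atTop,
    ∫ ω, |((𝒳.P x)[S T | 𝒳.F.rightCont n]) ω * (𝒳.bondPrice S T x)⁻¹ -
      𝒳.eigenMartingale S lam π n ω| ∂𝒳.P x ≤ a := by
  have h1 := (h.tendsto_eLpNorm n x).eventually
    (ge_mem_nhds (show (0 : ℝ≥0∞) < ENNReal.ofReal a by simpa using ha))
  filter_upwards [h1, eventually_ge_atTop n] with T hT hnT
  have h2 : ∫ ω, |((𝒳.P x)[S T | 𝒳.F.rightCont n]) ω * (𝒳.bondPrice S T x)⁻¹ -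
      𝒳.eigenMartingale S lam π n ω| ∂𝒳.P x =
      ∫ ω, ‖((fun ω => ((𝒳.P x)[S T | 𝒳.F n]) ω / 𝒳.bondPrice S T x) -
      𝒳.eigenMartingale S lam π n) ω‖ ∂𝒳.P x := by
    refine integral_congr_ae ?_
    filter_upwards [h.kernel.condExp_rightCont hnT x, h.kernel.condExp_F hnT x] with ω h3 h4
    rw [h3, Pi.sub_apply, h4, Real.norm_eq_abs, div_eq_mul_inv]
  rw [h2, ← ENNReal.ofReal_le_ofReal_iff ha.le, ofReal_integral_norm_eq_lintegral_enorm
    ((integrable_ratio T n x).sub (h.integrable_eigenMartingale n x)),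
    ← eLpNorm_one_eq_lintegral_enorm]
  exact hT

/-- For `T > t` the difference of the two bonds is `W / S`, where `W` is a regular version of the
martingale `D`. The factor `1 / S` stays below `c` off an event of measure `r / 2`, and Doob's
inequality makes `W` exceed `K / c` with probability at most `r / 2`. -/
theorem tendstoUCP_rolloverVersion (x : E) :
    TendstoUCP (𝒳.P x) (𝒳.rolloverVersion S x) (𝒳.longBond S lam π) := by
  intro t K hK
  rw [ENNReal.tendsto_nhds_zero]
  intro ε hε
  obtain ⟨r, hr0, hr⟩ := ENNReal.lt_iff_exists_nnreal_btwn.1 hε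
  have hr0 : (0 : ℝ) < r := by exact_mod_cast hr0
  obtain ⟨c, hc, hcb⟩ := exists_measure_lt_le (h.kernel.ae_isRCLL_inv x)
    (fun t => Filter.EventuallyEq.rfl) (fun t => (h.kernel.measurable t).inv) t
    (show 0 < (r : ℝ) / 2 by positivity)
  obtain ⟨n, hn⟩ := exists_nat_ge t
  filter_upwards [h.eventually_integral_abs_le n x (show 0 < (r : ℝ) / 2 * (K / c) by positivity),
    eventually_gt_atTop t] with T hT htT
  set D : ℝ≥0 → Ω → ℝ := fun s ω => ((𝒳.P x)[S T | 𝒳.F.rightCont s]) ω *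
    (𝒳.bondPrice S T x)⁻¹ - 𝒳.eigenMartingale S lam π s ω with hD
  set W : ℝ≥0 → Ω → ℝ := fun s ω => 𝒳.condPrice S x T s ω * (𝒳.bondPrice S T x)⁻¹ -
    dyadicLim (𝒳.eigenMartingale S lam π) s ω with hW
  have hDm : Martingale D 𝒳.F.rightCont (𝒳.P x) := by
    have h1 := ((martingale_condExp_rightCont (𝒳 := 𝒳) (S := S) x T).smul
      (𝒳.bondPrice S T x)⁻¹).sub (h.martingale_rightCont x)
    convert h1 using 1
    ext s ω
    simp [hD, mul_comm]
  have hWrc : ∀ᵐ ω ∂𝒳.P x, ∀ s, ContinuousWithinAt (fun u => W u ω) (Ici s) s := by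
    filter_upwards [ae_isRCLL_condPrice (S := S) x T,
      ae_isRCLL_dyadicLim (h.martingale_rightCont x)] with ω h1 h2
    exact ((h1.mul (isRCLL_const _)).sub h2).1
  have hWD : ∀ s, W s =ᵐ[𝒳.P x] D s := by
    intro s
    filter_upwards [dyadicLim_ae_eq (martingale_condExp_rightCont (𝒳 := 𝒳) (S := S) x T) s,
      h.dyadicLim_eigenMartingale_ae_eq s x] with ω h1 h2
    simp only [hW, hD, h2, condPrice, h1]
  have hWb : 𝒳.P x {ω | ∃ s ≤ t, K / c < |W s ω|} ≤ ENNReal.ofReal ((r : ℝ) / 2) := by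
    refine ((measure_exists_lt_le_dyadics hWrc hWD hn _).trans
      (measure_exists_dyadic_lt_le hDm n (show 0 < K / c by positivity))).trans
      (ENNReal.ofReal_le_ofReal ?_)
    rw [div_le_iff₀ (by positivity)]
    exact hT
  have hsub : ∀ᵐ ω ∂𝒳.P x,
      (∃ s ≤ t, K < |𝒳.rolloverVersion S x T s ω - 𝒳.longBond S lam π s ω|) →
      ω ∈ {ω | ∃ s ≤ t, c < |(S s ω)⁻¹|} ∪ {ω | ∃ s ≤ t, K / c < |W s ω|} := by
    filter_upwards [h.kernel.rolloverVersion_eq x T] with ω h1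
    rintro ⟨s, hs, hsK⟩
    by_contra hcon
    simp only [mem_union, mem_ofPred_eq, not_or, not_exists, not_and, not_lt] at hcon
    have h2 : 𝒳.rolloverVersion S x T s ω - 𝒳.longBond S lam π s ω = W s ω * (S s ω)⁻¹ := by
      rw [h1 s (hs.trans_lt htT), longBond, hW]
      ring
    rw [h2, abs_mul] at hsK
    have h3 := mul_le_mul (hcon.2 s hs) (hcon.1 s hs) (abs_nonneg _) (by positivity)
    rw [div_mul_cancel₀ _ hc.ne'] at h3
    exact absurd hsK (not_lt.2 h3)
  refine ((measure_mono_ae hsub).trans ((measure_union_le _ _).trans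
    (add_le_add hcb hWb))).trans (le_trans ?_ hr.le)
  rw [← ENNReal.ofReal_add (by positivity) (by positivity), add_halves, ENNReal.ofReal_coe_nnreal]

theorem isLongBond (x : E) : 𝒳.IsLongBond S x (𝒳.longBond S lam π) :=
  ⟨h.isSemimartingale_longBond x, h.longBond_pos x, 𝒳.rolloverVersion S x,
    fun _ hT => h.kernel.isRolloverProc_rolloverVersion x hT, h.tendstoUCP_rolloverVersion x⟩

end HasLongTermLimit

/-- The exponent and the eigenfunction of a pricing kernel with long-term limits. -/
theorem exists_hasLongTermLimit [Nonempty E] (hS : 𝒳.IsMarkovianPricingKernel S)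
    (hL1 : ∀ x, 𝒳.LongTermL1 S x)
    (hlim : ∀ t : ℝ≥0, 0 < t → ∀ x y : E, ∃ b : ℝ, 0 < b ∧
      Tendsto (fun T : ℝ≥0 => 𝒳.bondPrice S (T - t) y / 𝒳.bondPrice S T x) atTop (𝓝 b)) :
    ∃ (lam : ℝ) (π : E → ℝ), 𝒳.HasLongTermLimit S lam π := by
  obtain ⟨lam, π, h1, h2, h3⟩ := hS.exists_limit_data hlim
  exact ⟨lam, π, hS, hL1, h1, h2, h3⟩

end BorelRightProc

end LongForward

theorem theorem4p1 {E Ω : Type*} [MetricSpace E] [MeasurableSpace E] [BorelSpace E]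
    [MeasurableSpace Ω] (𝒳 : LongForward.BorelRightProc E Ω) (S : ℝ≥0 → Ω → ℝ)
    (hS : 𝒳.IsMarkovianPricingKernel S)
    (hL1 : ∀ x, 𝒳.LongTermL1 S x)
    (hlim : ∀ t : ℝ≥0, 0 < t → ∀ x y : E, ∃ b : ℝ, 0 < b ∧
      Tendsto (fun T : ℝ≥0 => 𝒳.bondPrice S (T - t) y / 𝒳.bondPrice S T x) atTop (𝓝 b)) :
    ∃ (lam : ℝ) (π : E → ℝ),
      𝒳.IsPosEigenfunction S lam π ∧
      𝒳.IsPosMultiplicativeFunctional (𝒳.transitionIndependent lam π) ∧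
      (∀ x, ∃ B : ℝ≥0 → Ω → ℝ, 𝒳.IsLongBond S x B ∧
        ∀ t : ℝ≥0, ∀ᵐ ω ∂𝒳.P x, B t ω = Real.exp (lam * t) * π (𝒳.X t ω) / π x) ∧
      𝒳.HasEigenFactorization S lam π ∧
      ∀ x, 𝒳.IsLongForwardMeasure S x (𝒳.eigenMeasure S lam π x) := by
  obtain ⟨lam, π, h⟩ : ∃ (lam : ℝ) (π : E → ℝ), 𝒳.HasLongTermLimit S lam π := by
    -- Without a reference point `x₀` the eigenfunction cannot be normalized; on an empty state
    -- space any choice will do.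
    cases isEmpty_or_nonempty E
    · exact ⟨0, fun _ => 1, hS, hL1, fun x => isEmptyElim x, fun _ _ => aemeasurable_const,
        fun _ x => isEmptyElim x⟩
    · exact LongForward.BorelRightProc.exists_hasLongTermLimit hS hL1 hlim
  exact ⟨lam, π, h.isPosEigenfunction, h.isPosMultiplicativeFunctional_transitionIndependent,
    fun x => ⟨𝒳.longBond S lam π, h.isLongBond x, fun t => h.longBond_ae_eq t x⟩,
    h.hasEigenFactorization, h.isLongForwardMeasure⟩
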